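/- **Setting.** Let $I\subset\mathbb R$ be an open interval, $z_1,\dots,z_m:I\to\mathbb C$ differentiable functions with pairwise distinct values at each $t$, $m\ge 2$, one of which is identically $0$, and let $\rho_1,\dots,\rho_m\in\mathbb C\setminus\mathbb Z_{\ge 0}$ be constants. Put $W(z)=\prod_{j}(z-z_j(t))$ and let $V$ be the polynomial with $2V/W=\sum_j\rho_j/(z-z_j(t))$. Let $D\subset\mathbb R\times\mathbb C$ be open and write $D_t=\{z:(t,z)\in D\}$ ("the cut plane"). Let $w(z)=w(z;t)$ be a regular semi-classical weight: for each $t\in I$ it is analytic and nowhere zero on $D_t$, and on $D$ $$Ww'=2Vw,\qquad \frac{\dot w}{w}=-\sum_{j=1}^m\rho_j\frac{\dot z_j}{z-z_j},$$ so that $w$ is a branch of $\prod_j(z-z_j)^{\rho_j}$ up to locally constant factors. Assume that $D_t$ contains every point of the unit circle $\mathbb T$ other than the $z_k(t)$, and that $\Re\rho_k>0$ whenever $z_k(t)\in\mathbb T$ for some $t\in I$. For a weight $w$ let $(\phi_n,\bar\phi_n)_{n\ge0}$ be a bi-orthonormal system: polynomials of degree $n$ with a common leading coefficient $\kappa_n$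 and $\int_{\mathbb T}\frac{d\zeta}{2\pi i\zeta}w(\zeta)\phi_k(\zeta)\bar\phi_n(\bar\zeta)=\delta_{k,n}$. Put $\phi_n^*(z)=z^n\bar\phi_n(1/z)$, $F(z)=\int_{\mathbb T}\frac{d\zeta}{2\pi i\zeta}\frac{\zeta+z}{\zeta-z}w(\zeta)$, $$\psi_n(z)=\int_{\mathbb T}\frac{d\zeta}{2\pi i\zeta}\frac{\zeta+z}{\zeta-z}w(\zeta)[\phi_n(\zeta)-\phi_n(z)],\quad \psi_n^*(z)=-\int_{\mathbb T}\frac{d\zeta}{2\pi i\zeta}\frac{\zeta+z}{\zeta-z}w(\zeta)[z^n\bar\phi_n(\bar\zeta)-\phi_n^*(z)]\quad(n\ge1),$$ $\psi_0=\psi_0^*=1/\kappa_0$, $\epsilon_n=\psi_n+F\phi_n$, $\epsilon_n^*=\psi_n^*-F\phi_n^*$, and $$Y_n=\begin{pmatrix}\phi_n&\epsilon_n/w\\ \phi_n^*&-\epsilon_n^*/w\end{pmatrix}.$$ **Proposition.** (a) Let $1\le j\le m$ and let $b(t)=z_j(t)+\delta(t)$ be a base point depending continuously on $t\in I$ with $b(t)\in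 D_t\setminus\mathbb T$ and $|\delta(t)|<\min_{k\ne j}|z_k(t)-z_j(t)|$. There is a constant $C_j$, independent of $t$ (and of $n$), such that for every $t\in I$: * near $b(t)$ one has $F=f_j+C_jw$ with $f_j$ holomorphic in the disc $|z-z_j|<\min_{k\neq j}|z_k-z_j|$; * for every bi-orthonormal system of $w(\cdot\,;t)$ and every $n\ge 0$, the germ of $Y_n$ at $b(t)$ can be continued analytically once around the circle about $z_j$ through $b(t)$, in the positive direction, and turns into $Y_nM_j$ with the uniquely determined monodromy matrix $$M_j=\begin{pmatrix}1&C_j(1-e^{-2\pi i\rho_j})\\0&e^{-2\pi i\rho_j}\end{pmatrix}.$$ (b) The same holds at $z_\infty=\infty$ with $\rho_\infty=-\sum_j\rho_j$: for a continuous base point $b(t)\in D_t\setminus\mathbb T$ with $|b(t)|>\max_k|z_k(t)|$, there is a constant $C_\infty$, independent of $t$ and $n$, such that for every $t\in I$ one has $F=f_\infty+C_\infty w$ near $b(t)$, with $f_\infty$ holomorphic in $|z|>\max_k|z_k|$ and having a finite limit at $\infty$; and, for every bi-orthonormal system and every $n\ge0$, continuation of $Y_n$ along the circle about $0$ through $b(t)$,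 positively oriented with respect to the local coordinate $1/z$, exists and has the uniquely determined monodromy matrix $M_\infty=\begin{pmatrix}1&C_\infty(1-e^{-2\pi i\rho_\infty})\\0&e^{-2\pi i\rho_\infty}\end{pmatrix}$. In particular all the matrices $M_j$, $j=1,\dots,m,\infty$, are upper triangular and independent of $t$, $\dot M_j=0$: the deformation is isomonodromic. -/

import Mathlib

open Polynomial Filter Topology Set

noncomputable section

namespace Semiclassical

/-! ### Bi-orthogonal polynomials on the unit circle -/

/-- The normalised integral `∫_𝕋 g(ζ) dζ / (2πiζ)` over the unit circle. -/
def circleMean (g : ℂ → ℂ) : ℂ :=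
  (2 * Real.pi * Complex.I)⁻¹ * ∮ ζ in C(0, 1), g ζ / ζ

/-- `φ n`, `φb n` (the second one is written `φ̄_n` in the literature; it is not the complex
conjugate of `φ n`) form the bi-orthonormal polynomial system of the weight `w` on the unit
circle, normalised so that both polynomials of degree `n` have the same leading coefficient. -/
structure IsBiorthonormal (w : ℂ → ℂ) (φ φb : ℕ → ℂ[X]) : Prop where
  natDegree_left : ∀ n, (φ n).natDegree = n
  natDegree_right : ∀ n, (φb n).natDegree = n
  leadingCoeff_eq : ∀ n, (φ n).leadingCoeff = (φb n).leadingCoeff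
  orthonormal : ∀ k n,
    circleMean (fun ζ => w ζ * (φ k).eval ζ * (φb n).eval (starRingEnd ℂ ζ))
      = if k = n then 1 else 0

/-- The reciprocal polynomial `φ*_n(z) = z^n φ̄_n(1/z)`. -/
def recip (φb : ℕ → ℂ[X]) (n : ℕ) : ℂ[X] := (φb n).reflect n

/-- The Carathéodory function of the weight. -/
def caratheodory (w : ℂ → ℂ) (z : ℂ) : ℂ :=
  circleMean fun ζ => (ζ + z) / (ζ - z) * w ζ

/-- The associated polynomial `ψ_n`, with `ψ_0 = 1/κ_0`. -/
def psi (w : ℂ → ℂ) (φ : ℕ → ℂ[X]) (n : ℕ) (z : ℂ) : ℂ :=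
  if n = 0 then ((φ 0).leadingCoeff)⁻¹
  else circleMean fun ζ => (ζ + z) / (ζ - z) * w ζ * ((φ n).eval ζ - (φ n).eval z)

/-- The reciprocal associated polynomial `ψ*_n`, with `ψ*_0 = 1/κ_0`. -/
def psiStar (w : ℂ → ℂ) (φb : ℕ → ℂ[X]) (n : ℕ) (z : ℂ) : ℂ :=
  if n = 0 then ((φb 0).leadingCoeff)⁻¹
  else -circleMean fun ζ => (ζ + z) / (ζ - z) * w ζ *
    (z ^ n * (φb n).eval (starRingEnd ℂ ζ) - (recip φb n).eval z)

/-- The associated function `ε_n = ψ_n + F φ_n`. -/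
def eps (w : ℂ → ℂ) (φ : ℕ → ℂ[X]) (n : ℕ) (z : ℂ) : ℂ :=
  psi w φ n z + caratheodory w z * (φ n).eval z

/-- The reciprocal associated function `ε*_n = ψ*_n - F φ*_n`. -/
def epsStar (w : ℂ → ℂ) (φb : ℕ → ℂ[X]) (n : ℕ) (z : ℂ) : ℂ :=
  psiStar w φb n z - caratheodory w z * (recip φb n).eval z

/-- The fundamental matrix `Y_n`. -/
def Y (w : ℂ → ℂ) (φ φb : ℕ → ℂ[X]) (n : ℕ) (z : ℂ) : Matrix (Fin 2) (Fin 2) ℂ :=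
  !![(φ n).eval z, eps w φ n z / w z;
     (recip φb n).eval z, -(epsStar w φb n z) / w z]

/-! ### Regular semi-classical weights and their deformations -/

/-- `w` is, on the set `D`, a (nowhere vanishing) regular semi-classical weight function with
logarithmic derivative `2V/W`. -/
structure IsRegularSemiclassical (W V : ℂ[X]) (D : Set ℂ) (w : ℂ → ℂ) : Prop where
  two_le : 2 ≤ W.natDegree
  degree_lt : V.degree < W.degree
  roots_nodup : W.roots.Nodup
  residue_ne : ∀ a, W.IsRoot a → ∀ k : ℕ, 2 * V.eval a / (derivative W).eval a ≠ k
  ne_zero : ∀ x ∈ D, w x ≠ 0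
  differentiableAt : ∀ x ∈ D, DifferentiableAt ℂ w x
  ode : ∀ x ∈ D, W.eval x * deriv w x = 2 * V.eval x * w x

/-- `W(x) = ∏ (x - z_k)`. -/
def singPoly {m : ℕ} (z : Fin m → ℂ) : ℂ[X] := ∏ k, (X - C (z k))

/-- The polynomial `V` with `2V/W = ∑ ρ_j / (x - z_j)`. -/
def resPoly {m : ℕ} (z ρ : Fin m → ℂ) : ℂ[X] :=
  C (1 / 2) * ∑ j, C (ρ j) * ∏ k ∈ Finset.univ.erase j, (X - C (z k))

/-- A deformation `t ↦ w t`, `t ∈ I`, of a regular semi-classical weight `∏ (x - z_j(t))^{ρ_j}`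
through a motion of its finite singularities, one of which is fixed at the origin.
The slice `{x | (t, x) ∈ D}` is the cut plane on which the branch `w t` is analytic; the cuts
may meet the unit circle only in singularities of the weight. -/
structure IsDeformation {m : ℕ} (I : Set ℝ) (D : Set (ℝ × ℂ)) (z : Fin m → ℝ → ℂ)
    (ρ : Fin m → ℂ) (w : ℝ → ℂ → ℂ) : Prop where
  isOpen_time : IsOpen I
  isPreconnected_time : IsPreconnected I
  isOpen_domain : IsOpen D
  differentiableAt_sing : ∀ j, ∀ t ∈ I, DifferentiableAt ℝ (z j) t
  sing_zero : ∃ j, ∀ t ∈ I, z j t = 0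
  circle_subset : ∀ t ∈ I, ∀ x : ℂ, ‖x‖ = 1 → (∀ k, x ≠ z k t) → (t, x) ∈ D
  re_pos : ∀ t ∈ I, ∀ k, ‖z k t‖ = 1 → 0 < (ρ k).re
  semiclassical : ∀ t ∈ I, IsRegularSemiclassical (singPoly fun k => z k t)
    (resPoly (fun k => z k t) ρ) {x | (t, x) ∈ D} (w t)
  hasDerivAt_time : ∀ t ∈ I, ∀ x, (t, x) ∈ D →
    HasDerivAt (fun τ => w τ x) (-(∑ j, ρ j * deriv (z j) t / (x - z j t)) * w t x) t

/-! ### Analytic continuation and monodromy -/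

/-- `G s` (`0 ≤ s ≤ 1`) represents the analytic continuation of the germ of `G 0` at `γ 0` along
the path `γ`. -/
def IsContinuationAlong (γ : ℝ → ℂ) (G : ℝ → ℂ → Matrix (Fin 2) (Fin 2) ℂ) : Prop :=
  ∀ s ∈ Icc (0 : ℝ) 1,
    (∀ i j, AnalyticAt ℂ (fun x => G s x i j) (γ s)) ∧
    ∀ᶠ s' in 𝓝[Icc (0 : ℝ) 1] s, G s' =ᶠ[𝓝 (γ s')] G s

/-- Analytic continuation along the loop `γ` turns the germ of `Y` at `γ 0` into `Y M`. -/
def HasMonodromy (Y : ℂ → Matrix (Fin 2) (Fin 2) ℂ) (γ : ℝ → ℂ)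
    (M : Matrix (Fin 2) (Fin 2) ℂ) : Prop :=
  ∃ G, IsContinuationAlong γ G ∧ G 0 =ᶠ[𝓝 (γ 0)] Y ∧ G 1 =ᶠ[𝓝 (γ 1)] fun x => Y x * M

/-- The positively oriented circle about `a` through the point `b`, starting at `b`. -/
def circleLoop (a b : ℂ) (s : ℝ) : ℂ :=
  a + (b - a) * Complex.exp (2 * Real.pi * Complex.I * s)

/-- The loop through `b` that is positively oriented about `∞` (that is, in the local
coordinate `1/x`). -/
def inftyLoop (b : ℂ) (s : ℝ) : ℂ :=
  b * Complex.exp (-(2 * Real.pi * Complex.I * s))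

/-- The matrix `[[1, C (1 - e^{-2πiρ})], [0, e^{-2πiρ}]]`. -/
def monodromyMatrix (C ρ : ℂ) : Matrix (Fin 2) (Fin 2) ℂ :=
  !![1, C * (1 - Complex.exp (-(2 * Real.pi * Complex.I * ρ)));
     0, Complex.exp (-(2 * Real.pi * Complex.I * ρ))]

/-- The largest open disc about `z_j` that contains no other singularity. -/
def singDisc {m : ℕ} (z : Fin m → ℂ) (j : Fin m) : Set ℂ :=
  {x | ∀ k, k ≠ j → dist x (z j) < dist (z k) (z j)}

/-- The largest neighbourhood `|x| > R` of `∞` that contains no finite singularity. -/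
def inftyDisc {m : ℕ} (z : Fin m → ℂ) : Set ℂ :=
  {x | ∀ k, ‖z k‖ < ‖x‖}

end Semiclassical

end

open Semiclassical

/-! Everything reduces to the Carathéodory function `F`. Integration by parts along the circle gives
`W F' = 2V F + U` with one entire `U` for both sides of `𝕋` (`IsCutWeight.exists_forcing`). No
boundary terms appear: at a singularity on `𝕋` the polynomial `W` vanishes, while `w` stays bounded
because the exponent has positive real part. Since `ρ_j ∉ ℕ`, a power series solves this equation
near `z_j` (`IsCutWeight.exists_disc_solution`), and the holomorphic solution is unique
(`IsCutWeight.eventually_eq_zero_of_homogeneous`). Off `𝕋` the difference `F - f_j` then solves the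
equation of `w`, so locally it is `C w`.

Once `F = f + C w`, the monodromy is a computation: `ε_n / w = (ψ_n + f φ_n) / w + C φ_n`, similarly
in the second row, and `1 / w` is the only multivalued ingredient
(`IsBiorthonormal.hasMonodromy_iff`). The matrix is unique because continuation is unique and `det
Y_n` does not vanish identically (`IsBiorthonormal.exists_det_ne_zero`).

The substance is that `C` does not depend on time. In the coordinate `u = log (x - z_j)`, relative
to a fixed branch of the weight, the coefficient of `F - f_j` is locally constant off `𝕋` and jumps
by twice the coefficient of `w` across `𝕋` (`IsDiscSolution.connCoeff_jump`). If `z_j` is off `𝕋`,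
then `F = f_j` on its side, so `C` is zero there and `±2` times a ratio of two weight coefficients
on the other side. If `z_j` lies on `𝕋`, the circle about `z_j` through the base point crosses `𝕋`
twice and a full turn multiplies the coefficient by `e^{-2πiρ_j}`; the resulting linear relation
determines `C` (`IsDiscSolution.connCoeff_of_circle`). It remains valid when `z_j` moves slightly
off `𝕋`, which covers passages through the circle. In all cases `C` is built from ratios of weight
coefficients. By the time equation, `w` divided by a continuous branch of `∏ (x - z_k)^{ρ_k}` is
locally constant in time (`IsDeformation.weight_eventually_eq`), so these ratios, hence `C`, are
locally constant on the connected set `I`.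

At infinity nothing is assumed about `ρ_∞`, so no power series is used. If some `|z_k| ≥ 1`, the
neighbourhood of infinity lies outside `𝕋`, and `f = F`, `C = 0` works. Otherwise `w` is
single-valued along `𝕋`, so `∑ ρ_k` is an integer and `w` agrees on `𝕋` with a function holomorphic
for `|x| > max |z_k|`. Shrinking the contour continues `F` inwards from outside, and the difference
from the inner `F` is twice that function (`IsCutWeight.exists_infty_solution`). -/

namespace Semiclassical

/-! ### Averages over circles -/

theorem circleMean_eq_circleAverage (g : ℂ → ℂ) : circleMean g = Real.circleAverage g 0 1 := by
  rw [Real.circleAverage_eq_circleIntegral one_ne_zero, circleMean, smul_eq_mul]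
  congr 2
  ext ζ
  simp [div_eq_inv_mul]

theorem exists_ball_forall_le_norm_circleMap_sub {r : ℝ} (hr : 0 ≤ r) {z : ℂ} (hz : ‖z‖ ≠ r) :
    ∃ d > 0, ∀ x ∈ Metric.ball z d, ∀ θ : ℝ, d ≤ ‖circleMap 0 r θ - x‖ := by
  refine ⟨|‖z‖ - r| / 2, by have := abs_pos.2 (sub_ne_zero.2 hz); positivity, fun x hx θ => ?_⟩
  have h1 : |‖x‖ - ‖z‖| ≤ ‖x - z‖ := abs_norm_sub_norm_le x z
  have h2 : |‖circleMap 0 r θ‖ - ‖x‖| ≤ ‖circleMap 0 r θ - x‖ := abs_norm_sub_norm_le _ _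
  rw [norm_circleMap_zero, abs_of_nonneg hr] at h2
  rw [Metric.mem_ball, dist_eq_norm] at hx
  have h3 : |‖z‖ - r| ≤ |r - ‖x‖| + |‖x‖ - ‖z‖| := by
    rw [abs_sub_comm ‖z‖ r]; exact abs_sub_le _ _ _
  linarith

theorem circleMap_sub_ne_zero {r : ℝ} (hr : 0 ≤ r) {z : ℂ} (hz : ‖z‖ ≠ r) (θ : ℝ) :
    circleMap 0 r θ - z ≠ 0 := fun h => hz <| by
  rw [← sub_eq_zero.1 h, norm_circleMap_zero, abs_of_nonneg hr]

theorem continuousOn_kernel {r : ℝ} (hr : 0 ≤ r) {z : ℂ} (hz : ‖z‖ ≠ r) :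
    ContinuousOn (fun ζ : ℂ => (ζ + z) / (ζ - z)) (Metric.sphere 0 |r|) := by
  refine ContinuousOn.div (by fun_prop) (by fun_prop) fun ζ hζ h => hz ?_
  rw [← sub_eq_zero.1 h]
  simpa [abs_of_nonneg hr] using hζ

/-- The derivative of the Carathéodory transform off the circle. -/
theorem hasDerivAt_circleAverage_kernel {g : ℂ → ℂ} {r : ℝ} (hr : 0 ≤ r)
    (hg : CircleIntegrable g 0 r) {z : ℂ} (hz : ‖z‖ ≠ r) :
    HasDerivAt (fun z => Real.circleAverage (fun ζ => (ζ + z) / (ζ - z) * g ζ) 0 r)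
      (Real.circleAverage (fun ζ => 2 * ζ / (ζ - z) ^ 2 * g ζ) 0 r) z := by
  obtain ⟨d, hd, hdist⟩ := exists_ball_forall_le_norm_circleMap_sub hr hz
  have hgm : MeasureTheory.AEStronglyMeasurable (fun θ ↦ g (circleMap 0 r θ))
      (MeasureTheory.volume.restrict (uIoc 0 (2 * Real.pi))) :=
    (intervalIntegrable_iff.1 hg).aestronglyMeasurable
  simp only [Real.circleAverage_def]
  apply HasDerivAt.const_smul
  refine (intervalIntegral.hasDerivAt_integral_of_dominated_loc_of_deriv_le
    (F' := fun x θ ↦ (2 * circleMap 0 r θ / (circleMap 0 r θ - x) ^ 2) * g (circleMap 0 r θ))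
    (bound := fun θ ↦ 2 * r * (d ^ 2)⁻¹ * ‖g (circleMap 0 r θ)‖)
    (Metric.ball_mem_nhds z hd) ?_ ?_ ?_ ?_ ?_ ?_).2
  · filter_upwards with x
    exact MeasureTheory.AEStronglyMeasurable.mul
      (Measurable.aestronglyMeasurable (by fun_prop)) hgm
  · exact hg.continuousOn_mul (continuousOn_kernel hr hz)
  · exact (Measurable.aestronglyMeasurable (by fun_prop)).mul hgm
  · filter_upwards with θ _ x hx
    have h₁ : ‖(2 : ℂ)‖ = 2 := by norm_num
    rw [norm_mul, norm_div, norm_mul, norm_circleMap_zero, abs_of_nonneg hr, norm_pow,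
      div_eq_mul_inv, h₁]
    gcongr
    exact hdist x hx θ
  · exact (IntervalIntegrable.norm hg).const_mul _
  · filter_upwards with θ _ x hx
    have h₁ : circleMap 0 r θ - x ≠ 0 := fun h => by
      have := hdist x hx θ
      rw [h, norm_zero] at this; linarith
    have h₃ := (((hasDerivAt_id' x).const_add (circleMap 0 r θ)).div
      ((hasDerivAt_id' x).const_sub (circleMap 0 r θ)) h₁).mul_const (g (circleMap 0 r θ))
    refine h₃.congr_deriv ?_
    congr 2
    ring

/-! ### Locally constant functions and logarithms -/

/-- The target carries no topology, so the lemma applies to numerical coefficients and also to truth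
values, as in the uniqueness of continuation. -/
theorem eq_of_eventually_eq_of_isPreconnected {α β : Type*} [TopologicalSpace α] {s : Set α}
    (hs : IsPreconnected s) {f : α → β} (h : ∀ x ∈ s, ∀ᶠ y in 𝓝[s] x, f y = f x)
    {x y : α} (hx : x ∈ s) (hy : y ∈ s) : f x = f y :=
  hs.induction₂ (fun a b => f a = f b) (fun a ha => (h a ha).mono fun _ hb => hb.symm)
    (fun _ _ _ _ _ _ h1 h2 => h1.trans h2) (fun _ _ _ _ h1 => h1.symm) hx hy

theorem eventually_eq_of_hasDerivAt_zero {𝕜 : Type*} [RCLike 𝕜] [NormedSpace 𝕜 ℂ] {f : 𝕜 → ℂ}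
    {x : 𝕜}
    (h : ∀ᶠ y in 𝓝 x, HasDerivAt f 0 y) : ∀ᶠ y in 𝓝 x, f y = f x := by
  obtain ⟨ε, hε, H⟩ := Metric.eventually_nhds_iff_ball.1 h
  filter_upwards [Metric.ball_mem_nhds x hε] with y hy
  exact Metric.isOpen_ball.is_const_of_deriv_eq_zero (convex_ball x ε).isPreconnected
    (fun z hz => (H z hz).differentiableAt.differentiableWithinAt) (fun z hz => (H z hz).deriv)
    hy (Metric.mem_ball_self hε)

/-- The logarithms of `1` are spaced by `2π > 1`, so a small one is zero. This identifies continuous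
branches without reference to a cut. -/
theorem eventually_eq_zero_of_exp_eq_one {α : Type*} {l : Filter α} {f : α → ℂ}
    (hf : Tendsto f l (𝓝 0)) (h : ∀ᶠ x in l, Complex.exp (f x) = 1) : ∀ᶠ x in l, f x = 0 := by
  have h1 : ∀ᶠ x in l, ‖f x‖ < 1 := by
    have := (tendsto_zero_iff_norm_tendsto_zero.1 hf).eventually (gt_mem_nhds one_pos)
    exact this
  filter_upwards [h, h1] with x hx hx1
  obtain ⟨n, hn⟩ := Complex.exp_eq_one_iff.1 hx
  rcases eq_or_ne n 0 with rfl | hn0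
  · simpa using hn
  · exfalso
    rw [hn] at hx1
    have h2 : (1 : ℝ) ≤ |(n : ℝ)| := by exact_mod_cast Int.one_le_abs hn0
    have h3 := Real.pi_gt_three
    simp only [norm_mul, Complex.norm_intCast, Complex.norm_ofNat, Complex.norm_real,
      Real.norm_eq_abs, abs_of_pos Real.pi_pos, Complex.norm_I, mul_one] at hx1
    nlinarith

/-- Two continuous logarithms of the same function differ by a constant. -/
theorem eventually_log_sub_eq {f g : ℝ → ℂ} {t₀ : ℝ} (hf : ContinuousAt f t₀)
    (hg : ContinuousAt g t₀)
    (h : ∀ᶠ t in 𝓝 t₀, Complex.exp (f t - f t₀) = Complex.exp (g t - g t₀)) :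
    ∀ᶠ t in 𝓝 t₀, f t - f t₀ = g t - g t₀ := by
  have h1 : Tendsto (fun t => (f t - f t₀) - (g t - g t₀)) (𝓝 t₀) (𝓝 0) := by
    have h2 : ContinuousAt (fun t => (f t - f t₀) - (g t - g t₀)) t₀ := by fun_prop
    have h3 := h2.tendsto
    simpa using h3
  filter_upwards [eventually_eq_zero_of_exp_eq_one h1 (by
    filter_upwards [h] with t ht
    rw [Complex.exp_sub, ht, div_self (Complex.exp_ne_zero _)])] with t ht
  exact sub_eq_zero.1 ht

/-! ### Uniqueness of analytic continuation -/

/-- By the identity theorem on a ball where both germs are analytic, the proposition "the two germs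
at `γ s` agree" is locally constant in `s`; connectedness of `[0, 1]` does the rest. -/
theorem IsContinuationAlong.eventuallyEq {γ : ℝ → ℂ} (hγ : Continuous γ)
    {G G' : ℝ → ℂ → Matrix (Fin 2) (Fin 2) ℂ} (hG : IsContinuationAlong γ G)
    (hG' : IsContinuationAlong γ G') (h0 : G 0 =ᶠ[𝓝 (γ 0)] G' 0) :
    G 1 =ᶠ[𝓝 (γ 1)] G' 1 := by
  have key : ∀ s ∈ Icc (0 : ℝ) 1, ∀ᶠ s' in 𝓝[Icc (0 : ℝ) 1] s,
      (G s' =ᶠ[𝓝 (γ s')] G' s') = (G s =ᶠ[𝓝 (γ s)] G' s) := by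
    intro s hs
    have hA : ∀ᶠ x in 𝓝 (γ s), ∀ i j, AnalyticAt ℂ (fun x => G s x i j) x ∧
        AnalyticAt ℂ (fun x => G' s x i j) x := by
      simp only [eventually_all]
      exact fun i j => ((hG s hs).1 i j).eventually_analyticAt.and
        ((hG' s hs).1 i j).eventually_analyticAt
    obtain ⟨ε, hε, H⟩ := Metric.eventually_nhds_iff_ball.1 hA
    have hγs : ∀ᶠ s' in 𝓝[Icc (0 : ℝ) 1] s, γ s' ∈ Metric.ball (γ s) ε :=
      (hγ.continuousAt.tendsto.mono_left nhdsWithin_le_nhds).eventually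
        (Metric.ball_mem_nhds _ hε)
    filter_upwards [(hG s hs).2, (hG' s hs).2, hγs] with s' h1 h2 h3
    have prop : ∀ x ∈ Metric.ball (γ s) ε, ∀ y ∈ Metric.ball (γ s) ε,
        G s =ᶠ[𝓝 x] G' s → G s =ᶠ[𝓝 y] G' s := by
      intro x hx y hy hxy
      have heq : EqOn (G s) (G' s) (Metric.ball (γ s) ε) := by
        intro u hu
        ext i j
        refine AnalyticOnNhd.eqOn_of_preconnected_of_eventuallyEq (𝕜 := ℂ)
          (f := fun x => G s x i j) (g := fun x => G' s x i j) (U := Metric.ball (γ s) ε)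
          (fun v hv => (H v hv i j).1) (fun v hv => (H v hv i j).2)
          (convex_ball _ _).isPreconnected hx ?_ hu
        exact hxy.mono fun v hv => by simp only [hv]
      exact eventually_of_mem (Metric.isOpen_ball.mem_nhds hy) heq
    have h0 := Metric.mem_ball_self (x := γ s) hε
    refine propext ⟨fun h => ?_, fun h => ?_⟩
    · exact prop _ h3 _ h0 (h1.symm.trans (h.trans h2))
    · exact h1.trans ((prop _ h0 _ h3 h).trans h2.symm)
  have := eq_of_eventually_eq_of_isPreconnected isPreconnected_Icc
    (f := fun s => (G s =ᶠ[𝓝 (γ s)] G' s)) key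
    (left_mem_Icc.2 zero_le_one) (right_mem_Icc.2 zero_le_one)
  exact this.mp h0

theorem HasMonodromy.eventuallyEq {Y : ℂ → Matrix (Fin 2) (Fin 2) ℂ} {γ : ℝ → ℂ}
    (hγ : Continuous γ) {M M' : Matrix (Fin 2) (Fin 2) ℂ} (h : HasMonodromy Y γ M)
    (h' : HasMonodromy Y γ M') : (fun x => Y x * M) =ᶠ[𝓝 (γ 1)] fun x => Y x * M' := by
  obtain ⟨G, hG, h0, h1⟩ := h
  obtain ⟨G', hG', h0', h1'⟩ := h'
  exact h1.symm.trans ((hG.eventuallyEq hγ hG' (h0.trans h0'.symm)).trans h1')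

/-! ### A first order equation with a regular singular point -/

/-- The equation `(x - a) k' = ρ k + v` has a holomorphic solution when `ρ ∉ ℕ`. -/
theorem exists_differentiableOn_ball_euler {a ρ : ℂ} {R : ℝ} (hρ : ∀ n : ℕ, ρ ≠ n)
    {v : ℂ → ℂ} (hv : DifferentiableOn ℂ v (Metric.ball a R)) :
    ∃ k : ℂ → ℂ, DifferentiableOn ℂ k (Metric.ball a R) ∧
      ∀ x ∈ Metric.ball a R, (x - a) * deriv k x = ρ * k x + v x := by
  set c : ℕ → ℂ := fun n => (n.factorial : ℂ)⁻¹ * iteratedDeriv n v a with hc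
  have hsum : ∀ x ∈ Metric.ball a R, HasSum (fun n => c n * (x - a) ^ n) (v x) := by
    intro x hx
    refine (Complex.hasSum_taylorSeries_on_ball hv hx).congr_fun ?_ |> fun h => h
    intro n
    simp only [hc, smul_eq_mul]; ring
  obtain ⟨m, hm, hmn⟩ : ∃ m > 0, ∀ n : ℕ, m ≤ ‖(n : ℂ) - ρ‖ := by
    -- The coefficients of the solution are `c n / (n - ρ)`. The denominators are bounded below: by
    -- `1` beyond `N`, and by a positive minimum over the finitely many earlier indices. Hence no
    -- radius of convergence is lost.
    obtain ⟨N, hN⟩ := exists_nat_ge (‖ρ‖ + 1)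
    have hpos : ∀ n : ℕ, 0 < ‖(n : ℂ) - ρ‖ := fun n =>
      norm_pos_iff.2 (sub_ne_zero.2 (hρ n).symm)
    obtain ⟨n₀, -, hn₀⟩ := (Finset.range (N + 1)).exists_min_image
      (fun n : ℕ => ‖(n : ℂ) - ρ‖) ⟨0, by simp⟩
    refine ⟨min 1 ‖(n₀ : ℂ) - ρ‖, lt_min one_pos (hpos _), fun n => ?_⟩
    by_cases hn : n ∈ Finset.range (N + 1)
    · exact (min_le_right _ _).trans (hn₀ n hn)
    · refine (min_le_left _ _).trans ?_
      have h1 : (N : ℝ) + 1 ≤ n := by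
        simp only [Finset.mem_range, not_lt] at hn
        exact_mod_cast hn
      have h2 := norm_sub_norm_le (n : ℂ) ρ
      rw [Complex.norm_natCast] at h2
      linarith
  set F : ℕ → ℂ → ℂ := fun n x => c n / (n - ρ) * (x - a) ^ n with hF
  have hFd : ∀ n, Differentiable ℂ (F n) := fun n => by
    simp only [hF]; fun_prop
  -- Convergence of the Taylor series of `v` at `a + r`, for a radius `r` between `dist x a` and
  -- `R`, supplies the majorant.
  have loc : ∀ x ∈ Metric.ball a R, ∃ U, IsOpen U ∧ x ∈ U ∧ ∃ u : ℕ → ℝ, Summable u ∧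
      ∀ (i : ℕ) (y : ℂ), y ∈ U → ‖F i y‖ ≤ u i := by
    intro x hx
    obtain ⟨r, hr1, hr2⟩ := exists_between (Metric.mem_ball.1 hx)
    have hr0 : 0 ≤ r := dist_nonneg.trans hr1.le
    refine ⟨Metric.ball a r, Metric.isOpen_ball, hr1, fun n => m⁻¹ * ‖c n * (r : ℂ) ^ n‖, ?_, ?_⟩
    · have := (hsum (a + r) (by simpa [abs_of_nonneg hr0] using hr2)).summable.norm
      simpa using this.mul_left m⁻¹
    · intro i y hy
      simp only [hF, norm_mul, norm_div, norm_pow]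
      rw [Complex.norm_real, Real.norm_of_nonneg hr0, ← mul_assoc, div_eq_inv_mul]
      rw [Metric.mem_ball, dist_eq_norm] at hy
      gcongr
      exact hmn i
  refine ⟨fun x => ∑' n, F n x, fun x hx => ?_, fun x hx => ?_⟩
  · obtain ⟨U, hU, hxU, u, hu, hb⟩ := loc x hx
    exact ((Complex.differentiableOn_tsum_of_summable_norm hu
      (fun i => (hFd i).differentiableOn) hU hb).differentiableAt
      (hU.mem_nhds hxU)).differentiableWithinAt
  · obtain ⟨U, hU, hxU, u, hu, hb⟩ := loc x hx
    have h1 := Complex.hasSum_deriv_of_summable_norm hu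
      (fun i => (hFd i).differentiableOn) hU hb hxU
    have h2 : HasSum (fun n => F n x) (∑' n, F n x) :=
      (Summable.of_norm_bounded hu fun i => hb i x hxU).hasSum
    have h3 := (h1.mul_left (x - a)).sub (h2.mul_left ρ)
    have h4 := hsum x hx
    refine sub_eq_iff_eq_add'.1 (h3.unique (h4.congr_fun fun n => ?_))
    have hd : deriv (F n) x = c n / (n - ρ) * (n * (x - a) ^ (n - 1)) := by
      have : HasDerivAt (F n) (c n / (n - ρ) * (n * (x - a) ^ (n - 1) * 1)) x :=
        (((hasDerivAt_id x).sub_const a).pow n).const_mul _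
      simpa using this.deriv
    have hne : (n : ℂ) - ρ ≠ 0 := sub_ne_zero.2 (hρ n).symm
    rw [hd]
    simp only [hF]
    rcases n with _ | n
    · simp only [Nat.cast_zero, zero_sub] at hne ⊢
      have : ρ ≠ 0 := by simpa using hne
      simp; field_simp
    · simp only [Nat.add_sub_cancel]
      field_simp
      ring

/-! ### The weight at a fixed time -/

/-- The logarithmic derivative `∑ ρ_k / (x - z_k)` of the weight. -/
noncomputable def logDer {m : ℕ} (z ρ : Fin m → ℂ) (x : ℂ) : ℂ := ∑ k, ρ k / (x - z k)

/-- A regular semi-classical weight at a fixed time, with cuts meeting the unit circle only in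
singularities. -/
structure IsCutWeight {m : ℕ} (z ρ : Fin m → ℂ) (D : Set ℂ) (w : ℂ → ℂ) : Prop where
  injective : Function.Injective z
  exponent_ne : ∀ k (n : ℕ), ρ k ≠ n
  isOpen : IsOpen D
  circle_subset : ∀ x : ℂ, ‖x‖ = 1 → (∀ k, x ≠ z k) → x ∈ D
  re_pos : ∀ k, ‖z k‖ = 1 → 0 < (ρ k).re
  ne_sing : ∀ x ∈ D, ∀ k, x ≠ z k
  ne_zero : ∀ x ∈ D, w x ≠ 0
  hasDerivAt : ∀ x ∈ D, HasDerivAt w (logDer z ρ x * w x) x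

theorem eval_singPoly {m : ℕ} (z : Fin m → ℂ) (x : ℂ) :
    (singPoly z).eval x = ∏ k, (x - z k) := by
  simp [singPoly, eval_prod]

theorem eval_singPoly_ne_zero {m : ℕ} {z : Fin m → ℂ} {x : ℂ} (hx : ∀ k, x ≠ z k) :
    (singPoly z).eval x ≠ 0 := by
  rw [eval_singPoly]
  exact Finset.prod_ne_zero_iff.2 fun k _ => sub_ne_zero.2 (hx k)

theorem two_mul_eval_resPoly {m : ℕ} (z ρ : Fin m → ℂ) (x : ℂ) :
    2 * (resPoly z ρ).eval x = ∑ j, ρ j * ∏ k ∈ Finset.univ.erase j, (x - z k) := by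
  simp only [resPoly, eval_mul, eval_C, eval_finsetSum, eval_prod, eval_sub, eval_X]
  ring

theorem two_mul_eval_resPoly_eq {m : ℕ} {z : Fin m → ℂ} (ρ : Fin m → ℂ) {x : ℂ}
    (hx : ∀ k, x ≠ z k) :
    2 * (resPoly z ρ).eval x = (singPoly z).eval x * logDer z ρ x := by
  rw [two_mul_eval_resPoly, eval_singPoly, logDer, Finset.mul_sum]
  refine Finset.sum_congr rfl fun j _ => ?_
  rw [← Finset.mul_prod_erase _ _ (Finset.mem_univ j)]
  have := sub_ne_zero.2 (hx j)
  field_simp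

theorem two_mul_eval_resPoly_sing {m : ℕ} (z ρ : Fin m → ℂ) (j : Fin m) :
    2 * (resPoly z ρ).eval (z j) = ρ j * ∏ k ∈ Finset.univ.erase j, (z j - z k) := by
  rw [two_mul_eval_resPoly]
  refine Finset.sum_eq_single j (fun i _ hi => ?_) (by simp)
  rw [Finset.prod_eq_zero (Finset.mem_erase.2 ⟨hi.symm, Finset.mem_univ j⟩) (sub_self _), mul_zero]

theorem eval_derivative_singPoly_sing {m : ℕ} (z : Fin m → ℂ) (j : Fin m) :
    (derivative (singPoly z)).eval (z j) = ∏ k ∈ Finset.univ.erase j, (z j - z k) := by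
  rw [singPoly, derivative_prod_finset, eval_finsetSum]
  rw [Finset.sum_eq_single j (fun i _ hi => ?_) (by simp)]
  · simp [eval_prod]
  · simp only [derivative_X_sub_C, mul_one, eval_prod]
    exact Finset.prod_eq_zero (Finset.mem_erase.2 ⟨hi.symm, Finset.mem_univ j⟩) (by simp)

theorem IsRegularSemiclassical.isCutWeight {m : ℕ} {z ρ : Fin m → ℂ} {D : Set ℂ} {w : ℂ → ℂ}
    (h : IsRegularSemiclassical (singPoly z) (resPoly z ρ) D w) (hD : IsOpen D)
    (hcirc : ∀ x : ℂ, ‖x‖ = 1 → (∀ k, x ≠ z k) → x ∈ D)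
    (hre : ∀ k, ‖z k‖ = 1 → 0 < (ρ k).re) : IsCutWeight z ρ D w := by
  have inj : Function.Injective z := by
    have h1 := h.roots_nodup
    have h2 : (singPoly z).roots = Finset.univ.val.map z := by
      have : singPoly z = (Multiset.map (fun a => X - C a) (Finset.univ.val.map z)).prod := by
        rw [Multiset.map_map]; rfl
      rw [this, roots_multiset_prod_X_sub_C]
    rw [h2] at h1
    intro a b hab
    exact Multiset.inj_on_of_nodup_map h1 a (by simp) b (by simp) hab
  have exponent : ∀ k (n : ℕ), ρ k ≠ n := by
    intro k n hk
    refine h.residue_ne (z k) ?_ n ?_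
    · rw [IsRoot, eval_singPoly]
      exact Finset.prod_eq_zero (Finset.mem_univ k) (sub_self _)
    · rw [two_mul_eval_resPoly_sing, eval_derivative_singPoly_sing, hk]
      refine mul_div_cancel_right₀ _ (Finset.prod_ne_zero_iff.2 fun i hi => ?_)
      exact sub_ne_zero.2 fun h' => (Finset.mem_erase.1 hi).1 (inj h').symm
  -- At `z k` the differential equation would read `0 = 2 V w`, but `V (z k) ≠ 0` because `ρ k ≠ 0`,
  -- which is the case `n = 0` of the exponent condition.
  have ne_sing : ∀ x ∈ D, ∀ k, x ≠ z k := by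
    rintro x hx k rfl
    have h1 := h.ode _ hx
    rw [two_mul_eval_resPoly_sing, eval_singPoly, Finset.prod_eq_zero (Finset.mem_univ k)
      (sub_self _), zero_mul] at h1
    have h2 : ∏ i ∈ Finset.univ.erase k, (z k - z i) ≠ 0 := Finset.prod_ne_zero_iff.2 fun i hi =>
      sub_ne_zero.2 fun h' => (Finset.mem_erase.1 hi).1 (inj h').symm
    have h3 : ρ k ≠ 0 := by simpa using exponent k 0
    exact mul_ne_zero (mul_ne_zero h3 h2) (h.ne_zero _ hx) h1.symm
  refine ⟨inj, exponent, hD, hcirc, hre, ne_sing, h.ne_zero, fun x hx => ?_⟩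
  refine (h.differentiableAt x hx).hasDerivAt.congr_deriv ?_
  have h1 := h.ode x hx
  rw [two_mul_eval_resPoly_eq ρ (ne_sing x hx), mul_assoc] at h1
  exact mul_left_cancel₀ (eval_singPoly_ne_zero (ne_sing x hx)) h1

theorem IsDeformation.isCutWeight {m : ℕ} {I : Set ℝ} {D : Set (ℝ × ℂ)} {z : Fin m → ℝ → ℂ}
    {ρ : Fin m → ℂ} {w : ℝ → ℂ → ℂ} (hw : IsDeformation I D z ρ w) {t : ℝ} (ht : t ∈ I) :
    IsCutWeight (fun k => z k t) ρ {x | (t, x) ∈ D} (w t) :=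
  (hw.semiclassical t ht).isCutWeight (hw.isOpen_domain.preimage (by fun_prop))
    (hw.circle_subset t ht) (hw.re_pos t ht)

/-! ### The regular factor of the weight in the disc about a singularity -/

/-- The branch of `∏_{k ≠ j} ((x - z_k) / (z_j - z_k))^{ρ_k}` on the disc about `z_j`. -/
noncomputable def discFactor {m : ℕ} (z ρ : Fin m → ℂ) (j : Fin m) (x : ℂ) : ℂ :=
  Complex.exp (∑ k ∈ Finset.univ.erase j, ρ k * Complex.log (1 - (x - z j) / (z k - z j)))

theorem discFactor_ne_zero {m : ℕ} (z ρ : Fin m → ℂ) (j : Fin m) (x : ℂ) :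
    discFactor z ρ j x ≠ 0 := Complex.exp_ne_zero _

theorem ne_sing_of_mem_singDisc {m : ℕ} {z : Fin m → ℂ} {j : Fin m} {x : ℂ}
    (hx : x ∈ singDisc z j) {k : Fin m} (hk : k ≠ j) : x ≠ z k := by
  rintro rfl
  exact lt_irrefl _ (hx k hk)

theorem sing_mem_singDisc {m : ℕ} {z : Fin m → ℂ} (hz : Function.Injective z) (j : Fin m) :
    z j ∈ singDisc z j := fun k hk => by
  rw [dist_self]; exact dist_pos.2 fun h => hk (hz h)

theorem isOpen_singDisc {m : ℕ} (z : Fin m → ℂ) (j : Fin m) : IsOpen (singDisc z j) := by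
  simp only [singDisc, ofPred_forall]
  refine isOpen_iInter_of_finite fun k => isOpen_iInter_of_finite fun _ => ?_
  exact isOpen_lt (by fun_prop) continuous_const

theorem convex_singDisc {m : ℕ} (z : Fin m → ℂ) (j : Fin m) : Convex ℝ (singDisc z j) := by
  simp only [singDisc, ofPred_forall]
  exact convex_iInter fun k => convex_iInter fun _ => convex_ball (z j) _

theorem one_sub_div_mem_slitPlane {m : ℕ} {z : Fin m → ℂ} {j : Fin m} {x : ℂ}
    (hx : x ∈ singDisc z j) {k : Fin m} (hk : k ≠ j) :
    1 - (x - z j) / (z k - z j) ∈ Complex.slitPlane := by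
  have h1 := hx k hk
  have h2 : 0 < dist (z k) (z j) := dist_nonneg.trans_lt h1
  rw [sub_eq_add_neg]
  refine Complex.mem_slitPlane_of_norm_lt_one ?_
  rw [norm_neg, norm_div, ← dist_eq_norm, ← dist_eq_norm]
  exact (div_lt_one h2).2 h1

theorem hasDerivAt_discFactor {m : ℕ} {z ρ : Fin m → ℂ} {j : Fin m} {x : ℂ}
    (hx : x ∈ singDisc z j) :
    HasDerivAt (discFactor z ρ j)
      ((∑ k ∈ Finset.univ.erase j, ρ k / (x - z k)) * discFactor z ρ j x) x := by
  unfold discFactor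
  rw [mul_comm]
  refine HasDerivAt.cexp (HasDerivAt.fun_sum fun k hk => ?_)
  have hk := (Finset.mem_erase.1 hk).1
  have h1 := one_sub_div_mem_slitPlane hx hk
  have h2 := (((hasDerivAt_id x).sub_const (z j)).div_const (z k - z j)).const_sub 1
  refine ((h2.clog h1).const_mul (ρ k)).congr_deriv ?_
  have h3 : z k - z j ≠ 0 := by
    have : 0 < dist (z k) (z j) := dist_nonneg.trans_lt (hx k hk)
    exact sub_ne_zero.2 (dist_pos.1 this)
  have h4 : x - z k ≠ 0 := sub_ne_zero.2 (ne_sing_of_mem_singDisc hx hk)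
  have h5 : 1 - (x - z j) / (z k - z j) = -(x - z k) / (z k - z j) := by
    field_simp; ring
  simp only [id]
  rw [h5]
  field_simp

theorem logDer_eq_add {m : ℕ} (z ρ : Fin m → ℂ) (j : Fin m) (x : ℂ) :
    logDer z ρ x = ρ j / (x - z j) + ∑ k ∈ Finset.univ.erase j, ρ k / (x - z k) :=
  (Finset.add_sum_erase _ _ (Finset.mem_univ j)).symm

/-! ### Integrability of the weight -/

namespace IsCutWeight
variable {m : ℕ} {z ρ : Fin m → ℂ} {D : Set ℂ} {w : ℂ → ℂ}

/-- On either side of a singularity on the circle the weight is bounded along the circle. -/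
theorem bounded_side (h : IsCutWeight z ρ D w) {j : Fin m} (hj : ‖z j‖ = 1) {σ : ℝ}
    (hσ : σ = 1 ∨ σ = -1) :
    ∃ K, ∀ᶠ τ : ℝ in 𝓝[>] 0, ‖w (z j * Complex.exp (Complex.I * σ * τ))‖ ≤ K := by
  have hσ2 : (σ : ℂ) * σ = 1 := by rcases hσ with rfl | rfl <;> simp
  have hσ0 : (σ : ℂ) ≠ 0 := fun h0 => by simp [h0] at hσ2
  have hz0 : z j ≠ 0 := fun h0 => by simp [h0] at hj
  set x : ℝ → ℂ := fun τ => z j * Complex.exp (Complex.I * σ * τ) with hx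
  have hxd : ∀ τ, HasDerivAt x (Complex.I * σ * x τ) τ := by
    intro τ
    have h1 : HasDerivAt (fun τ : ℝ => Complex.I * σ * (τ : ℂ)) (Complex.I * σ * 1) τ :=
      (Complex.ofRealCLM.hasDerivAt (x := τ)).const_mul _
    refine (h1.cexp.const_mul (z j)).congr_deriv ?_
    simp only [hx]; ring
  have hxc : Continuous x := by simp only [hx]; fun_prop
  have hx0 : x 0 = z j := by simp [hx]
  have hxn : ∀ τ, ‖x τ‖ = 1 := by
    intro τ
    simp only [hx, norm_mul, hj, one_mul]
    rw [mul_comm Complex.I, mul_right_comm, ← Complex.ofReal_mul, Complex.norm_exp_ofReal_mul_I]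
  obtain ⟨η, hη, hηπ, hηd⟩ : ∃ η > 0, η < Real.pi ∧ ∀ τ : ℝ, |τ| < η → x τ ∈ singDisc z j := by
    have h1 : ∀ᶠ τ in 𝓝 (0 : ℝ), x τ ∈ singDisc z j := by
      refine hxc.continuousAt.eventually ?_
      rw [hx0]
      exact (isOpen_singDisc z j).mem_nhds (sing_mem_singDisc h.injective j)
    obtain ⟨ε, hε, H⟩ := Metric.eventually_nhds_iff_ball.1 h1
    refine ⟨min ε 1, lt_min hε one_pos, (min_le_right _ _).trans_lt (by linarith [Real.pi_gt_three]), fun τ hτ => ?_⟩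
    exact H τ (by simpa using hτ.trans_le (min_le_left _ _))
  set P : ℝ → ℂ := fun τ => Complex.exp (ρ j * Complex.log ((x τ - z j) / (Complex.I * σ * z j)))
    with hP
  -- Dividing by `i σ z_j`, the tangent to the circle in the direction `σ`, moves the arc into the
  -- right half plane, where the principal logarithm defines the power `(x - z_j)^{ρ_j}` up to a
  -- constant.
  have hre : ∀ τ : ℝ, ((x τ - z j) / (Complex.I * σ * z j)).re = Real.sin τ := by
    intro τ
    have : (x τ - z j) / (Complex.I * σ * z j)
        = (Complex.exp (Complex.I * σ * τ) - 1) * (-Complex.I * σ) := by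
      have hI : Complex.I ^ 2 = -1 := Complex.I_sq
      simp only [hx]
      field_simp
      linear_combination ((Complex.exp (Complex.I * σ * τ) - 1) * (σ * σ)) * hI
        - (Complex.exp (Complex.I * σ * τ) - 1) * hσ2
    rw [this]
    have h2 : Complex.exp (Complex.I * σ * τ) = Real.cos (σ * τ) + Real.sin (σ * τ) * Complex.I := by
      rw [mul_assoc, ← Complex.ofReal_mul, mul_comm, Complex.exp_mul_I, Complex.ofReal_cos,
        Complex.ofReal_sin]
    rw [h2]
    rcases hσ with rfl | rfl <;> simp [-Complex.ofReal_sin]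
  have hslit : ∀ τ ∈ Ioo 0 η, (x τ - z j) / (Complex.I * σ * z j) ∈ Complex.slitPlane := by
    intro τ hτ
    refine Or.inl ?_
    rw [hre]
    exact Real.sin_pos_of_pos_of_lt_pi hτ.1 (hτ.2.trans hηπ)
  have hne : ∀ τ ∈ Ioo 0 η, x τ ≠ z j := by
    intro τ hτ he
    have := Complex.slitPlane_ne_zero (hslit τ hτ)
    simp [he] at this
  have hmem : ∀ τ ∈ Ioo 0 η, x τ ∈ singDisc z j := fun τ hτ =>
    hηd τ (by rw [abs_of_pos hτ.1]; exact hτ.2)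
  have hxD : ∀ τ ∈ Ioo 0 η, x τ ∈ D := by
    intro τ hτ
    refine h.circle_subset _ (hxn τ) fun k => ?_
    rcases eq_or_ne k j with rfl | hk
    · exact hne τ hτ
    · exact ne_sing_of_mem_singDisc (hmem τ hτ) hk
  have hPd : ∀ τ ∈ Ioo 0 η, HasDerivAt P (ρ j / (x τ - z j) * (Complex.I * σ * x τ) * P τ) τ := by
    intro τ hτ
    have h1 := ((hxd τ).sub_const (z j)).div_const (Complex.I * σ * z j)
    refine (((h1.clog_real (hslit τ hτ)).const_mul (ρ j)).cexp).congr_deriv ?_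
    have h2 := sub_ne_zero.2 (hne τ hτ)
    have h3 := Complex.I_ne_zero
    simp only [hP]
    field_simp
  -- The weight and its explicit branch have the same logarithmic derivative along the arc, so their
  -- quotient is constant on the whole one-sided interval.
  set q : ℝ → ℂ := fun τ => w (x τ) / (P τ * discFactor z ρ j (x τ)) with hq
  have hP0 : ∀ τ, P τ ≠ 0 := fun τ => Complex.exp_ne_zero _
  have hqd : ∀ τ ∈ Ioo 0 η, HasDerivAt q 0 τ := by
    intro τ hτ
    have h1 : HasDerivAt (fun τ => w (x τ)) _ τ :=
      HasDerivAt.comp_of_eq (h₂ := w) τ (h.hasDerivAt _ (hxD τ hτ)) (hxd τ) rfl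
    have h2 : HasDerivAt (fun τ => discFactor z ρ j (x τ)) _ τ :=
      HasDerivAt.comp_of_eq (h₂ := discFactor z ρ j) τ (hasDerivAt_discFactor (hmem τ hτ)) (hxd τ) rfl
    have h3 := h1.div ((hPd τ hτ).mul h2) (mul_ne_zero (hP0 τ) (discFactor_ne_zero _ _ _ _))
    refine h3.congr_deriv ?_
    rw [logDer_eq_add z ρ j]
    rw [div_eq_zero_iff]
    left
    simp only [Pi.mul_apply]
    ring
  have hqc : ∀ τ ∈ Ioo 0 η, q τ = q (η / 2) := fun τ hτ =>
    isOpen_Ioo.is_const_of_deriv_eq_zero isPreconnected_Ioo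
      (fun s hs => (hqd s hs).differentiableAt.differentiableWithinAt)
      (fun s hs => (hqd s hs).deriv) hτ ⟨by linarith, by linarith⟩
  have hE : ∃ B, ∀ᶠ τ in 𝓝 (0 : ℝ), ‖discFactor z ρ j (x τ)‖ ≤ B := by
    have h1 : ContinuousAt (fun τ => discFactor z ρ j (x τ)) 0 := by
      refine ContinuousAt.comp (f := x) (g := discFactor z ρ j) ?_ hxc.continuousAt
      rw [hx0]
      exact (hasDerivAt_discFactor (sing_mem_singDisc h.injective j)).continuousAt
    refine ⟨‖discFactor z ρ j (x 0)‖ + 1, ?_⟩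
    exact (h1.norm.eventually (gt_mem_nhds (lt_add_one _))).mono fun τ hτ => hτ.le
  obtain ⟨B, hB⟩ := hE
  have hbase : ∀ τ : ℝ, ‖(x τ - z j) / (Complex.I * σ * z j)‖ ≤ 2 := by
    intro τ
    have hσn : ‖(σ : ℂ)‖ = 1 := by rcases hσ with rfl | rfl <;> simp
    rw [norm_div, norm_mul, norm_mul, Complex.norm_I, hσn, hj, mul_one, mul_one, div_one]
    calc _ ≤ ‖x τ‖ + ‖z j‖ := norm_sub_le _ _
      _ = 2 := by rw [hxn, hj]; norm_num
  -- `|P|` is `|base|^{Re ρ_j} e^{-Im ρ_j arg}`. Since `Re ρ_j > 0`, an upper bound on the base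
  -- bounds the first factor even as the base tends to zero.
  have hPb : ∀ τ ∈ Ioo 0 η, ‖P τ‖ ≤ Real.exp ((ρ j).re * Real.log 2 + |(ρ j).im| * Real.pi) := by
    intro τ hτ
    simp only [hP, Complex.norm_exp]
    rw [Real.exp_le_exp, Complex.mul_re, Complex.log_re, Complex.log_im]
    have h1 : Real.log ‖(x τ - z j) / (Complex.I * σ * z j)‖ ≤ Real.log 2 :=
      Real.log_le_log (norm_pos_iff.2 (Complex.slitPlane_ne_zero (hslit τ hτ))) (hbase τ)
    have h2 : -((ρ j).im * Complex.arg ((x τ - z j) / (Complex.I * σ * z j)))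
        ≤ |(ρ j).im| * Real.pi := by
      refine (neg_le_abs _).trans ?_
      rw [abs_mul]
      gcongr
      exact Complex.abs_arg_le_pi _
    have h3 := mul_le_mul_of_nonneg_left h1 (h.re_pos j hj).le
    linarith
  refine ⟨‖q (η / 2)‖ * (Real.exp ((ρ j).re * Real.log 2 + |(ρ j).im| * Real.pi) * B), ?_⟩
  filter_upwards [Ioo_mem_nhdsGT hη, nhdsWithin_le_nhds hB] with τ hτ hBτ
  have h1 : w (x τ) = q (η / 2) * (P τ * discFactor z ρ j (x τ)) := by
    rw [← hqc τ hτ]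
    simp only [hq]
    rw [div_mul_cancel₀ _ (mul_ne_zero (hP0 τ) (discFactor_ne_zero _ _ _ _))]
  change ‖w (x τ)‖ ≤ _
  rw [h1, norm_mul, norm_mul]
  gcongr
  exact hPb τ hτ

/-- Local bounds are glued by compactness. They are first obtained on punctured neighbourhoods,
since the value of `w` at a singularity is arbitrary; it is then absorbed by a maximum. -/
theorem exists_norm_le (h : IsCutWeight z ρ D w) : ∃ K, ∀ x : ℂ, ‖x‖ = 1 → ‖w x‖ ≤ K := by
  have key : ∀ θ₀ : ℝ, ∃ K, ∀ᶠ θ in 𝓝[≠] θ₀, ‖w (circleMap 0 1 θ)‖ ≤ K := by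
    intro θ₀
    by_cases hs : ∃ j, circleMap 0 1 θ₀ = z j
    · obtain ⟨j, hj⟩ := hs
      have hzj : ‖z j‖ = 1 := by rw [← hj]; simp
      obtain ⟨K₁, h₁⟩ := h.bounded_side hzj (σ := 1) (Or.inl rfl)
      obtain ⟨K₂, h₂⟩ := h.bounded_side hzj (σ := -1) (Or.inr rfl)
      refine ⟨max K₁ K₂, ?_⟩
      have e : ∀ (σ θ : ℝ), z j * Complex.exp (Complex.I * σ * (σ * (θ - θ₀) : ℝ))
          = circleMap 0 1 (θ₀ + σ * σ * (θ - θ₀)) := by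
        intro σ θ
        rw [← hj]
        simp only [circleMap, zero_add, Complex.ofReal_one, one_mul]
        rw [← Complex.exp_add]
        congr 1
        push_cast; ring
      rw [← nhdsLT_sup_nhdsGT, eventually_sup]
      constructor
      · have ht : Tendsto (fun θ => -1 * (θ - θ₀)) (𝓝[<] θ₀) (𝓝[>] 0) := by
          refine tendsto_nhdsWithin_iff.2 ⟨?_, ?_⟩
          · refine Tendsto.mono_left ?_ nhdsWithin_le_nhds
            have : ContinuousAt (fun θ => -1 * (θ - θ₀)) θ₀ := by fun_prop
            simpa using this.tendsto
          · filter_upwards [self_mem_nhdsWithin] with θ hθ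
            simp only [mem_Iio, mem_Ioi] at *; linarith
        filter_upwards [ht.eventually h₂] with θ hθ
        rw [e] at hθ
        refine le_trans ?_ (hθ.trans (le_max_right _ _))
        norm_num
      · have ht : Tendsto (fun θ => 1 * (θ - θ₀)) (𝓝[>] θ₀) (𝓝[>] 0) := by
          refine tendsto_nhdsWithin_iff.2 ⟨?_, ?_⟩
          · refine Tendsto.mono_left ?_ nhdsWithin_le_nhds
            have : ContinuousAt (fun θ => 1 * (θ - θ₀)) θ₀ := by fun_prop
            simpa using this.tendsto
          · filter_upwards [self_mem_nhdsWithin] with θ hθ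
            simp only [mem_Ioi] at *; linarith
        filter_upwards [ht.eventually h₁] with θ hθ
        rw [e] at hθ
        refine le_trans ?_ (hθ.trans (le_max_left _ _))
        norm_num
    · push Not at hs
      have hD := h.circle_subset (circleMap 0 1 θ₀) (by simp) hs
      have hc : ContinuousAt (fun θ => w (circleMap 0 1 θ)) θ₀ :=
        ContinuousAt.comp (f := circleMap 0 1) (g := w) (h.hasDerivAt _ hD).continuousAt
          (continuous_circleMap 0 1).continuousAt
      refine ⟨‖w (circleMap 0 1 θ₀)‖ + 1, nhdsWithin_le_nhds ?_⟩
      exact (hc.norm.eventually (gt_mem_nhds (lt_add_one _))).mono fun τ hτ => hτ.le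
  obtain ⟨K, hK⟩ : ∃ K, ∀ θ ∈ Icc (0 : ℝ) (2 * Real.pi), ‖w (circleMap 0 1 θ)‖ ≤ K := by
    refine isCompact_Icc.induction_on (p := fun s => ∃ K, ∀ θ ∈ s, ‖w (circleMap 0 1 θ)‖ ≤ K)
      ⟨0, by simp⟩ (fun s t hst ⟨K, hK⟩ => ⟨K, fun θ hθ => hK θ (hst hθ)⟩) ?_ ?_
    · rintro s t ⟨K, hK⟩ ⟨K', hK'⟩
      exact ⟨max K K', fun θ hθ => hθ.elim (fun h => (hK θ h).trans (le_max_left _ _))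
        fun h => (hK' θ h).trans (le_max_right _ _)⟩
    · intro θ₀ _
      obtain ⟨K, hK⟩ := key θ₀
      refine ⟨{θ | ‖w (circleMap 0 1 θ)‖ ≤ max K ‖w (circleMap 0 1 θ₀)‖},
        mem_nhdsWithin_of_mem_nhds ?_, _, fun θ hθ => hθ⟩
      rw [eventually_nhdsWithin_iff] at hK
      filter_upwards [hK] with θ hθ
      by_cases he : θ = θ₀
      · subst he; exact le_max_right _ _
      · exact (hθ he).trans (le_max_left _ _)
  refine ⟨K, fun x hx => ?_⟩
  have : x ∈ circleMap 0 1 '' Ioc 0 (2 * Real.pi) := by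
    rw [image_circleMap_Ioc]; simpa using hx
  obtain ⟨θ, hθ, rfl⟩ := this
  exact hK θ (Ioc_subset_Icc_self hθ)

/-- The weight is bounded, and continuous along the circle off a countable closed set of angles,
which gives measurability. -/
theorem circleIntegrable (h : IsCutWeight z ρ D w) : CircleIntegrable w 0 1 := by
  obtain ⟨K, hK⟩ := h.exists_norm_le
  set A : Set ℝ := {θ | circleMap 0 1 θ ∉ range z} with hA
  have hcount : (Aᶜ).Countable := by
    have : Aᶜ = circleMap 0 1 ⁻¹' range z := by ext; simp [hA]
    rw [this]
    exact (finite_range z).countable.preimage_circleMap 0 one_ne_zero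
  have hAo : IsOpen A :=
    (finite_range z).isClosed.isOpen_compl.preimage (continuous_circleMap 0 1)
  have hc : ContinuousOn (fun θ => w (circleMap 0 1 θ)) A := by
    intro θ hθ
    have hD := h.circle_subset (circleMap 0 1 θ) (by simp) fun k hk => hθ ⟨k, hk.symm⟩
    exact (ContinuousAt.comp (f := circleMap 0 1) (g := w) (h.hasDerivAt _ hD).continuousAt
      (continuous_circleMap 0 1).continuousAt).continuousWithinAt
  have hm : MeasureTheory.AEStronglyMeasurable (fun θ => w (circleMap 0 1 θ))
      MeasureTheory.volume := by
    have h1 := hc.aestronglyMeasurable (μ := MeasureTheory.volume) hAo.measurableSet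
    rwa [MeasureTheory.Measure.restrict_eq_self_of_ae_mem] at h1
    rw [MeasureTheory.ae_iff]
    exact hcount.measure_zero _
  refine (intervalIntegrable_const (c := K)).mono_fun' hm.restrict ?_
  exact Eventually.of_forall fun θ => hK _ (by simp)

end IsCutWeight

/-! ### Bivariate polynomials -/

/-- The difference quotient of a polynomial is a polynomial in both variables. It cancels the pole
of the Carathéodory kernel at `ζ = x`. -/
theorem exists_evalEval_eq (W : ℂ[X]) : ∃ S : Polynomial ℂ[X], ∀ x y : ℂ,
    W.eval x = W.eval y + S.evalEval x y * (x - y) := by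
  obtain ⟨S, hS⟩ := (W.map ((C : ℂ[X] →+* Polynomial ℂ[X]).comp C)).evalSubFactor (C X) X
  refine ⟨S, fun x y => ?_⟩
  have h := congrArg (evalEval x y) hS
  simp only [eval_map, evalEval_sub, evalEval_mul, evalEval_C, evalEval_X, eval_X] at h
  rw [← coe_evalEvalRingHom, hom_eval₂, hom_eval₂] at h
  have h3 : (evalEvalRingHom x y).comp ((C : ℂ[X] →+* Polynomial ℂ[X]).comp C) = RingHom.id ℂ := by
    ext; simp
  rw [h3] at h
  simp only [coe_evalEvalRingHom, evalEval_C, eval_X, evalEval_X, eval₂_id] at h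
  linear_combination h

theorem exists_evalEval_eq_sq (W : ℂ[X]) : ∃ Q : Polynomial ℂ[X], ∀ x y : ℂ,
    W.eval x = W.eval y + (derivative W).eval y * (x - y) + Q.evalEval x y * (x - y) ^ 2 := by
  obtain ⟨Q, hQ⟩ := (W.map ((C : ℂ[X] →+* Polynomial ℂ[X]).comp C)).binomExpansion X (C X - X)
  refine ⟨Q, fun x y => ?_⟩
  have h := congrArg (evalEval x y) hQ
  simp only [eval_map, derivative_map, add_sub_cancel, evalEval_add, evalEval_pow, evalEval_sub,
    evalEval_mul, evalEval_C, evalEval_X, eval_X] at h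
  rw [← coe_evalEvalRingHom, hom_eval₂, hom_eval₂, hom_eval₂] at h
  have h3 : (evalEvalRingHom x y).comp ((C : ℂ[X] →+* Polynomial ℂ[X]).comp C) = RingHom.id ℂ := by
    ext; simp
  rw [h3] at h
  simp only [coe_evalEvalRingHom, evalEval_C, eval_X, evalEval_X, eval₂_id] at h
  exact h

theorem _root_.CircleIntegrable.fun_const_smul {f : ℂ → ℂ} {c : ℂ} {R : ℝ}
    (hf : CircleIntegrable f c R) (a : ℂ) : CircleIntegrable (fun ζ => a • f ζ) c R :=
  hf.const_smul

/-- Collecting powers of `y`, the average is a polynomial in `y` whose coefficients are averages of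
polynomials against `g`. -/
theorem differentiable_circleAverage_evalEval {g : ℂ → ℂ} (hg : CircleIntegrable g 0 1)
    (p : Polynomial ℂ[X]) :
    Differentiable ℂ fun y => Real.circleAverage (fun x => p.evalEval x y * g x) 0 1 := by
  have h : (fun y => Real.circleAverage (fun x => p.evalEval x y * g x) 0 1) = fun y =>
      ∑ i ∈ Finset.range (p.natDegree + 1),
        y ^ i * Real.circleAverage (fun x => (p.coeff i).eval x * g x) 0 1 := by
    ext y
    have h1 : (fun x => p.evalEval x y * g x) = fun x =>
        ∑ i ∈ Finset.range (p.natDegree + 1), y ^ i • ((p.coeff i).eval x * g x) := by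
      ext x
      rw [evalEval, eval_eq_sum_range (p := p), eval_finsetSum, Finset.sum_mul]
      refine Finset.sum_congr rfl fun i _ => ?_
      simp only [eval_mul, eval_pow, eval_C, smul_eq_mul]
      ring
    rw [h1, Real.circleAverage_fun_sum]
    · refine Finset.sum_congr rfl fun i _ => ?_
      rw [Real.circleAverage_fun_smul, smul_eq_mul]
    · intro i _
      exact (hg.continuousOn_mul (p.coeff i).continuous.continuousOn).fun_const_smul _
  rw [h]
  fun_prop

/-! ### The differential equation of the Carathéodory function -/

theorem caratheodory_eq (w : ℂ → ℂ) :
    caratheodory w = fun x => Real.circleAverage (fun ζ => (ζ + x) / (ζ - x) * w ζ) 0 1 := by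
  ext x
  rw [caratheodory, circleMean_eq_circleAverage]

namespace IsCutWeight
variable {m : ℕ} {z ρ : Fin m → ℂ} {D : Set ℂ} {w : ℂ → ℂ}

theorem differentiableAt_caratheodory (h : IsCutWeight z ρ D w) {x : ℂ} (hx : ‖x‖ ≠ 1) :
    DifferentiableAt ℂ (caratheodory w) x := by
  rw [caratheodory_eq]
  exact (hasDerivAt_circleAverage_kernel zero_le_one h.circleIntegrable hx).differentiableAt

/-- Integration by parts along the circle. -/
theorem circleAverage_by_parts (h : IsCutWeight z ρ D w) {x : ℂ} (hx : ‖x‖ ≠ 1) :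
    Real.circleAverage (fun ζ => (ζ * (((derivative (singPoly z)).eval ζ
      + 2 * (resPoly z ρ).eval ζ) / (ζ - x) - (singPoly z).eval ζ / (ζ - x) ^ 2)) * w ζ) 0 1 = 0 := by
  set f : ℝ → ℂ := fun θ => (singPoly z).eval (circleMap 0 1 θ) * w (circleMap 0 1 θ)
    / (circleMap 0 1 θ - x) with hf
  set k : ℂ → ℂ := fun ζ => ζ * (((derivative (singPoly z)).eval ζ
      + 2 * (resPoly z ρ).eval ζ) / (ζ - x) - (singPoly z).eval ζ / (ζ - x) ^ 2) with hk
  have hne : ∀ θ, circleMap 0 1 θ - x ≠ 0 := circleMap_sub_ne_zero zero_le_one hx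
  have hdiff : ∀ θ, (∀ k, circleMap 0 1 θ ≠ z k) →
      HasDerivAt f (Complex.I * (k (circleMap 0 1 θ) * w (circleMap 0 1 θ))) θ := by
    intro θ hθ
    have h1 := hasDerivAt_circleMap 0 1 θ
    have hD := h.circle_subset (circleMap 0 1 θ) (by simp) hθ
    have h2 := ((((singPoly z).hasDerivAt (circleMap 0 1 θ)).mul (h.hasDerivAt _ hD)).div
      ((hasDerivAt_id _).sub_const x) (hne θ)).comp_of_eq θ h1 rfl
    refine h2.congr_deriv ?_
    simp only [hk, two_mul_eval_resPoly_eq ρ hθ, id, Pi.mul_apply]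
    have := hne θ
    field_simp
  obtain ⟨K, hK⟩ := h.exists_norm_le
  -- At a singularity on the circle the zero of `W` meets a bounded weight, so `f` extends by zero.
  -- Hence the fundamental theorem with a countable exceptional set applies, and periodicity makes
  -- the integral vanish.
  have hcont : Continuous f := by
    refine continuous_iff_continuousAt.2 fun θ => ?_
    by_cases hθ : ∀ k, circleMap 0 1 θ ≠ z k
    · exact (hdiff θ hθ).continuousAt
    · push Not at hθ
      obtain ⟨j, hj⟩ := hθ
      have h0 : (singPoly z).eval (circleMap 0 1 θ) = 0 := by
        rw [eval_singPoly, hj]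
        exact Finset.prod_eq_zero (Finset.mem_univ j) (sub_self _)
      have h1 : f θ = 0 := by simp [hf, h0]
      rw [ContinuousAt, h1]
      have h2 : ContinuousAt (fun θ' => ‖(singPoly z).eval (circleMap 0 1 θ')‖ * K
          / ‖circleMap 0 1 θ' - x‖) θ :=
        (((singPoly z).continuous.comp (continuous_circleMap 0 1)).norm.continuousAt.mul
          continuousAt_const).div ((continuous_circleMap 0 1).sub continuous_const).norm.continuousAt
          (norm_ne_zero_iff.2 (hne θ))
      have h3 := h2.tendsto
      simp only [h0, norm_zero, zero_mul, zero_div] at h3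
      refine squeeze_zero_norm (fun θ' => ?_) h3
      simp only [hf, norm_div, norm_mul]
      gcongr
      exact hK _ (by simp)
  have hkc : ContinuousOn k (Metric.sphere 0 |1|) := by
    have hs : ∀ ζ ∈ Metric.sphere (0 : ℂ) |1|, ζ - x ≠ 0 := by
      intro ζ hζ h0
      rw [← sub_eq_zero.1 h0] at hx
      simp at hζ
      exact hx hζ
    simp only [hk]
    refine continuousOn_id.mul (ContinuousOn.sub (ContinuousOn.div ?_ (by fun_prop) hs)
      (ContinuousOn.div ?_ (by fun_prop) fun ζ hζ => pow_ne_zero 2 (hs ζ hζ)))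
    · exact ((derivative (singPoly z)).continuous.add
        (continuous_const.mul (resPoly z ρ).continuous)).continuousOn
    · exact (singPoly z).continuous.continuousOn
  have hint : CircleIntegrable (fun ζ => k ζ * w ζ) 0 1 := h.circleIntegrable.continuousOn_mul hkc
  have hmain := MeasureTheory.integral_eq_of_hasDerivAt_off_countable f
    (fun θ => Complex.I * (k (circleMap 0 1 θ) * w (circleMap 0 1 θ)))
    (a := 0) (b := 2 * Real.pi) (s := circleMap 0 1 ⁻¹' range z)
    ((finite_range z).countable.preimage_circleMap 0 one_ne_zero) hcont.continuousOn
    (fun θ hθ => hdiff θ fun j hj => hθ.2 ⟨j, hj.symm⟩)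
    (IntervalIntegrable.const_mul hint _)
  have hper : f (2 * Real.pi) = f 0 := by
    have := periodic_circleMap 0 1 0
    rw [zero_add] at this
    simp only [hf, this]
  rw [hper, sub_self, intervalIntegral.integral_const_mul] at hmain
  have h0 := (mul_eq_zero.1 hmain).resolve_left Complex.I_ne_zero
  rw [Real.circleAverage_def]
  exact smul_eq_zero.2 (Or.inr h0)

/-- The Carathéodory function satisfies the same inhomogeneous equation on both sides of the
circle. -/
theorem exists_forcing (h : IsCutWeight z ρ D w) : ∃ U : ℂ → ℂ, Differentiable ℂ U ∧
    ∀ x, ‖x‖ ≠ 1 → (singPoly z).eval x * deriv (caratheodory w) x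
      = 2 * (resPoly z ρ).eval x * caratheodory w x + U x := by
  obtain ⟨Q, hQ⟩ := exists_evalEval_eq_sq (singPoly z)
  obtain ⟨R, hR⟩ := exists_evalEval_eq (derivative (singPoly z))
  obtain ⟨S, hS⟩ := exists_evalEval_eq (resPoly z ρ)
  -- Add twice the vanishing integral of `circleAverage_by_parts` to `W(x) F' - 2 V(x) F` and expand
  -- `W`, `W'`, `V` at `x`: all poles at `ζ = x` cancel, and `p` is the remaining integrand.
  set p : Polynomial ℂ[X] := 2 * (resPoly z ρ).map C + 2 * C X * (R + 2 * S - Q) with hp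
  refine ⟨_, differentiable_circleAverage_evalEval h.circleIntegrable p, fun x hx => ?_⟩
  have hpe : ∀ ζ, p.evalEval ζ x = 2 * (resPoly z ρ).eval x
      + 2 * ζ * (R.evalEval ζ x + 2 * S.evalEval ζ x - Q.evalEval ζ x) := by
    intro ζ
    have h2 : (2 : Polynomial ℂ[X]).evalEval ζ x = 2 := by
      rw [show (2 : Polynomial ℂ[X]) = 1 + 1 by norm_num, evalEval_add, evalEval_one]; norm_num
    simp only [hp, evalEval_add, evalEval_mul, evalEval_sub, evalEval_C, eval_X, h2,
      evalEval_map_C]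
  have hd := (hasDerivAt_circleAverage_kernel zero_le_one h.circleIntegrable hx).deriv
  rw [caratheodory_eq, hd]
  have hw := h.circleIntegrable
  have hs : ∀ ζ ∈ Metric.sphere (0 : ℂ) |1|, ζ - x ≠ 0 := by
    intro ζ hζ h0
    rw [← sub_eq_zero.1 h0] at hx
    simp at hζ
    exact hx hζ
  have i1 : CircleIntegrable (fun ζ => 2 * ζ / (ζ - x) ^ 2 * w ζ) 0 1 :=
    hw.continuousOn_mul (ContinuousOn.div (by fun_prop) (by fun_prop) fun ζ hζ =>
      pow_ne_zero 2 (hs ζ hζ))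
  have i2 : CircleIntegrable (fun ζ => (ζ + x) / (ζ - x) * w ζ) 0 1 :=
    hw.continuousOn_mul (continuousOn_kernel zero_le_one hx)
  have i3 : CircleIntegrable (fun ζ => (ζ * (((derivative (singPoly z)).eval ζ
      + 2 * (resPoly z ρ).eval ζ) / (ζ - x) - (singPoly z).eval ζ / (ζ - x) ^ 2)) * w ζ) 0 1 := by
    refine hw.continuousOn_mul ?_
    refine continuousOn_id.mul (ContinuousOn.sub (ContinuousOn.div ?_ (by fun_prop) hs)
      (ContinuousOn.div ?_ (by fun_prop) fun ζ hζ => pow_ne_zero 2 (hs ζ hζ)))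
    · exact ((derivative (singPoly z)).continuous.add
        (continuous_const.mul (resPoly z ρ).continuous)).continuousOn
    · exact (singPoly z).continuous.continuousOn
  have h3 := h.circleAverage_by_parts hx
  have key : Real.circleAverage (fun ζ => p.evalEval ζ x * w ζ) 0 1
      = Real.circleAverage (fun ζ => ((singPoly z).eval x • (2 * ζ / (ζ - x) ^ 2 * w ζ)
        - (2 * (resPoly z ρ).eval x) • ((ζ + x) / (ζ - x) * w ζ))
        + (2 : ℂ) • ((ζ * (((derivative (singPoly z)).eval ζ
      + 2 * (resPoly z ρ).eval ζ) / (ζ - x) - (singPoly z).eval ζ / (ζ - x) ^ 2)) * w ζ)) 0 1 := by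
    refine Real.circleAverage_congr_sphere fun ζ hζ => ?_
    have h0 := hs ζ hζ
    simp only [smul_eq_mul, hpe]
    rw [hQ ζ x, hR ζ x, hS ζ x]
    field_simp
    ring
  have i4 : CircleIntegrable (fun ζ => (singPoly z).eval x • (2 * ζ / (ζ - x) ^ 2 * w ζ)
      - (2 * (resPoly z ρ).eval x) • ((ζ + x) / (ζ - x) * w ζ)) 0 1 :=
    (i1.fun_const_smul _).sub (i2.fun_const_smul _)
  rw [key, Real.circleAverage_fun_add i4 (i3.fun_const_smul _),
    Real.circleAverage_fun_sub (i1.fun_const_smul _) (i2.fun_const_smul _)]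
  simp only [Real.circleAverage_fun_smul]
  rw [h3]
  simp only [smul_eq_mul]
  ring

end IsCutWeight

/-! ### The jump of the Carathéodory function across the circle -/

/-- Partial fractions: `(ζ + x) / (ζ (ζ - x)) = 2 / (ζ - x) - 1 / ζ`, and only the first term
depends on the side of `x`. -/
theorem circleAverage_kernel_one {x : ℂ} (hx : ‖x‖ ≠ 1) :
    Real.circleAverage (fun ζ => (ζ + x) / (ζ - x)) 0 1 = if ‖x‖ < 1 then 1 else -1 := by
  rw [Real.circleAverage_eq_circleIntegral one_ne_zero]
  have hs : ∀ ζ ∈ Metric.sphere (0 : ℂ) |1|, ζ - x ≠ 0 := by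
    intro ζ hζ h0
    rw [← sub_eq_zero.1 h0] at hx
    simp at hζ
    exact hx hζ
  have h1 : (∮ ζ in C(0, 1), (ζ - 0)⁻¹ • ((ζ + x) / (ζ - x)))
      = ∮ ζ in C(0, 1), ((2 : ℂ) • (ζ - x)⁻¹ - (ζ - 0)⁻¹) := by
    refine circleIntegral.integral_congr zero_le_one fun ζ hζ => ?_
    have h0 := hs ζ (by simpa using hζ)
    have h1 : ζ ≠ 0 := fun h => by simp [h] at hζ
    simp only [sub_zero, smul_eq_mul]
    field_simp
    ring
  have i1 : CircleIntegrable (fun ζ => (ζ - x)⁻¹) 0 1 :=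
    ContinuousOn.circleIntegrable' (ContinuousOn.inv₀ (by fun_prop) hs)
  have i2 : CircleIntegrable (fun ζ : ℂ => (ζ - 0)⁻¹) 0 1 :=
    ContinuousOn.circleIntegrable' (ContinuousOn.inv₀ (by fun_prop) fun ζ hζ h => by
      simp at h; simp [h] at hζ)
  rw [h1, circleIntegral.integral_sub (i1.fun_const_smul _) i2, circleIntegral.integral_smul,
    circleIntegral.integral_sub_center_inv 0 one_ne_zero]
  have hpi : (2 * Real.pi * Complex.I : ℂ) ≠ 0 := Complex.two_pi_I_ne_zero
  split_ifs with hlt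
  · rw [circleIntegral.integral_sub_inv_of_mem_ball (by simpa using hlt)]
    simp only [smul_eq_mul]
    field_simp
    norm_num
  · have h2 : (∮ ζ in C(0, 1), (ζ - x)⁻¹) = 0 := by
      have hne : ∀ ζ ∈ Metric.closedBall (0 : ℂ) 1, ζ - x ≠ 0 := by
        intro ζ hζ h0
        rw [sub_eq_zero.1 h0] at hζ
        simp at hζ
        exact hx (le_antisymm hζ (not_lt.1 hlt))
      refine Complex.circleIntegral_eq_zero_of_differentiable_on_off_countable zero_le_one
        countable_empty (ContinuousOn.inv₀ (by fun_prop) hne) fun ζ hζ => ?_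
      exact DifferentiableAt.inv (by fun_prop) (hne ζ (Metric.ball_subset_closedBall hζ.1))
    rw [h2]
    simp only [smul_eq_mul]
    field_simp
    norm_num

/-- The Plemelj jump. With `w x` subtracted inside the integral, the average `H` has a limit as `x`
tends to `x₀` off the circle. On both sides the corrected function is `H - w`, by the values `1` and
`-1` of the average of the kernel; hence a common limit. -/
theorem IsCutWeight.tendsto_jump {m : ℕ} {z ρ : Fin m → ℂ} {D : Set ℂ} {w : ℂ → ℂ}
    (h : IsCutWeight z ρ D w) {x₀ : ℂ} (hx₀ : ‖x₀‖ = 1) (hne : ∀ k, x₀ ≠ z k) :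
    ∃ L, Tendsto (fun x => caratheodory w x - if ‖x‖ < 1 then 2 * w x else 0)
      (𝓝[{x | ‖x‖ ≠ 1}] x₀) (𝓝 L) := by
  have hD := h.circle_subset x₀ hx₀ hne
  have hw := h.circleIntegrable
  obtain ⟨K, hK⟩ := h.exists_norm_le
  have hwc : ContinuousAt w x₀ := (h.hasDerivAt _ hD).continuousAt
  have han : AnalyticAt ℂ w x₀ := by
    rw [Complex.analyticAt_iff_eventually_differentiableAt]
    filter_upwards [h.isOpen.mem_nhds hD] with x hx using (h.hasDerivAt x hx).differentiableAt
  -- Near `x₀` the Lipschitz bound on the analytic weight compensates the kernel singularity.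
  obtain ⟨κ, T, hT, hlip⟩ := (han.contDiffAt (n := 1)).exists_lipschitzOnWith
  obtain ⟨ε, hε, hεT⟩ := Metric.mem_nhds_iff.1 hT
  set H : ℂ → ℂ := fun x => Real.circleAverage (fun ζ => (ζ + x) / (ζ - x) * (w ζ - w x)) 0 1 with hH
  have hF : ∀ x, ‖x‖ ≠ 1 → caratheodory w x - (if ‖x‖ < 1 then 2 * w x else 0) = H x - w x := by
    intro x hx
    have i1 : CircleIntegrable (fun ζ => (ζ + x) / (ζ - x) * w ζ) 0 1 :=
      hw.continuousOn_mul (continuousOn_kernel zero_le_one hx)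
    have i2 : CircleIntegrable (fun ζ => (ζ + x) / (ζ - x)) 0 1 :=
      (continuousOn_kernel zero_le_one hx).circleIntegrable'
    have h1 : H x = caratheodory w x - w x * (if ‖x‖ < 1 then 1 else -1) := by
      rw [← circleAverage_kernel_one hx, caratheodory_eq, ← smul_eq_mul,
        ← Real.circleAverage_fun_smul, ← Real.circleAverage_fun_sub i1 (i2.fun_const_smul _)]
      simp only [hH]
      congr 1
      ext ζ
      simp only [smul_eq_mul]
      ring
    rw [h1]
    split_ifs <;> ring
  have hHt : Tendsto H (𝓝[{x | ‖x‖ ≠ 1}] x₀) (𝓝 (H x₀)) := by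
    simp only [hH, Real.circleAverage_def]
    refine Tendsto.const_smul ?_ _
    have hnear : ∀ᶠ x in 𝓝[{x | ‖x‖ ≠ 1}] x₀, ‖x‖ ≠ 1 ∧ dist x x₀ < min (ε / 2) 1 ∧
        ‖w x‖ < ‖w x₀‖ + 1 := by
      refine (eventually_mem_nhdsWithin).and (nhdsWithin_le_nhds ?_)
      have hb : ∀ᶠ x in 𝓝 x₀, dist x x₀ < min (ε / 2) 1 :=
        Metric.ball_mem_nhds x₀ (lt_min (half_pos hε) one_pos)
      exact hb.and (hwc.norm.eventually (gt_mem_nhds (lt_add_one _)))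
    -- Since `|ζ + x| ≤ 3`, the integrand is at most `3κ` for `ζ` near `x₀`; for the other `ζ` one
    -- has `|ζ - x| ≥ ε / 2` and the weight is bounded.
    refine intervalIntegral.tendsto_integral_filter_of_dominated_convergence
      (fun _ => max (3 * κ) (3 / (ε / 2) * (K + (‖w x₀‖ + 1)))) ?_ ?_ intervalIntegrable_const ?_
    · filter_upwards [hnear] with x hx
      have i1 : CircleIntegrable (fun ζ => (ζ + x) / (ζ - x) * (w ζ - w x)) 0 1 :=
        (hw.sub (circleIntegrable_const _ _ _)).continuousOn_mul
          (continuousOn_kernel zero_le_one hx.1)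
      exact (intervalIntegrable_iff.1 i1).aestronglyMeasurable
    · filter_upwards [hnear] with x hx
      refine Eventually.of_forall fun θ _ => ?_
      set ζ := circleMap 0 1 θ with hζ
      have hζ1 : ‖ζ‖ = 1 := by simp [hζ]
      have hx2 : ‖x‖ ≤ 2 := by
        have h1 : ‖x‖ ≤ ‖x₀‖ + ‖x - x₀‖ := norm_le_norm_add_norm_sub' x x₀
        have h2 := hx.2.1.trans_le (min_le_right _ _)
        rw [dist_eq_norm] at h2
        linarith
      have hnum : ‖ζ + x‖ ≤ 3 := (norm_add_le _ _).trans (by linarith)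
      have hsub : ζ - x ≠ 0 := circleMap_sub_ne_zero zero_le_one hx.1 θ
      have hpos : 0 < ‖ζ - x‖ := norm_pos_iff.2 hsub
      rw [norm_mul, norm_div]
      by_cases hζε : dist ζ x₀ < ε
      · refine le_trans ?_ (le_max_left _ _)
        have h1 := hlip.dist_le_mul ζ (hεT hζε) x
          (hεT ((hx.2.1.trans_le (min_le_left _ _)).trans (by linarith)))
        rw [dist_eq_norm, dist_eq_norm] at h1
        calc ‖ζ + x‖ / ‖ζ - x‖ * ‖w ζ - w x‖ ≤ 3 / ‖ζ - x‖ * (κ * ‖ζ - x‖) := by gcongr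
          _ = 3 * κ := by field_simp
      · refine le_trans ?_ (le_max_right _ _)
        have h1 : ε / 2 ≤ ‖ζ - x‖ := by
          have h2 := dist_triangle ζ x x₀
          have h3 := hx.2.1.trans_le (min_le_left _ _)
          rw [dist_eq_norm ζ x] at h2
          linarith
        have h2 : ‖w ζ - w x‖ ≤ K + (‖w x₀‖ + 1) :=
          (norm_sub_le _ _).trans (add_le_add (hK ζ hζ1) hx.2.2.le)
        gcongr
    · have hc : ({θ | circleMap 0 1 θ ∈ ({x₀} : Set ℂ)} : Set ℝ).Countable :=
        (countable_singleton x₀).preimage_circleMap 0 one_ne_zero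
      have hae : ∀ᵐ θ : ℝ, circleMap 0 1 θ ≠ x₀ := by
        rw [MeasureTheory.ae_iff]
        simpa using hc.measure_zero MeasureTheory.volume
      filter_upwards [hae] with θ hθ _
      have h1 : ContinuousAt (fun x => (circleMap 0 1 θ + x) / (circleMap 0 1 θ - x)
          * (w (circleMap 0 1 θ) - w x)) x₀ := by
        refine ContinuousAt.mul (ContinuousAt.div (by fun_prop) (by fun_prop) ?_)
          (continuousAt_const.sub hwc)
        exact sub_ne_zero.2 hθ
      exact h1.tendsto.mono_left nhdsWithin_le_nhds
  refine ⟨H x₀ - w x₀, ?_⟩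
  refine (hHt.sub (hwc.tendsto.mono_left nhdsWithin_le_nhds)).congr' ?_
  filter_upwards [self_mem_nhdsWithin] with x hx
  exact (hF x hx).symm

/-! ### Holomorphic solutions near a singularity -/

section
variable {m : ℕ} {z ρ : Fin m → ℂ} {D : Set ℂ} {w : ℂ → ℂ}

/-- A second singularity is required: without one, `singDisc` is the whole plane. -/
theorem singDisc_eq_ball (hz : Function.Injective z) {j : Fin m} (hm : ∃ k, k ≠ j) :
    ∃ R > 0, singDisc z j = Metric.ball (z j) R ∧ ∀ k, k ≠ j → R ≤ dist (z k) (z j) := by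
  have hne : (Finset.univ.erase j).Nonempty := hm.imp fun k hk => by simpa using hk
  obtain ⟨i, hi, hmin⟩ := (Finset.univ.erase j).exists_min_image (fun k => dist (z k) (z j)) hne
  have hij := (Finset.mem_erase.1 hi).1
  refine ⟨dist (z i) (z j), dist_pos.2 fun h => hij (hz h), ?_, fun k hk => hmin k (by simpa using hk)⟩
  ext x
  exact ⟨fun hx => hx i hij, fun hx k hk => hx.trans_le (hmin k (by simpa using hk))⟩

theorem eval_singPoly_eq_mul (z : Fin m → ℂ) (j : Fin m) (x : ℂ) :
    (singPoly z).eval x = (x - z j) * ∏ k ∈ Finset.univ.erase j, (x - z k) := by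
  rw [eval_singPoly, ← Finset.mul_prod_erase _ _ (Finset.mem_univ j)]

theorem prod_erase_ne_zero {j : Fin m} {x : ℂ} (hx : x ∈ singDisc z j) :
    ∏ k ∈ Finset.univ.erase j, (x - z k) ≠ 0 :=
  Finset.prod_ne_zero_iff.2 fun _ hk =>
    sub_ne_zero.2 (ne_sing_of_mem_singDisc hx (Finset.mem_erase.1 hk).1)

theorem two_mul_eval_resPoly_of_mem_singDisc (ρ : Fin m → ℂ) {j : Fin m} {x : ℂ}
    (hx : x ∈ singDisc z j) :
    2 * (resPoly z ρ).eval x = (∏ k ∈ Finset.univ.erase j, (x - z k))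
      * (ρ j + (x - z j) * ∑ k ∈ Finset.univ.erase j, ρ k / (x - z k)) := by
  rcases eq_or_ne x (z j) with rfl | hxj
  · rw [two_mul_eval_resPoly_sing, sub_self]; ring
  · rw [two_mul_eval_resPoly_eq ρ, eval_singPoly_eq_mul z j, logDer_eq_add z ρ j]
    · have := sub_ne_zero.2 hxj
      field_simp
    · intro k
      rcases eq_or_ne k j with rfl | hk
      · exact hxj
      · exact ne_sing_of_mem_singDisc hx hk

/-- Writing `f = E k` with `E` the regular factor of the weight removes the other singularities.
What is left for `k` is the Euler equation with exponent `ρ j` and holomorphic right-hand side. -/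
theorem IsCutWeight.exists_disc_solution (h : IsCutWeight z ρ D w) {j : Fin m} (hm : ∃ k, k ≠ j)
    {U : ℂ → ℂ} (hU : Differentiable ℂ U) :
    ∃ f : ℂ → ℂ, DifferentiableOn ℂ f (singDisc z j) ∧ ∀ x ∈ singDisc z j,
      (singPoly z).eval x * deriv f x = 2 * (resPoly z ρ).eval x * f x + U x := by
  obtain ⟨R, hR, hB, -⟩ := singDisc_eq_ball h.injective hm
  set P : ℂ → ℂ := fun x => ∏ k ∈ Finset.univ.erase j, (x - z k) with hP
  have hPd : Differentiable ℂ P := by simp only [hP]; fun_prop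
  have hEd : ∀ x ∈ singDisc z j, DifferentiableAt ℂ (discFactor z ρ j) x :=
    fun x hx => (hasDerivAt_discFactor hx).differentiableAt
  have hv : DifferentiableOn ℂ (fun x => U x / (P x * discFactor z ρ j x))
      (Metric.ball (z j) R) := by
    rw [← hB]
    intro x hx
    exact ((hU x).div ((hPd x).mul (hEd x hx)) (mul_ne_zero (prod_erase_ne_zero hx)
      (discFactor_ne_zero _ _ _ _))).differentiableWithinAt
  obtain ⟨k, hk, hk2⟩ := exists_differentiableOn_ball_euler (h.exponent_ne j) hv
  rw [← hB] at hk hk2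
  have hkd : ∀ x ∈ singDisc z j, DifferentiableAt ℂ k x := fun x hx =>
    hk.differentiableAt ((isOpen_singDisc z j).mem_nhds hx)
  refine ⟨fun x => discFactor z ρ j x * k x,
    fun x hx => ((hEd x hx).mul (hkd x hx)).differentiableWithinAt, fun x hx => ?_⟩
  have hd := ((hasDerivAt_discFactor (ρ := ρ) hx).mul (hkd x hx).hasDerivAt).deriv
  have h2 := hk2 x hx
  have hP0 : P x ≠ 0 := prod_erase_ne_zero hx
  have hE0 := discFactor_ne_zero z ρ j x
  rw [two_mul_eval_resPoly_of_mem_singDisc ρ hx, eval_singPoly_eq_mul z j]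
  change _ * deriv (discFactor z ρ j * k) x = _
  rw [hd]
  change (x - z j) * P x * _ = P x * _ * _ + _
  have h3 : (x - z j) * deriv k x * (P x * discFactor z ρ j x)
      = ρ j * k x * (P x * discFactor z ρ j x) + U x := by
    rw [h2]; field_simp
  linear_combination h3

/-- A nonzero holomorphic solution has some vanishing order `n` at `z_j`; comparing leading
coefficients gives `n = ρ_j`, which the exponent condition excludes. -/
theorem IsCutWeight.eventually_eq_zero_of_homogeneous (h : IsCutWeight z ρ D w) {j : Fin m}
    {d : ℂ → ℂ} (hd : AnalyticAt ℂ d (z j))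
    (heq : ∀ᶠ x in 𝓝 (z j), (singPoly z).eval x * deriv d x = 2 * (resPoly z ρ).eval x * d x) :
    ∀ᶠ x in 𝓝 (z j), d x = 0 := by
  by_contra hne
  obtain ⟨n, g, hg, hg0, hdg⟩ := hd.exists_eventuallyEq_pow_smul_nonzero_iff.2 hne
  set S : ℂ → ℂ := fun x => ∑ k ∈ Finset.univ.erase j, ρ k / (x - z k) with hS
  have hB := (isOpen_singDisc z j).mem_nhds (sing_mem_singDisc h.injective j)
  have hSc : ContinuousAt S (z j) := by
    simp only [hS]
    refine tendsto_finsetSum _ fun k hk => ?_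
    have : ContinuousAt (fun x => ρ k / (x - z k)) (z j) := by
      refine ContinuousAt.div (by fun_prop) (by fun_prop) ?_
      exact sub_ne_zero.2 fun h' => (Finset.mem_erase.1 hk).1 (h.injective h').symm
    exact this
  have key : ∀ᶠ x in 𝓝[≠] (z j),
      n * g x + (x - z j) * deriv g x = (ρ j + (x - z j) * S x) * g x := by
    filter_upwards [nhdsWithin_le_nhds heq, nhdsWithin_le_nhds hdg.eventually_nhds,
      nhdsWithin_le_nhds hg.eventually_analyticAt, nhdsWithin_le_nhds hB,
      self_mem_nhdsWithin] with x h1 h2 h3 h4 h5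
    have hx0 : x - z j ≠ 0 := sub_ne_zero.2 h5
    have h6 : HasDerivAt d ((n * (x - z j) ^ (n - 1) * 1) * g x + (x - z j) ^ n * deriv g x) x := by
      have h7 := (((hasDerivAt_id x).sub_const (z j)).pow n).mul h3.differentiableAt.hasDerivAt
      refine HasDerivAt.congr_of_eventuallyEq (f := (fun x => (x - z j) ^ n * g x)) h7 ?_
      exact h2.mono fun y hy => by simpa using hy
    rw [h6.deriv, two_mul_eval_resPoly_of_mem_singDisc ρ h4, eval_singPoly_eq_mul z j,
      h2.self_of_nhds, smul_eq_mul] at h1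
    have hP0 : ∏ k ∈ Finset.univ.erase j, (x - z k) ≠ 0 := prod_erase_ne_zero h4
    have h8 : (n : ℂ) * (x - z j) ^ (n - 1) * (x - z j) = n * (x - z j) ^ n := by
      rcases n with _ | n
      · simp
      · rw [Nat.add_sub_cancel]; ring
    refine mul_left_cancel₀ (mul_ne_zero hP0 (pow_ne_zero n hx0)) ?_
    linear_combination h1 - (∏ k ∈ Finset.univ.erase j, (x - z k)) * g x * h8
  have hgc := hg.continuousAt
  have hgd := hg.deriv.continuousAt
  have hc1 : ContinuousAt (fun x => n * g x + (x - z j) * deriv g x) (z j) := by fun_prop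
  have hc2 : ContinuousAt (fun x => (ρ j + (x - z j) * S x) * g x) (z j) := by fun_prop
  have hlim := tendsto_nhds_unique_of_eventuallyEq (hc1.tendsto.mono_left nhdsWithin_le_nhds)
    (hc2.tendsto.mono_left nhdsWithin_le_nhds) key
  simp only [sub_self, zero_mul, add_zero] at hlim
  exact h.exponent_ne j n (mul_right_cancel₀ hg0 hlim).symm

/-- The image under inversion of the part of a disc avoiding the origin that lies outside the unit
circle is convex. -/
theorem isPreconnected_ball_inter_exterior {a : ℂ} {R : ℝ} (hR : 0 < R) (ha : R ≤ ‖a‖) :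
    IsPreconnected (Metric.ball a R ∩ {x | 1 < ‖x‖}) := by
  -- The second condition is `|1 - a y|² < R² |y|²`, that is `|1/y - a| < R`, expanded. Its
  -- quadratic coefficient is nonnegative because `R ≤ |a|`, so it is a convex sublevel set, and the
  -- bound `-1` excludes `y = 0`.
  set A : Set ℂ := {y | ‖y‖ < 1} ∩
    {y | (-2 * (a * y).re) + (‖a‖ ^ 2 - R ^ 2) * ‖y‖ ^ 2 < -1} with hA
  have hconv : Convex ℝ A := by
    have h1 : Convex ℝ {y : ℂ | ‖y‖ < 1} := by
      have h0 : {y : ℂ | ‖y‖ < 1} = Metric.ball 0 1 := by ext; simp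
      rw [h0]
      exact convex_ball 0 1
    refine h1.inter ?_
    have h2 : ConvexOn ℝ univ fun y : ℂ => -2 * (a * y).re := by
      refine ⟨convex_univ, fun x _ y _ s t _ _ _ => le_of_eq ?_⟩
      simp only [Complex.real_smul, smul_eq_mul, Complex.add_re, Complex.mul_re, Complex.add_im,
        Complex.mul_im, Complex.ofReal_re, Complex.ofReal_im]
      ring
    have h3 : ConvexOn ℝ univ fun y : ℂ => (‖a‖ ^ 2 - R ^ 2) * ‖y‖ ^ 2 := by
      have h4 : ConvexOn ℝ univ fun y : ℂ => ‖y‖ ^ 2 :=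
        (convexOn_norm convex_univ).pow (fun _ _ => norm_nonneg _) 2
      have h5 : 0 ≤ ‖a‖ ^ 2 - R ^ 2 := sub_nonneg.2 (by gcongr)
      exact h4.smul h5
    simpa using (h2.add h3).convex_lt (-1)
  have hA0 : ∀ y ∈ A, y ≠ 0 := by
    rintro y hy rfl
    have := hy.2
    norm_num at this
  have himg : Metric.ball a R ∩ {x | 1 < ‖x‖} = (fun y => y⁻¹) '' A := by
    have key : ∀ y : ℂ, y ≠ 0 → (y⁻¹ ∈ Metric.ball a R ∩ {x | 1 < ‖x‖} ↔ y ∈ A) := by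
      intro y hy
      have hn : 0 < ‖y‖ := norm_pos_iff.2 hy
      have e1 : ‖y⁻¹ - a‖ * ‖y‖ = ‖1 - a * y‖ := by
        rw [← norm_mul]; congr 1; field_simp
      have e2 : ‖1 - a * y‖ ^ 2 = 1 - 2 * (a * y).re + ‖a‖ ^ 2 * ‖y‖ ^ 2 := by
        rw [← mul_pow, ← norm_mul, ← Complex.normSq_eq_norm_sq, ← Complex.normSq_eq_norm_sq]
        simp only [Complex.normSq_apply, Complex.sub_re, Complex.sub_im, Complex.one_re,
          Complex.one_im]
        ring
      have e3 : ‖y⁻¹ - a‖ < R ↔ ‖1 - a * y‖ ^ 2 < (R * ‖y‖) ^ 2 := by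
        rw [← e1, pow_lt_pow_iff_left₀ (by positivity) (by positivity) two_ne_zero,
          mul_lt_mul_iff_left₀ hn]
      simp only [mem_inter_iff, Metric.mem_ball, dist_eq_norm, mem_ofPred_eq, hA, norm_inv,
        one_lt_inv₀ hn, e3, e2]
      rw [and_comm]
      refine and_congr_right fun _ => ?_
      constructor <;> intro h <;> nlinarith
    ext x
    constructor
    · intro hx
      have hx0 : x ≠ 0 := by
        rintro rfl
        have := hx.2
        simp at this
        linarith
      exact ⟨x⁻¹, (key _ (inv_ne_zero hx0)).1 (by rwa [inv_inv]), inv_inv x⟩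
    · rintro ⟨y, hy, rfl⟩
      exact (key y (hA0 y hy)).2 hy
  rw [himg]
  exact hconv.isPreconnected.image _ (ContinuousOn.inv₀ continuousOn_id hA0)

/-- A holomorphic solution near `z_j` is the Carathéodory function on the side of the circle that
contains `z_j`. -/
theorem IsCutWeight.eqOn_of_analyticOn (h : IsCutWeight z ρ D w) {j : Fin m} {U f : ℂ → ℂ}
    (hF : ∀ x, ‖x‖ ≠ 1 → (singPoly z).eval x * deriv (caratheodory w) x
      = 2 * (resPoly z ρ).eval x * caratheodory w x + U x)
    (hf : DifferentiableOn ℂ f (singDisc z j))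
    (hfU : ∀ x ∈ singDisc z j, (singPoly z).eval x * deriv f x
      = 2 * (resPoly z ρ).eval x * f x + U x)
    {Ω : Set ℂ} (hΩ : IsOpen Ω) (hpre : IsPreconnected Ω) (hsub : Ω ⊆ singDisc z j)
    (hcirc : ∀ x ∈ Ω, ‖x‖ ≠ 1) (hj : z j ∈ Ω) :
    EqOn (caratheodory w) f Ω := by
  have h1 : ∀ x ∈ Ω, AnalyticAt ℂ (caratheodory w) x := fun x hx => by
    rw [Complex.analyticAt_iff_eventually_differentiableAt]
    filter_upwards [hΩ.mem_nhds hx] with y hy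
    exact h.differentiableAt_caratheodory (hcirc y hy)
  have h2 : ∀ x ∈ Ω, AnalyticAt ℂ f x := fun x hx =>
    (hf.mono hsub).analyticAt (hΩ.mem_nhds hx)
  refine AnalyticOnNhd.eqOn_of_preconnected_of_eventuallyEq h1 h2 hpre hj ?_
  have h3 := h.eventually_eq_zero_of_homogeneous ((h1 _ hj).sub (h2 _ hj)) (by
    filter_upwards [hΩ.mem_nhds hj] with x hx
    rw [deriv_sub (h1 x hx).differentiableAt (h2 x hx).differentiableAt, mul_sub,
      hF x (hcirc x hx), hfU x (hsub hx), Pi.sub_apply]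
    ring)
  exact h3.mono fun x hx => sub_eq_zero.1 hx

theorem IsCutWeight.eq_interior (h : IsCutWeight z ρ D w) {j : Fin m} {U f : ℂ → ℂ}
    (hF : ∀ x, ‖x‖ ≠ 1 → (singPoly z).eval x * deriv (caratheodory w) x
      = 2 * (resPoly z ρ).eval x * caratheodory w x + U x)
    (hf : DifferentiableOn ℂ f (singDisc z j))
    (hfU : ∀ x ∈ singDisc z j, (singPoly z).eval x * deriv f x
      = 2 * (resPoly z ρ).eval x * f x + U x)
    (hj : ‖z j‖ < 1) {x : ℂ} (hx : x ∈ singDisc z j) (hx1 : ‖x‖ < 1) : caratheodory w x = f x := by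
  have hball : {x : ℂ | ‖x‖ < 1} = Metric.ball 0 1 := by ext; simp
  refine h.eqOn_of_analyticOn hF hf hfU (Ω := singDisc z j ∩ {x | ‖x‖ < 1})
    ((isOpen_singDisc z j).inter (isOpen_lt continuous_norm continuous_const)) ?_
    inter_subset_left (fun y hy => hy.2.ne) ⟨sing_mem_singDisc h.injective j, hj⟩ ⟨hx, hx1⟩
  rw [hball]
  exact ((convex_singDisc z j).inter (convex_ball 0 1)).isPreconnected

/-- The singularity at the origin keeps the disc about `z_j` away from `0`, as the inversion
argument for connectedness of its exterior part requires. -/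
theorem IsCutWeight.eq_exterior (h : IsCutWeight z ρ D w) {j : Fin m} {U f : ℂ → ℂ}
    (hF : ∀ x, ‖x‖ ≠ 1 → (singPoly z).eval x * deriv (caratheodory w) x
      = 2 * (resPoly z ρ).eval x * caratheodory w x + U x)
    (hf : DifferentiableOn ℂ f (singDisc z j))
    (hfU : ∀ x ∈ singDisc z j, (singPoly z).eval x * deriv f x
      = 2 * (resPoly z ρ).eval x * f x + U x) (h0 : ∃ k, z k = 0)
    (hj : 1 < ‖z j‖) {x : ℂ} (hx : x ∈ singDisc z j) (hx1 : 1 < ‖x‖) : caratheodory w x = f x := by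
  obtain ⟨k, hk⟩ := h0
  have hkj : k ≠ j := by
    rintro rfl
    rw [hk, norm_zero] at hj
    linarith
  obtain ⟨R, hR, hB, hmin⟩ := singDisc_eq_ball h.injective ⟨k, hkj⟩
  refine h.eqOn_of_analyticOn hF hf hfU (Ω := singDisc z j ∩ {x | 1 < ‖x‖})
    ((isOpen_singDisc z j).inter (isOpen_lt continuous_const continuous_norm)) ?_
    inter_subset_left (fun y hy => hy.2.ne') ⟨sing_mem_singDisc h.injective j, hj⟩ ⟨hx, hx1⟩
  rw [hB]
  refine isPreconnected_ball_inter_exterior hR ?_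
  have := hmin k hkj
  rwa [hk, dist_zero_left] at this

end

/-! ### Solutions in the logarithmic coordinate about a singularity -/

section
variable {m : ℕ} {z ρ : Fin m → ℂ} {D : Set ℂ} {w : ℂ → ℂ}

/-- The branch of the weight in the coordinate `u = log (x - z_j)`. -/
noncomputable def discBranch (z ρ : Fin m → ℂ) (j : Fin m) (u : ℂ) : ℂ :=
  Complex.exp (ρ j * u) * discFactor z ρ j (z j + Complex.exp u)

/-- The quotient of a function by the branch of the weight, in the coordinate `log (x - z_j)`. -/
noncomputable def discCoeff (z ρ : Fin m → ℂ) (j : Fin m) (g : ℂ → ℂ) (u : ℂ) : ℂ :=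
  g (z j + Complex.exp u) / discBranch z ρ j u

theorem discBranch_ne_zero (z ρ : Fin m → ℂ) (j : Fin m) (u : ℂ) : discBranch z ρ j u ≠ 0 :=
  mul_ne_zero (Complex.exp_ne_zero _) (discFactor_ne_zero _ _ _ _)

theorem hasDerivAt_sing_add_exp (a u : ℂ) :
    HasDerivAt (fun u => a + Complex.exp u) (Complex.exp u) u :=
  (Complex.hasDerivAt_exp u).const_add a

theorem hasDerivAt_discBranch {j : Fin m} {u : ℂ} (hu : z j + Complex.exp u ∈ singDisc z j) :
    HasDerivAt (discBranch z ρ j)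
      (logDer z ρ (z j + Complex.exp u) * discBranch z ρ j u * Complex.exp u) u := by
  have h1 : HasDerivAt (fun u => Complex.exp (ρ j * u)) (Complex.exp (ρ j * u) * (ρ j * 1)) u :=
    ((hasDerivAt_id u).const_mul (ρ j)).cexp
  have h2 := (hasDerivAt_discFactor (ρ := ρ) hu).comp u (hasDerivAt_sing_add_exp (z j) u)
  refine (h1.mul h2).congr_deriv ?_
  rw [logDer_eq_add z ρ j, discBranch, add_sub_cancel_left]
  have := Complex.exp_ne_zero u
  field_simp
  simp only [Function.comp]
  ring

theorem discCoeff_eventually_eq {j : Fin m} {g : ℂ → ℂ} {u : ℂ}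
    (hu : z j + Complex.exp u ∈ singDisc z j)
    (hg : ∀ᶠ y in 𝓝 (z j + Complex.exp u), HasDerivAt g (logDer z ρ y * g y) y) :
    ∀ᶠ v in 𝓝 u, discCoeff z ρ j g v = discCoeff z ρ j g u := by
  refine eventually_eq_of_hasDerivAt_zero ?_
  have hc : ContinuousAt (fun u => z j + Complex.exp u) u :=
    (hasDerivAt_sing_add_exp (z j) u).continuousAt
  filter_upwards [hc.eventually hg, hc.eventually ((isOpen_singDisc z j).mem_nhds hu)] with v h1 h2
  have h3 := (h1.comp v (hasDerivAt_sing_add_exp (z j) v)).div (hasDerivAt_discBranch (ρ := ρ) h2)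
    (discBranch_ne_zero _ _ _ _)
  refine h3.congr_deriv ?_
  simp only [Function.comp]
  rw [div_eq_zero_iff]
  left; ring

/-- A full turn leaves the point unchanged and multiplies the branch in the denominator by
`e^{2πiρ_j}`. -/
theorem discCoeff_add_two_pi (z ρ : Fin m → ℂ) (j : Fin m) (g : ℂ → ℂ) (u : ℂ) :
    discCoeff z ρ j g (u + 2 * Real.pi * Complex.I)
      = Complex.exp (-(2 * Real.pi * Complex.I * ρ j)) * discCoeff z ρ j g u := by
  simp only [discCoeff, discBranch, Complex.exp_periodic u]
  rw [mul_add, Complex.exp_add, Complex.exp_neg, mul_comm (2 * (Real.pi : ℂ) * Complex.I) (ρ j)]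
  have := Complex.exp_ne_zero (ρ j * (2 * Real.pi * Complex.I))
  have := Complex.exp_ne_zero (ρ j * u)
  have := discFactor_ne_zero z ρ j (z j + Complex.exp u)
  field_simp

/-- A holomorphic solution, on the disc about `z_j`, of the equation satisfied by the
Carathéodory function. -/
structure IsDiscSolution (z ρ : Fin m → ℂ) (j : Fin m) (w f : ℂ → ℂ) : Prop where
  differentiableOn : DifferentiableOn ℂ f (singDisc z j)
  hasDerivAt_sub : ∀ x ∈ singDisc z j, x ≠ z j → ‖x‖ ≠ 1 →
    HasDerivAt (fun y => caratheodory w y - f y) (logDer z ρ x * (caratheodory w x - f x)) x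
  eq_interior : ‖z j‖ < 1 → ∀ x ∈ singDisc z j, ‖x‖ < 1 → caratheodory w x = f x
  eq_exterior : 1 < ‖z j‖ → ∀ x ∈ singDisc z j, 1 < ‖x‖ → caratheodory w x = f x

/-- Both functions satisfy the equation with the same forcing term, so it cancels in the difference;
uniqueness gives equality on the side of the circle containing `z_j`. -/
theorem IsCutWeight.exists_isDiscSolution (h : IsCutWeight z ρ D w) {j : Fin m}
    (hm : ∃ k, k ≠ j) (h0 : ∃ k, z k = 0) : ∃ f, IsDiscSolution z ρ j w f := by
  obtain ⟨U, hU, hF⟩ := h.exists_forcing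
  obtain ⟨f, hf, hfU⟩ := h.exists_disc_solution hm hU
  refine ⟨f, hf, fun x hx hxj hx1 => ?_, fun hj x hx hx1 => h.eq_interior hF hf hfU hj hx hx1,
    fun hj x hx hx1 => h.eq_exterior hF hf hfU h0 hj hx hx1⟩
  have hne : ∀ k, x ≠ z k := fun k => by
    rcases eq_or_ne k j with rfl | hk
    · exact hxj
    · exact ne_sing_of_mem_singDisc hx hk
  have hfd := hf.differentiableAt ((isOpen_singDisc z j).mem_nhds hx)
  refine ((h.differentiableAt_caratheodory hx1).hasDerivAt.sub hfd.hasDerivAt).congr_deriv ?_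
  refine mul_left_cancel₀ (eval_singPoly_ne_zero hne) ?_
  have h1 := hF x hx1
  have h2 := hfU x hx
  rw [two_mul_eval_resPoly_eq ρ hne] at h1 h2
  linear_combination h1 - h2

/-- The coefficient of the weight in the Carathéodory function, in the coordinate
`log (x - z_j)`. -/
noncomputable def connCoeff (z ρ : Fin m → ℂ) (j : Fin m) (w f : ℂ → ℂ) : ℂ → ℂ :=
  discCoeff z ρ j fun x => caratheodory w x - f x

namespace IsDiscSolution
variable {j : Fin m} {f : ℂ → ℂ}

theorem connCoeff_eventually_eq (hf : IsDiscSolution z ρ j w f) {u : ℂ}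
    (hu : z j + Complex.exp u ∈ singDisc z j) (h1 : ‖z j + Complex.exp u‖ ≠ 1) :
    ∀ᶠ v in 𝓝 u, connCoeff z ρ j w f v = connCoeff z ρ j w f u := by
  refine discCoeff_eventually_eq hu ?_
  have hne : z j + Complex.exp u ≠ z j := by simp [Complex.exp_ne_zero]
  filter_upwards [(isOpen_singDisc z j).mem_nhds hu, isOpen_ne.mem_nhds hne,
    (continuous_norm.isOpen_preimage _ isOpen_ne).mem_nhds h1] with y h2 h3 h4
  exact hf.hasDerivAt_sub y h2 h3 h4

/-- The coefficient does not change along a path that avoids the circle. -/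
theorem connCoeff_eq_of_path (hf : IsDiscSolution z ρ j w f) {J : Set ℝ} (hJ : IsPreconnected J)
    {p : ℝ → ℂ} (hp : ContinuousOn p J) (hdisc : ∀ s ∈ J, z j + Complex.exp (p s) ∈ singDisc z j)
    (hcirc : ∀ s ∈ J, ‖z j + Complex.exp (p s)‖ ≠ 1) {s s' : ℝ} (hs : s ∈ J) (hs' : s' ∈ J) :
    connCoeff z ρ j w f (p s) = connCoeff z ρ j w f (p s') :=
  eq_of_eventually_eq_of_isPreconnected hJ (f := fun s => connCoeff z ρ j w f (p s))
    (fun s hs => (hp s hs).eventually (hf.connCoeff_eventually_eq (hdisc s hs) (hcirc s hs))) hs hs'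

/-- The jump of the coefficient across the circle is twice that of the weight. -/
theorem connCoeff_jump (hf : IsDiscSolution z ρ j w f) (h : IsCutWeight z ρ D w) {u₀ : ℂ}
    (hu : z j + Complex.exp u₀ ∈ singDisc z j) (h1 : ‖z j + Complex.exp u₀‖ = 1) :
    ∃ L, ∀ (l : Filter ℂ) [l.NeBot], l ≤ 𝓝 u₀ → ∀ c,
      ((∀ᶠ u in l, connCoeff z ρ j w f u = c ∧ ‖z j + Complex.exp u‖ < 1) →
        c = L + 2 * discCoeff z ρ j w u₀) ∧
      ((∀ᶠ u in l, connCoeff z ρ j w f u = c ∧ 1 < ‖z j + Complex.exp u‖) → c = L) := by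
  set x₀ := z j + Complex.exp u₀ with hx₀
  have hne : ∀ k, x₀ ≠ z k := fun k => by
    rcases eq_or_ne k j with rfl | hk
    · simp [hx₀, Complex.exp_ne_zero]
    · exact ne_sing_of_mem_singDisc hu hk
  obtain ⟨L, hL⟩ := h.tendsto_jump h1 hne
  have hB0 := discBranch_ne_zero z ρ j u₀
  -- The witness is the candidate outer limit of the coefficient. Quantifying over filters below `𝓝
  -- u₀` lets the crossing point be approached along any path in the logarithmic coordinate.
  refine ⟨(L - f x₀) / discBranch z ρ j u₀, fun l _ hl c => ?_⟩
  have hxc : Tendsto (fun u => z j + Complex.exp u) l (𝓝 x₀) :=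
    ((hasDerivAt_sing_add_exp (z j) u₀).continuousAt.tendsto).mono_left hl
  have hBc : Tendsto (discBranch z ρ j) l (𝓝 (discBranch z ρ j u₀)) :=
    ((hasDerivAt_discBranch hu).continuousAt.tendsto).mono_left hl
  have hfc : Tendsto (fun u => f (z j + Complex.exp u)) l (𝓝 (f x₀)) :=
    (hf.differentiableOn.differentiableAt ((isOpen_singDisc z j).mem_nhds hu)).continuousAt.tendsto.comp
      hxc
  have hwc : Tendsto (fun u => w (z j + Complex.exp u)) l (𝓝 (w x₀)) :=
    ((h.hasDerivAt _ (h.circle_subset x₀ h1 hne)).continuousAt.tendsto).comp hxc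
  have hsplit : ∀ u, connCoeff z ρ j w f u * discBranch z ρ j u + f (z j + Complex.exp u)
      = caratheodory w (z j + Complex.exp u) := by
    intro u
    rw [connCoeff, discCoeff, div_mul_cancel₀ _ (discBranch_ne_zero _ _ _ _)]
    ring
  have hlim : (∀ᶠ u in l, ‖z j + Complex.exp u‖ ≠ 1) → Tendsto (fun u =>
      caratheodory w (z j + Complex.exp u)
        - if ‖z j + Complex.exp u‖ < 1 then 2 * w (z j + Complex.exp u) else 0) l (𝓝 L) :=
    fun hcirc => hL.comp (tendsto_nhdsWithin_iff.2 ⟨hxc, hcirc⟩)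
  constructor
  · intro hin
    have h2 := hlim (hin.mono fun u hu => hu.2.ne)
    have h3 : Tendsto (fun u => c * discBranch z ρ j u + f (z j + Complex.exp u)
        - 2 * w (z j + Complex.exp u)) l (𝓝 (c * discBranch z ρ j u₀ + f x₀ - 2 * w x₀)) :=
      ((hBc.const_mul c).add hfc).sub (hwc.const_mul 2)
    have h4 := tendsto_nhds_unique_of_eventuallyEq h2 h3 (by
      filter_upwards [hin] with u hu
      rw [if_pos hu.2, ← hsplit, hu.1])
    rw [discCoeff, h4, ← hx₀]
    field_simp
    ring
  · intro hout
    have h2 := hlim (hout.mono fun u hu => hu.2.ne')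
    have h3 : Tendsto (fun u => c * discBranch z ρ j u + f (z j + Complex.exp u)) l
        (𝓝 (c * discBranch z ρ j u₀ + f x₀)) := (hBc.const_mul c).add hfc
    have h4 := tendsto_nhds_unique_of_eventuallyEq h2 h3 (by
      filter_upwards [hout] with u hu
      rw [if_neg hu.2.not_gt, ← hsplit, hu.1, sub_zero])
    rw [h4]
    field_simp
    ring

end IsDiscSolution

/-- If `(y - a) / (x - a) = -r` with `r ≥ 0`, then `a = (r x + y) / (1 + r)` lies on the segment. So
the principal logarithm of the quotient is the change of `log (· - a)` along a segment avoiding `a`.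
-/
theorem div_mem_slitPlane_of_notMem_segment {a x y : ℂ} (h : a ∉ segment ℝ x y) :
    (y - a) / (x - a) ∈ Complex.slitPlane := by
  have hxa : x - a ≠ 0 := sub_ne_zero.2 fun h' => h (h' ▸ left_mem_segment ℝ x y)
  by_contra hs
  rw [Complex.mem_slitPlane_iff] at hs
  push Not at hs
  obtain ⟨h1, h2⟩ := hs
  set r := -((y - a) / (x - a)).re with hr
  have hr0 : 0 ≤ r := by linarith
  have h3 : (y - a) / (x - a) = -(r : ℂ) := by
    apply Complex.ext <;> simp [hr, h2]
  have h4 : y - a = -(r : ℂ) * (x - a) := by rw [← h3, div_mul_cancel₀ _ hxa]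
  refine h ⟨r / (1 + r), 1 / (1 + r), by positivity, by positivity, by field_simp; ring, ?_⟩
  have h5 : (1 + r : ℂ) ≠ 0 := by
    have : (1 + r : ℝ) ≠ 0 := by positivity
    exact_mod_cast this
  simp only [Complex.real_smul]
  push_cast
  field_simp
  linear_combination h4

/-- The path from `x` to `y` in the coordinate `log (· - a)`. -/
theorem exists_log_segment {a x y u : ℂ} (h : a ∉ segment ℝ x y) (hu : Complex.exp u = x - a) :
    ∃ p : ℝ → ℂ, ContinuousOn p (Icc 0 1) ∧ p 0 = u ∧
      p 1 = u + Complex.log ((y - a) / (x - a)) ∧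
      ∀ s ∈ Icc (0 : ℝ) 1, a + Complex.exp (p s) = x + s * (y - x) := by
  have hxa : x - a ≠ 0 := sub_ne_zero.2 fun h' => h (h' ▸ left_mem_segment ℝ x y)
  have hslit : ∀ s ∈ Icc (0 : ℝ) 1, (x + s * (y - x) - a) / (x - a) ∈ Complex.slitPlane := by
    intro s hs
    refine div_mem_slitPlane_of_notMem_segment fun h' => h ?_
    refine (convex_segment x y).segment_subset (left_mem_segment ℝ x y) ?_ h'
    exact ⟨1 - s, s, by linarith [hs.2], hs.1, by ring, by simp only [Complex.real_smul]; push_cast; ring⟩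
  refine ⟨fun s => u + Complex.log ((x + s * (y - x) - a) / (x - a)), ?_, ?_, ?_, ?_⟩
  · exact continuousOn_const.add (ContinuousOn.clog (by fun_prop) hslit)
  · simp [div_self hxa]
  · simp
  · intro s hs
    rw [Complex.exp_add, Complex.exp_log (Complex.slitPlane_ne_zero (hslit s hs)), hu]
    field_simp
    ring

namespace IsDiscSolution
variable {j : Fin m} {f : ℂ → ℂ}

/-- Transport of the coefficient along a segment that ends on the circle. -/
theorem connCoeff_of_segment (hf : IsDiscSolution z ρ j w f) {x y u : ℂ}
    (hx : x ∈ singDisc z j) (hy : y ∈ singDisc z j) (hj : z j ∉ segment ℝ x y)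
    (hu : Complex.exp u = x - z j) (hseg : ∀ s ∈ Ioc (0 : ℝ) 1, ‖x + s * (y - x)‖ ≠ 1) :
    ∃ l : Filter ℂ, l.NeBot ∧ l ≤ 𝓝 u ∧ ∀ P : ℂ → Prop, (∀ s ∈ Ioc (0 : ℝ) 1, P (x + s * (y - x))) →
      ∀ᶠ v in l, connCoeff z ρ j w f v
        = connCoeff z ρ j w f (u + Complex.log ((y - z j) / (x - z j))) ∧ P (z j + Complex.exp v) := by
  obtain ⟨p, hpc, hp0, hp1, hp⟩ := exists_log_segment hj hu
  have hJ : Ioc (0 : ℝ) 1 ⊆ Icc 0 1 := Ioc_subset_Icc_self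
  have hdisc : ∀ s ∈ Icc (0 : ℝ) 1, z j + Complex.exp (p s) ∈ singDisc z j := by
    intro s hs
    rw [hp s hs]
    refine (convex_singDisc z j).segment_subset hx hy
      ⟨1 - s, s, by linarith [hs.2], hs.1, by ring, ?_⟩
    simp only [Complex.real_smul]; push_cast; ring
  have hmem : Ioc (0 : ℝ) 1 ∈ 𝓝[>] (0 : ℝ) := Ioc_mem_nhdsGT one_pos
  -- The filter approaches `u` along the lifted segment; only the initial point `x` may lie on the
  -- unit circle.
  refine ⟨map p (𝓝[>] 0), inferInstance, ?_, fun P hP => ?_⟩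
  · have h1 : Tendsto p (𝓝[Icc 0 1] 0) (𝓝 (p 0)) := hpc 0 (left_mem_Icc.2 zero_le_one)
    rw [hp0] at h1
    refine h1.mono_left (nhdsWithin_le_of_mem ?_)
    exact mem_of_superset hmem hJ
  · rw [eventually_map]
    filter_upwards [hmem] with s hs
    refine ⟨?_, by rw [hp s (hJ hs)]; exact hP s hs⟩
    rw [← hp1]
    exact hf.connCoeff_eq_of_path isPreconnected_Ioc (hpc.mono hJ) (fun s hs => hdisc s (hJ hs))
      (fun s hs => by rw [hp s (hJ hs)]; exact hseg s hs) hs ⟨one_pos, le_rfl⟩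

/-- `z_j` inside the circle, base point outside. -/
theorem connCoeff_exterior (hf : IsDiscSolution z ρ j w f) (h : IsCutWeight z ρ D w)
    (hj : ‖z j‖ < 1) {b u : ℂ} (hb : b ∈ singDisc z j) (hb1 : 1 < ‖b‖)
    (hu : Complex.exp u = b / ‖b‖ - z j) :
    b / ‖b‖ ∈ singDisc z j ∧ z j ∉ segment ℝ (b / ‖b‖) b ∧
    connCoeff z ρ j w f (u + Complex.log ((b - z j) / (b / ‖b‖ - z j)))
      = -2 * discCoeff z ρ j w u := by
  set x := b / ‖b‖ with hx
  have hb0 : (‖b‖ : ℂ) ≠ 0 := by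
    have : ‖b‖ ≠ 0 := by linarith
    exact_mod_cast this
  have hbx : b = ‖b‖ * x := by rw [hx]; field_simp
  have hx1 : ‖x‖ = 1 := by
    rw [hx, norm_div, Complex.norm_real, norm_norm, div_self]; linarith
  have hxB : x ∈ singDisc z j := by
    intro k hk
    refine lt_trans ?_ (hb k hk)
    rw [dist_eq_norm, dist_eq_norm]
    refine lt_of_pow_lt_pow_left₀ 2 (norm_nonneg _) ?_
    -- This quadratic in `r` increases for `r ≥ 1`, as `Re (x z̄_j) ≤ |z_j| < 1`. So the radial
    -- projection `x` of `b` is closer to `z_j` than `b` and stays in the disc.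
    have e : ∀ r : ℝ, ‖(r : ℂ) * x - z j‖ ^ 2
        = r ^ 2 - 2 * r * (x * starRingEnd ℂ (z j)).re + ‖z j‖ ^ 2 := by
      intro r
      rw [← Complex.normSq_eq_norm_sq, Complex.normSq_sub, Complex.normSq_mul,
        Complex.normSq_ofReal, Complex.normSq_eq_norm_sq x, hx1, Complex.normSq_eq_norm_sq,
        mul_assoc (r : ℂ), Complex.re_ofReal_mul]
      ring
    have e1 := e 1
    rw [Complex.ofReal_one, one_mul] at e1
    rw [e1, hbx, e]
    have h3 : (x * starRingEnd ℂ (z j)).re ≤ ‖z j‖ := by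
      refine (Complex.re_le_norm _).trans ?_
      rw [norm_mul, hx1, one_mul, Complex.norm_conj]
    nlinarith
  have hnorm : ∀ s : ℝ, 0 ≤ s → ‖x + s * (b - x)‖ = 1 + s * (‖b‖ - 1) := by
    intro s hs
    have : x + s * (b - x) = ((1 + s * (‖b‖ - 1) : ℝ) : ℂ) * x := by
      conv_lhs => rw [hbx]
      push_cast; ring
    rw [this, norm_mul, hx1, mul_one, Complex.norm_real, Real.norm_of_nonneg]
    nlinarith
  have hzseg : z j ∉ segment ℝ x b := by
    rintro ⟨r, s, hr, hs, hrs, he⟩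
    have : x + s * (b - x) = z j := by
      rw [← he]
      simp only [Complex.real_smul]
      have : r = 1 - s := by linarith
      rw [this]; push_cast; ring
    rw [← this, hnorm s hs] at hj
    nlinarith
  refine ⟨hxB, hzseg, ?_⟩
  have hux : z j + Complex.exp u = x := by rw [hu]; ring
  obtain ⟨L, hL⟩ := hf.connCoeff_jump h (u₀ := u) (by rwa [hux]) (by rwa [hux])
  have hout : ∀ s ∈ Ioc (0 : ℝ) 1, 1 < ‖x + s * (b - x)‖ := by
    intro s hs
    rw [hnorm s hs.1.le]
    nlinarith [hs.1]
  obtain ⟨l, hl, hle, hev⟩ := hf.connCoeff_of_segment hxB hb hzseg hu fun s hs => (hout s hs).ne'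
  have h1 := (hL l hle _).2 (hev (fun y => 1 < ‖y‖) hout)
  -- On the inner side `F = f`, so the coefficient is zero there; together with `h1` this fixes the
  -- outer value. One must also show that the inner side accumulates at `u`.
  have h2 : (0 : ℂ) = L + 2 * discCoeff z ρ j w u := by
    have hfr : (𝓝[{v | ‖z j + Complex.exp v‖ < 1}] u).NeBot := by
      rw [← mem_closure_iff_nhdsWithin_neBot]
      -- The inward segment stops halfway to `z_j`, since the logarithm cannot follow it to `z_j`
      -- itself.
      have hxz : z j ∉ segment ℝ x (z j + (1 / 2 : ℝ) * (x - z j)) := by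
        rintro ⟨r, s, hr, hs, hrs, he⟩
        have hx0 : x - z j ≠ 0 := by rw [← hu]; exact Complex.exp_ne_zero _
        simp only [Complex.real_smul] at he
        have h4 : (r : ℂ) + s = 1 := by exact_mod_cast hrs
        have h5 : ((r + s / 2 : ℝ) : ℂ) * (x - z j) = 0 := by
          push_cast
          push_cast at he
          linear_combination he - z j * h4
        rcases mul_eq_zero.1 h5 with h6 | h6
        · have : r + s / 2 = 0 := by exact_mod_cast h6
          linarith
        · exact hx0 h6
      obtain ⟨p, hpc, hp0, -, hp⟩ := exists_log_segment hxz hu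
      have h1 : Tendsto p (𝓝[>] 0) (𝓝 u) := by
        have h1 : Tendsto p (𝓝[Icc 0 1] 0) (𝓝 (p 0)) := hpc 0 (left_mem_Icc.2 zero_le_one)
        rw [hp0] at h1
        exact h1.mono_left (nhdsWithin_le_of_mem (Icc_mem_nhdsGT one_pos))
      refine mem_closure_of_tendsto h1 ?_
      filter_upwards [Ioc_mem_nhdsGT one_pos] with s hs
      rw [hp s ⟨hs.1.le, hs.2⟩]
      have e : x + s * (z j + (1 / 2 : ℝ) * (x - z j) - x)
          = ((1 - s / 2 : ℝ) : ℂ) * x + ((s / 2 : ℝ) : ℂ) * z j := by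
        push_cast; ring
      rw [e]
      refine (norm_add_le _ _).trans_lt ?_
      rw [norm_mul, norm_mul, hx1, Complex.norm_real, Complex.norm_real,
        Real.norm_of_nonneg (by linarith [hs.2]), Real.norm_of_nonneg (by linarith [hs.1])]
      nlinarith [hs.1]
    refine (hL (𝓝[{v | ‖z j + Complex.exp v‖ < 1}] u) nhdsWithin_le_nhds 0).1 ?_
    have hB : ∀ᶠ v in 𝓝 u, z j + Complex.exp v ∈ singDisc z j :=
      (hasDerivAt_sing_add_exp (z j) u).continuousAt.eventually
        ((isOpen_singDisc z j).mem_nhds (by simpa only [hux] using hxB))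
    filter_upwards [self_mem_nhdsWithin, nhdsWithin_le_nhds hB] with v hv hvB
    refine ⟨?_, hv⟩
    rw [connCoeff, discCoeff, hf.eq_interior hj _ hvB hv, sub_self, zero_div]
  rw [h1]
  linear_combination -h2

/-- `z_j` outside the circle, base point inside. -/
theorem connCoeff_interior (hf : IsDiscSolution z ρ j w f) (h : IsCutWeight z ρ D w)
    (hj : 1 < ‖z j‖) {b u : ℂ} (hb : b ∈ singDisc z j) (hb1 : ‖b‖ < 1)
    (hu : Complex.exp u = z j / ‖z j‖ - z j) :
    z j / ‖z j‖ ∈ singDisc z j ∧ z j ∉ segment ℝ (z j / ‖z j‖) b ∧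
    connCoeff z ρ j w f (u + Complex.log ((b - z j) / (z j / ‖z j‖ - z j)))
      = 2 * discCoeff z ρ j w u := by
  -- The crossing point is the radial projection of `z_j`, at distance `|z_j| - 1`. This is less
  -- than the distance from `z_j` to the interior point `b`, so `x` lies in the disc.
  set x := z j / ‖z j‖ with hx
  have hb0 : (‖z j‖ : ℂ) ≠ 0 := by
    have : ‖z j‖ ≠ 0 := by linarith
    exact_mod_cast this
  have hbx : z j = ‖z j‖ * x := by rw [hx]; field_simp
  have hx1 : ‖x‖ = 1 := by
    rw [hx, norm_div, Complex.norm_real, norm_norm, div_self]; linarith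
  have hxz : ‖x - z j‖ = ‖z j‖ - 1 := by
    have : x - z j = ((1 - ‖z j‖ : ℝ) : ℂ) * x := by
      conv_lhs => rw [hbx]
      push_cast; ring
    rw [this, norm_mul, hx1, mul_one, Complex.norm_real, Real.norm_eq_abs, abs_sub_comm,
      abs_of_pos (by linarith)]
  have hxB : x ∈ singDisc z j := by
    intro k hk
    refine lt_trans ?_ (hb k hk)
    rw [dist_eq_norm, dist_eq_norm, hxz]
    have := norm_sub_norm_le (z j) b
    rw [norm_sub_rev] at this
    linarith
  have hin : ∀ s ∈ Ioc (0 : ℝ) 1, ‖x + s * (b - x)‖ < 1 := by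
    intro s hs
    have : x + s * (b - x) = ((1 - s : ℝ) : ℂ) * x + (s : ℂ) * b := by push_cast; ring
    rw [this]
    refine (norm_add_le _ _).trans_lt ?_
    rw [norm_mul, norm_mul, hx1, Complex.norm_real, Complex.norm_real,
      Real.norm_of_nonneg (by linarith [hs.2]), Real.norm_of_nonneg hs.1.le]
    nlinarith [hs.1]
  have hzseg : z j ∉ segment ℝ x b := by
    intro hz
    have h1 := (convex_closedBall (0 : ℂ) 1).segment_subset (by simp [hx1]) (by simpa using hb1.le) hz
    rw [mem_closedBall_zero_iff] at h1
    linarith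
  refine ⟨hxB, hzseg, ?_⟩
  have hux : z j + Complex.exp u = x := by rw [hu]; ring
  obtain ⟨L, hL⟩ := hf.connCoeff_jump h (u₀ := u) (by rwa [hux]) (by rwa [hux])
  obtain ⟨l, hl, hle, hev⟩ := hf.connCoeff_of_segment hxB hb hzseg hu fun s hs => (hin s hs).ne
  have h1 := (hL l hle _).1 (hev (fun y => ‖y‖ < 1) hin)
  have h2 : (0 : ℂ) = L := by
    have hfr : (𝓝[{v | 1 < ‖z j + Complex.exp v‖}] u).NeBot := by
      rw [← mem_closure_iff_nhdsWithin_neBot]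
      -- These coordinates describe `x + s (z_j - x)`, which moves radially outwards from the unit
      -- circle.
      have h1 : Tendsto (fun s : ℝ => u + Complex.log (1 - s)) (𝓝[>] 0) (𝓝 u) := by
        have hc : ContinuousAt (fun s : ℝ => u + Complex.log (1 - s)) 0 := by
          refine continuousAt_const.add (ContinuousAt.clog (by fun_prop) ?_)
          simp
        have := hc.tendsto
        simp only [Complex.ofReal_zero, sub_zero, Complex.log_one, add_zero] at this
        exact this.mono_left nhdsWithin_le_nhds
      refine mem_closure_of_tendsto h1 ?_
      filter_upwards [Ioo_mem_nhdsGT (one_pos : (0 : ℝ) < 1)] with s hs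
      have hs1 : (1 - s : ℂ) ≠ 0 := by
        have : (1 - s : ℝ) ≠ 0 := by linarith [hs.2]
        exact_mod_cast this
      rw [Complex.exp_add, Complex.exp_log hs1, hu]
      have e : z j + (x - z j) * (1 - s) = ((1 + s * (‖z j‖ - 1) : ℝ) : ℂ) * x := by
        rw [show z j + (x - z j) * (1 - s) = x + s * (z j - x) by ring]
        conv_lhs => rw [hbx]
        push_cast; ring
      rw [e, norm_mul, hx1, mul_one, Complex.norm_real, Real.norm_of_nonneg (by nlinarith [hs.1])]
      nlinarith [hs.1]
    refine (hL (𝓝[{v | 1 < ‖z j + Complex.exp v‖}] u) nhdsWithin_le_nhds 0).2 ?_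
    have hB : ∀ᶠ v in 𝓝 u, z j + Complex.exp v ∈ singDisc z j :=
      (hasDerivAt_sing_add_exp (z j) u).continuousAt.eventually
        ((isOpen_singDisc z j).mem_nhds (by simpa only [hux] using hxB))
    filter_upwards [self_mem_nhdsWithin, nhdsWithin_le_nhds hB] with v hv hvB
    refine ⟨?_, hv⟩
    rw [connCoeff, discCoeff, hf.eq_exterior hj _ hvB hv, sub_self, zero_div]
  rw [h1, ← h2, zero_add]

end IsDiscSolution
end

section
variable {m : ℕ} {z ρ : Fin m → ℂ} {D : Set ℂ} {w : ℂ → ℂ}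

/-! ### A singularity near the circle -/

/-- The law of cosines, with `θ` measured from the direction of `a`, so that `θ = 0` points away
from the origin. -/
theorem norm_circle_sq {a : ℂ} {α δ θ : ℝ} (hδ : 0 < δ) (ha : a = ‖a‖ * Complex.exp (α * Complex.I)) :
    ‖a + Complex.exp (Real.log δ + (α + θ) * Complex.I)‖ ^ 2
      = ‖a‖ ^ 2 + δ ^ 2 + 2 * ‖a‖ * δ * Real.cos θ := by
  have h1 : Complex.exp (Real.log δ + (α + θ) * Complex.I)
      = Complex.exp (α * Complex.I) * (δ * Complex.exp (θ * Complex.I)) := by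
    rw [Complex.exp_add, ← Complex.ofReal_exp, Real.exp_log hδ, add_mul, Complex.exp_add]
    ring
  have h2 : a + Complex.exp (Real.log δ + (α + θ) * Complex.I)
      = Complex.exp (α * Complex.I) * (‖a‖ + δ * Complex.exp (θ * Complex.I)) := by
    rw [h1]
    conv_lhs => rw [ha]
    ring
  rw [h2, norm_mul, Complex.norm_exp_ofReal_mul_I, one_mul, ← Complex.normSq_eq_norm_sq,
    Complex.exp_mul_I, ← Complex.ofReal_cos, ← Complex.ofReal_sin]
  simp only [Complex.normSq_apply, Complex.add_re, Complex.add_im, Complex.mul_re, Complex.mul_im,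
    Complex.ofReal_re, Complex.ofReal_im, Complex.I_re, Complex.I_im]
  have := Real.sin_sq_add_cos_sq θ
  linear_combination δ ^ 2 * this

theorem cos_lt_of_mem_Ioo {κ θ : ℝ} (h1 : -1 < κ) (h2 : κ < 1)
    (hθ : θ ∈ Ioo (Real.arccos κ) (2 * Real.pi - Real.arccos κ)) : Real.cos θ < κ := by
  have hA := Real.cos_arccos h1.le h2.le
  rcases le_total θ Real.pi with h | h
  · rw [← hA]
    exact Real.cos_lt_cos_of_nonneg_of_le_pi (Real.arccos_nonneg κ) h hθ.1
  · rw [← hA, ← Real.cos_two_pi_sub θ]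
    exact Real.cos_lt_cos_of_nonneg_of_le_pi (Real.arccos_nonneg κ) (by linarith)
      (by linarith [hθ.2])

theorem lt_cos_of_mem_Ioo {κ θ : ℝ} (h1 : -1 < κ) (h2 : κ < 1)
    (hθ : θ ∈ Ioo (-Real.arccos κ) (Real.arccos κ)) : κ < Real.cos θ := by
  have hA := Real.cos_arccos h1.le h2.le
  rw [← Real.cos_abs θ, ← hA]
  exact Real.cos_lt_cos_of_nonneg_of_le_pi (abs_nonneg θ) (Real.arccos_le_pi κ)
    (abs_lt.2 ⟨hθ.1, hθ.2⟩)

/-- The connection coefficient when the circle about `z_j` through the base point meets the unit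
circle in two points. -/
theorem IsDiscSolution.connCoeff_of_circle {j : Fin m} {f : ℂ → ℂ}
    (hf : IsDiscSolution z ρ j w f) (h : IsCutWeight z ρ D w) {α δ κ : ℝ} (hδ : 0 < δ)
    (hj : z j ≠ 0) (hα : z j = ‖z j‖ * Complex.exp (α * Complex.I))
    (hdisc : ∀ x, dist x (z j) = δ → x ∈ singDisc z j)
    (hκ : κ = (1 - ‖z j‖ ^ 2 - δ ^ 2) / (2 * ‖z j‖ * δ)) (h1 : -1 < κ) (h2 : κ < 1)
    {u : ℝ → ℂ} (hu : u = fun θ : ℝ => (Real.log δ : ℂ) + (α + θ) * Complex.I) {A : ℝ}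
    (hA : A = Real.arccos κ) {c₀ : ℂ}
    (hc₀ : c₀ = 2 * (discCoeff z ρ j w (u (2 * Real.pi - A)) - discCoeff z ρ j w (u A))) :
    (∀ θ ∈ Ioo (-A) A, connCoeff z ρ j w f (u θ)
      * (1 - Complex.exp (-(2 * Real.pi * Complex.I * ρ j))) = c₀) ∧
    (∀ θ ∈ Ioo A (2 * Real.pi - A), (connCoeff z ρ j w f (u θ) - 2 * discCoeff z ρ j w (u A))
      * (1 - Complex.exp (-(2 * Real.pi * Complex.I * ρ j))) = c₀) := by
  have hn : 0 < ‖z j‖ := norm_pos_iff.2 hj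
  -- The sign of `cos θ - κ` decides the side of the unit circle, and the crossings are at `A` and
  -- `2π - A`. Only `|κ| < 1` matters, not `|z_j| = 1`.
  have hsq : ∀ θ, ‖z j + Complex.exp (u θ)‖ ^ 2 - 1 = 2 * ‖z j‖ * δ * (Real.cos θ - κ) := by
    intro θ
    rw [hu, norm_circle_sq hδ hα, hκ]
    field_simp
    ring
  have hpos : 0 < 2 * ‖z j‖ * δ := by positivity
  have hin : ∀ θ, Real.cos θ < κ → ‖z j + Complex.exp (u θ)‖ < 1 := fun θ hθ => by
    have := hsq θ
    have h3 := mul_neg_of_pos_of_neg hpos (sub_neg.2 hθ)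
    exact (sq_lt_one_iff₀ (norm_nonneg _)).1 (by linarith)
  have hout : ∀ θ, κ < Real.cos θ → 1 < ‖z j + Complex.exp (u θ)‖ := fun θ hθ => by
    have := hsq θ
    have h3 := mul_pos hpos (sub_pos.2 hθ)
    exact (one_lt_sq_iff₀ (norm_nonneg _)).1 (by linarith)
  have hon : ∀ θ, Real.cos θ = κ → ‖z j + Complex.exp (u θ)‖ = 1 := fun θ hθ => by
    have := hsq θ
    rw [hθ, sub_self, mul_zero, sub_eq_zero] at this
    exact (pow_eq_one_iff_of_nonneg (norm_nonneg _) two_ne_zero).1 this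
  have huB : ∀ θ, z j + Complex.exp (u θ) ∈ singDisc z j := fun θ => by
    refine hdisc _ ?_
    rw [dist_eq_norm, add_sub_cancel_left, Complex.norm_exp, hu]
    simp [Real.exp_log hδ]
  have huc : Continuous u := by rw [hu]; fun_prop
  have hcosA : Real.cos A = κ := by rw [hA, Real.cos_arccos h1.le h2.le]
  have hcosB : Real.cos (2 * Real.pi - A) = κ := by rw [Real.cos_two_pi_sub, hcosA]
  have hA0 : 0 < A := by rw [hA]; exact Real.arccos_pos.2 h2
  have hAπ : A < Real.pi := by
    refine lt_of_le_of_ne (hA ▸ Real.arccos_le_pi κ) fun h3 => ?_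
    rw [h3, Real.cos_pi] at hcosA
    linarith
  have hOut : ∀ θ ∈ Ioo (-A) A, 1 < ‖z j + Complex.exp (u θ)‖ := fun θ hθ =>
    hout θ (lt_cos_of_mem_Ioo h1 h2 (hA ▸ hθ))
  have hIn : ∀ θ ∈ Ioo A (2 * Real.pi - A), ‖z j + Complex.exp (u θ)‖ < 1 := fun θ hθ =>
    hin θ (cos_lt_of_mem_Ioo h1 h2 (hA ▸ hθ))
  have hOut' : ∀ θ ∈ Ioo (2 * Real.pi - A) (2 * Real.pi + A), 1 < ‖z j + Complex.exp (u θ)‖ := by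
    intro θ hθ
    refine hout θ ?_
    rw [← Real.cos_sub_two_pi]
    exact lt_cos_of_mem_Ioo h1 h2 (hA ▸ ⟨by linarith [hθ.1], by linarith [hθ.2]⟩)
  have cOut : ∀ θ ∈ Ioo (-A) A, connCoeff z ρ j w f (u θ) = connCoeff z ρ j w f (u 0) := fun θ hθ =>
    hf.connCoeff_eq_of_path isPreconnected_Ioo huc.continuousOn (fun s _ => huB s)
      (fun s hs => (hOut s hs).ne') hθ ⟨by linarith, hA0⟩
  have cIn : ∀ θ ∈ Ioo A (2 * Real.pi - A),
      connCoeff z ρ j w f (u θ) = connCoeff z ρ j w f (u Real.pi) := fun θ hθ =>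
    hf.connCoeff_eq_of_path isPreconnected_Ioo huc.continuousOn (fun s _ => huB s)
      (fun s hs => (hIn s hs).ne) hθ ⟨hAπ, by linarith⟩
  -- Past the second crossing the outer arc is entered again one turn later, so its coefficient is
  -- that at `u 0` times `e^{-2πiρ_j}`.
  have cOut' : ∀ θ ∈ Ioo (2 * Real.pi - A) (2 * Real.pi + A), connCoeff z ρ j w f (u θ)
      = Complex.exp (-(2 * Real.pi * Complex.I * ρ j)) * connCoeff z ρ j w f (u 0) := by
    intro θ hθ
    rw [hf.connCoeff_eq_of_path isPreconnected_Ioo huc.continuousOn (fun s _ => huB s)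
      (fun s hs => (hOut' s hs).ne') hθ (s' := 2 * Real.pi) ⟨by linarith, by linarith⟩, connCoeff,
      ← discCoeff_add_two_pi]
    congr 1
    rw [hu]
    push_cast; ring
  obtain ⟨L₁, hL₁⟩ := hf.connCoeff_jump h (huB A) (hon A hcosA)
  obtain ⟨L₂, hL₂⟩ := hf.connCoeff_jump h (huB (2 * Real.pi - A)) (hon _ hcosB)
  -- With `c` the outer coefficient, `a` that of the weight and `q = e^{-2πiρ_j}`, matching the
  -- inner value at both crossings gives `c + 2a(A) = q c + 2a(2π - A)`. This is the asserted
  -- relation.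
  have e1 : connCoeff z ρ j w f (u 0) = L₁ := by
    refine (hL₁ (map u (𝓝[<] A)) (huc.continuousAt.tendsto.mono_left nhdsWithin_le_nhds) _).2 ?_
    rw [eventually_map]
    filter_upwards [Ioo_mem_nhdsLT (show -A < A by linarith)] with θ hθ
    exact ⟨cOut θ hθ, hOut θ hθ⟩
  have e2 : connCoeff z ρ j w f (u Real.pi) = L₁ + 2 * discCoeff z ρ j w (u A) := by
    refine (hL₁ (map u (𝓝[>] A)) (huc.continuousAt.tendsto.mono_left nhdsWithin_le_nhds) _).1 ?_
    rw [eventually_map]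
    filter_upwards [Ioo_mem_nhdsGT (show A < 2 * Real.pi - A by linarith)] with θ hθ
    exact ⟨cIn θ hθ, hIn θ hθ⟩
  have e3 : connCoeff z ρ j w f (u Real.pi)
      = L₂ + 2 * discCoeff z ρ j w (u (2 * Real.pi - A)) := by
    refine (hL₂ (map u (𝓝[<] (2 * Real.pi - A)))
      (huc.continuousAt.tendsto.mono_left nhdsWithin_le_nhds) _).1 ?_
    rw [eventually_map]
    filter_upwards [Ioo_mem_nhdsLT (show A < 2 * Real.pi - A by linarith)] with θ hθ
    exact ⟨cIn θ hθ, hIn θ hθ⟩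
  have e4 : Complex.exp (-(2 * Real.pi * Complex.I * ρ j)) * connCoeff z ρ j w f (u 0) = L₂ := by
    refine (hL₂ (map u (𝓝[>] (2 * Real.pi - A)))
      (huc.continuousAt.tendsto.mono_left nhdsWithin_le_nhds) _).2 ?_
    rw [eventually_map]
    filter_upwards [Ioo_mem_nhdsGT (show 2 * Real.pi - A < 2 * Real.pi + A by linarith)] with θ hθ
    exact ⟨cOut' θ hθ, hOut' θ hθ⟩
  refine ⟨fun θ hθ => ?_, fun θ hθ => ?_⟩
  · rw [cOut θ hθ, hc₀]
    linear_combination e1 + e3 - e2 - e4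
  · rw [cIn θ hθ, hc₀, e2]
    linear_combination
      (Complex.exp (-(2 * Real.pi * Complex.I * ρ j))) * e1 + e3 - e2 - e4

end

/-! ### The weight along a deformation -/

theorem exists_continuousAt_log {y : ℝ → ℂ} {t₀ : ℝ} (hy : ContinuousAt y t₀) {v : ℂ}
    (hv : Complex.exp v = y t₀) : ∃ l : ℝ → ℂ, ContinuousAt l t₀ ∧ l t₀ = v ∧
      ∀ᶠ t in 𝓝 t₀, Complex.exp (l t) = y t := by
  have h0 : y t₀ ≠ 0 := hv ▸ Complex.exp_ne_zero v
  refine ⟨fun t => Complex.log (y t / y t₀) + v, ?_, by simp [div_self h0], ?_⟩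
  · refine ContinuousAt.add (ContinuousAt.clog (hy.div_const _) ?_) continuousAt_const
    simp [div_self h0]
  · filter_upwards [hy.eventually_ne h0] with t ht
    rw [Complex.exp_add, Complex.exp_log (div_ne_zero ht h0), hv, div_mul_cancel₀ _ h0]

section
variable {m : ℕ} {I : Set ℝ} {D : Set (ℝ × ℂ)} {z : Fin m → ℝ → ℂ} {ρ : Fin m → ℂ}
  {w : ℝ → ℂ → ℂ}

/-- The weight, divided by a continuous branch of `∏ (x - z_k)^{ρ_k}`, is constant in time. -/
theorem IsDeformation.weight_eventually_eq (hw : IsDeformation I D z ρ w) {t₀ : ℝ} (ht₀ : t₀ ∈ I)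
    {x : ℝ → ℂ} (hx : ContinuousAt x t₀) (hD : (t₀, x t₀) ∈ D) {l : Fin m → ℝ → ℂ}
    (hl : ∀ k, ContinuousAt (l k) t₀)
    (hexp : ∀ᶠ t in 𝓝 t₀, ∀ k, Complex.exp (l k t) = x t - z k t) :
    ∀ᶠ t in 𝓝 t₀, w t (x t) * Complex.exp (-∑ k, ρ k * l k t)
      = w t₀ (x t₀) * Complex.exp (-∑ k, ρ k * l k t₀) := by
  set x₀ := x t₀ with hx₀
  obtain ⟨ε, hε, hεD⟩ := Metric.isOpen_iff.1 hw.isOpen_domain _ hD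
  have hmem : ∀ t ∈ Metric.ball t₀ ε, ∀ y ∈ Metric.ball x₀ ε, (t, y) ∈ D := fun t ht y hy =>
    hεD (by rw [← ball_prod_same]; exact ⟨ht, hy⟩)
  have hI : ∀ᶠ t in 𝓝 t₀, t ∈ I := hw.isOpen_time.mem_nhds ht₀
  have hball : ∀ᶠ t in 𝓝 t₀, t ∈ Metric.ball t₀ ε := Metric.ball_mem_nhds t₀ hε
  have hzc : ∀ k, ContinuousAt (z k) t₀ := fun k => (hw.differentiableAt_sing k t₀ ht₀).continuousAt
  have hne : ∀ t ∈ I, ∀ y, (t, y) ∈ D → ∀ k, y - z k t ≠ 0 := fun t ht y hy k =>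
    sub_ne_zero.2 ((hw.isCutWeight ht).ne_sing y hy k)
  have hne₀ : ∀ k, x₀ - z k t₀ ≠ 0 := hne t₀ ht₀ x₀ hD
  have hslit : ∀ᶠ t in 𝓝 t₀, ∀ k, (x₀ - z k t) / (x₀ - z k t₀) ∈ Complex.slitPlane := by
    rw [eventually_all]
    intro k
    have hc : ContinuousAt (fun t => (x₀ - z k t) / (x₀ - z k t₀)) t₀ :=
      (continuousAt_const.sub (hzc k)).div_const _
    refine hc.eventually (Complex.isOpen_slitPlane.mem_nhds ?_)
    simp [div_self (hne₀ k)]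
  set μ : Fin m → ℝ → ℂ := fun k t => Complex.log ((x₀ - z k t) / (x₀ - z k t₀)) with hμ
  -- Time and position are varied one after the other, because only the separate derivatives of `w`
  -- are available.
  have stepT : ∀ᶠ t in 𝓝 t₀, w t x₀ * Complex.exp (-∑ k, ρ k * μ k t) = w t₀ x₀ := by
    have hd : ∀ᶠ t in 𝓝 t₀, HasDerivAt
        (fun t => w t x₀ * Complex.exp (-∑ k, ρ k * μ k t)) 0 t := by
      filter_upwards [hI, hball, hslit] with t h1 h2 h3
      have h4 := hmem t h2 x₀ (Metric.mem_ball_self hε)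
      have h5 : HasDerivAt (fun t => ∑ k, ρ k * μ k t)
          (∑ k, ρ k * (-deriv (z k) t / (x₀ - z k t₀) / ((x₀ - z k t) / (x₀ - z k t₀)))) t := by
        refine HasDerivAt.fun_sum fun k _ => HasDerivAt.const_mul _ ?_
        exact ((((hw.differentiableAt_sing k t h1).hasDerivAt).const_sub x₀).div_const _).clog_real
          (h3 k)
      refine ((hw.hasDerivAt_time t h1 x₀ h4).mul h5.neg.cexp).congr_deriv ?_
      have h6 : (∑ k, ρ k * (-deriv (z k) t / (x₀ - z k t₀) / ((x₀ - z k t) / (x₀ - z k t₀))))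
          = -∑ k, ρ k * deriv (z k) t / (x₀ - z k t) := by
        rw [← Finset.sum_neg_distrib]
        refine Finset.sum_congr rfl fun k _ => ?_
        have := hne₀ k
        have := hne t h1 x₀ h4 k
        field_simp
      rw [h6]
      ring
    filter_upwards [eventually_eq_of_hasDerivAt_zero hd] with t ht
    rw [ht]
    simp [hμ]
  set ν : Fin m → ℝ → ℂ := fun k t => Complex.log ((x t - z k t) / (x₀ - z k t)) with hν
  have stepX : ∀ᶠ t in 𝓝 t₀, w t (x t) * Complex.exp (-∑ k, ρ k * ν k t) = w t x₀ := by
    filter_upwards [hI, hball, hx.eventually (Metric.ball_mem_nhds x₀ hε)] with t h1 h2 h3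
    have hcw := hw.isCutWeight h1
    -- The slice of `D` contains the ball about `x₀` and no singularity. This distance bound is
    -- uniform in `t` and keeps every quotient within the slit plane.
    have hfar : ∀ k, ε ≤ ‖x₀ - z k t‖ := by
      intro k
      by_contra hlt
      push Not at hlt
      refine hne t h1 (z k t) (hmem t h2 _ ?_) k (sub_self _)
      rwa [Metric.mem_ball, dist_comm, dist_eq_norm]
    have hs : ∀ y ∈ Metric.ball x₀ ε, ∀ k, (y - z k t) / (x₀ - z k t) ∈ Complex.slitPlane := by
      intro y hy k
      have h0 : x₀ - z k t ≠ 0 := norm_pos_iff.1 (hε.trans_le (hfar k))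
      have : (y - z k t) / (x₀ - z k t) = 1 + (y - x₀) / (x₀ - z k t) := by field_simp; ring
      rw [this]
      refine Complex.mem_slitPlane_of_norm_lt_one ?_
      rw [norm_div, div_lt_one (hε.trans_le (hfar k)), ← dist_eq_norm]
      exact (Metric.mem_ball.1 hy).trans_le (hfar k)
    set G : ℂ → ℂ := fun y =>
      w t y * Complex.exp (-∑ k, ρ k * Complex.log ((y - z k t) / (x₀ - z k t))) with hG
    have hGd : ∀ y ∈ Metric.ball x₀ ε, HasDerivAt G 0 y := by
      intro y hy
      have h4 := hmem t h2 y hy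
      have h5 : HasDerivAt (fun y => ∑ k, ρ k * Complex.log ((y - z k t) / (x₀ - z k t)))
          (∑ k, ρ k * (1 / (x₀ - z k t) / ((y - z k t) / (x₀ - z k t)))) y := by
        refine HasDerivAt.fun_sum fun k _ => HasDerivAt.const_mul _ ?_
        exact (((hasDerivAt_id y).sub_const (z k t)).div_const _).clog (hs y hy k)
      refine ((hcw.hasDerivAt y h4).mul h5.neg.cexp).congr_deriv ?_
      have h6 : (∑ k, ρ k * (1 / (x₀ - z k t) / ((y - z k t) / (x₀ - z k t))))
          = logDer (fun k => z k t) ρ y := by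
        refine Finset.sum_congr rfl fun k _ => ?_
        have := hne t h1 y h4 k
        have := hne t h1 x₀ (hmem t h2 x₀ (Metric.mem_ball_self hε)) k
        field_simp
      rw [h6]
      ring
    have h7 := Metric.isOpen_ball.is_const_of_deriv_eq_zero (convex_ball x₀ ε).isPreconnected
      (fun y hy => (hGd y hy).differentiableAt.differentiableWithinAt)
      (fun y hy => (hGd y hy).deriv) h3 (Metric.mem_ball_self hε)
    simp only [hG] at h7
    rw [h7]
    have h8 : ∀ k, Complex.log ((x₀ - z k t) / (x₀ - z k t)) = 0 := fun k => by
      rw [div_self (norm_pos_iff.1 (hε.trans_le (hfar k))), Complex.log_one]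
    simp [h8]
  -- The logarithms used in the two moves add up to the change of the prescribed `l k`: both are
  -- continuous logarithms of the same quotient vanishing at `t₀`.
  have stepL : ∀ᶠ t in 𝓝 t₀, ∀ k, μ k t + ν k t = l k t - l k t₀ := by
    rw [eventually_all]
    intro k
    have hμc : ContinuousAt (μ k) t₀ := by
      refine ContinuousAt.clog ((continuousAt_const.sub (hzc k)).div_const _) ?_
      simp [div_self (hne₀ k)]
    have hνc : ContinuousAt (ν k) t₀ := by
      refine ContinuousAt.clog ((hx.sub (hzc k)).div (continuousAt_const.sub (hzc k)) (hne₀ k)) ?_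
      simp [← hx₀, div_self (hne₀ k)]
    have h0 : μ k t₀ + ν k t₀ = 0 := by simp [hμ, hν, ← hx₀, div_self (hne₀ k)]
    have := eventually_log_sub_eq (f := fun t => μ k t + ν k t) (hμc.add hνc) (hl k) (by
      filter_upwards [hI, hball, hexp, hx.eventually (Metric.ball_mem_nhds x₀ hε)]
        with t h1 h2 h3 h4
      have n1 := hne t h1 x₀ (hmem t h2 x₀ (Metric.mem_ball_self hε)) k
      have n2 := hne t h1 (x t) (hmem t h2 _ h4) k
      have n3 := hne₀ k
      rw [h0, sub_zero, Complex.exp_add, Complex.exp_sub, h3, hexp.self_of_nhds,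
        Complex.exp_log (div_ne_zero n1 n3), Complex.exp_log (div_ne_zero n2 n1), ← hx₀]
      field_simp)
    filter_upwards [this] with t ht
    rw [← ht, h0, sub_zero]
  filter_upwards [stepT, stepX, stepL] with t h1 h2 h3
  rw [← h1, ← h2, mul_assoc, mul_assoc, ← Complex.exp_add, ← Complex.exp_add]
  congr 2
  rw [← neg_add, ← neg_add, neg_inj, ← Finset.sum_add_distrib, ← Finset.sum_add_distrib]
  refine Finset.sum_congr rfl fun k _ => ?_
  linear_combination -ρ k * h3 k

theorem IsDeformation.eventually_mem_singDisc (hw : IsDeformation I D z ρ w) {t₀ : ℝ}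
    (ht₀ : t₀ ∈ I) {j : Fin m} {x : ℝ → ℂ} (hx : ContinuousAt x t₀)
    (h : x t₀ ∈ singDisc (fun k => z k t₀) j) :
    ∀ᶠ t in 𝓝 t₀, x t ∈ singDisc (fun k => z k t) j := by
  have hzc : ∀ k, ContinuousAt (z k) t₀ := fun k => (hw.differentiableAt_sing k t₀ ht₀).continuousAt
  simp only [singDisc, mem_ofPred_eq, eventually_all]
  exact fun k hk => (hx.dist (hzc j)).eventually_lt ((hzc k).dist (hzc j)) (h k hk)

/-- In the logarithmic coordinate the coefficient of the weight depends on time only through a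
common factor. -/
theorem IsDeformation.discCoeff_eventually_eq (hw : IsDeformation I D z ρ w) {t₀ : ℝ}
    (ht₀ : t₀ ∈ I) (j : Fin m) : ∃ N : ℝ → ℂ, (∀ t, N t ≠ 0) ∧
    ∀ u : ℝ → ℂ, ContinuousAt u t₀ → z j t₀ + Complex.exp (u t₀) ∈ singDisc (fun k => z k t₀) j →
      (t₀, z j t₀ + Complex.exp (u t₀)) ∈ D →
      ∀ᶠ t in 𝓝 t₀, discCoeff (fun k => z k t) ρ j (w t) (u t)
        = N t * discCoeff (fun k => z k t₀) ρ j (w t₀) (u t₀) := by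
  have hzc : ∀ k, ContinuousAt (z k) t₀ := fun k => (hw.differentiableAt_sing k t₀ ht₀).continuousAt
  have hinj := (hw.isCutWeight ht₀).injective
  have hlog : ∀ k, ∃ l : ℝ → ℂ, k ≠ j → ContinuousAt l t₀ ∧
      ∀ᶠ t in 𝓝 t₀, Complex.exp (l t) = z j t - z k t := by
    intro k
    by_cases hk : k = j
    · exact ⟨0, fun h => absurd hk h⟩
    · have h0 : z j t₀ - z k t₀ ≠ 0 := sub_ne_zero.2 fun h => hk (hinj h).symm
      obtain ⟨l, h1, -, h2⟩ := exists_continuousAt_log (y := fun t => z j t - z k t)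
        ((hzc j).sub (hzc k)) (Complex.exp_log h0)
      exact ⟨l, fun _ => ⟨h1, h2⟩⟩
  choose l hl using hlog
  -- `discFactor` is normalised to `1` at `z_j`, so it differs from `∏_{k ≠ j} (x - z_k)^{ρ_k}` by a
  -- factor `∏_{k ≠ j} (z_j - z_k)^{ρ_k}`. `N` is that factor relative to `t₀`; it does not depend
  -- on `u`.
  refine ⟨fun t => Complex.exp (∑ k ∈ Finset.univ.erase j, ρ k * (l k t - l k t₀)),
    fun t => Complex.exp_ne_zero _, fun u hu hB hD => ?_⟩
  have hxc : ContinuousAt (fun t => z j t + Complex.exp (u t)) t₀ := (hzc j).add hu.cexp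
  have hBt := hw.eventually_mem_singDisc ht₀ hxc hB
  set g : Fin m → ℝ → ℂ := fun k t => Complex.log (1 - Complex.exp (u t) / (z k t - z j t)) with hg
  have hslit : ∀ t, z j t + Complex.exp (u t) ∈ singDisc (fun k => z k t) j → ∀ k, k ≠ j →
      1 - Complex.exp (u t) / (z k t - z j t) ∈ Complex.slitPlane := by
    intro t ht k hk
    have := one_sub_div_mem_slitPlane ht hk
    rwa [add_sub_cancel_left] at this
  have hgc : ∀ k, k ≠ j → ContinuousAt (g k) t₀ := by
    intro k hk
    have h0 : z k t₀ - z j t₀ ≠ 0 := sub_ne_zero.2 fun h => hk (hinj h)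
    exact ContinuousAt.clog (continuousAt_const.sub (hu.cexp.div ((hzc k).sub (hzc j)) h0))
      (hslit t₀ hB k hk)
  have hlt : ∀ᶠ t in 𝓝 t₀, ∀ k, k ≠ j → Complex.exp (l k t) = z j t - z k t := by
    simp only [eventually_all]
    exact fun k hk => (hl k hk).2
  have key := hw.weight_eventually_eq ht₀ hxc hD
    (l := fun k => if k = j then u else fun t => g k t + l k t)
    (fun k => by
      by_cases hk : k = j
      · simpa [hk] using hu
      · simp only [hk, if_false]
        exact (hgc k hk).add (hl k hk).1)
    (by
      filter_upwards [hBt, hlt] with t h1 h2 k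
      by_cases hk : k = j
      · simp [hk]
      · simp only [hk, if_false]
        have h3 := hslit t h1 k hk
        have h4 := h2 k hk
        have h5 : z k t - z j t ≠ 0 := by
          rw [← neg_sub, ← h4]; exact neg_ne_zero.2 (Complex.exp_ne_zero _)
        rw [Complex.exp_add, hg, Complex.exp_log (Complex.slitPlane_ne_zero h3), h4]
        field_simp
        ring)
  have hsplit : ∀ t, discCoeff (fun k => z k t) ρ j (w t) (u t)
      = w t (z j t + Complex.exp (u t)) * Complex.exp (-∑ k, ρ k *
        (if k = j then u else fun t => g k t + l k t) t)
        * Complex.exp (∑ k ∈ Finset.univ.erase j, ρ k * l k t) := by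
    intro t
    rw [← Finset.add_sum_erase _ _ (Finset.mem_univ j)]
    simp only [if_true]
    have h1 : ∑ k ∈ Finset.univ.erase j, ρ k * (if k = j then u else fun t => g k t + l k t) t
        = ∑ k ∈ Finset.univ.erase j, ρ k * g k t + ∑ k ∈ Finset.univ.erase j, ρ k * l k t := by
      rw [← Finset.sum_add_distrib]
      refine Finset.sum_congr rfl fun k hk => ?_
      rw [if_neg (Finset.mem_erase.1 hk).1]
      ring
    rw [h1, mul_assoc, ← Complex.exp_add, discCoeff, discBranch, discFactor, ← Complex.exp_add,
      div_eq_mul_inv, ← Complex.exp_neg]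
    simp only [add_sub_cancel_left, hg]
    congr 2
    ring
  filter_upwards [key] with t ht
  rw [hsplit t, hsplit t₀, ht]
  have : (∑ k ∈ Finset.univ.erase j, ρ k * l k t) = ∑ k ∈ Finset.univ.erase j, ρ k * (l k t - l k t₀)
      + ∑ k ∈ Finset.univ.erase j, ρ k * l k t₀ := by
    rw [← Finset.sum_add_distrib]
    exact Finset.sum_congr rfl fun k _ => by ring
  rw [this, Complex.exp_add]
  ring

end

/-! ### From the logarithmic coordinate back to the base point -/

section
variable {m : ℕ} {z ρ : Fin m → ℂ} {D : Set ℂ} {w : ℂ → ℂ}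

theorem IsDiscSolution.eventually_eq_add {j : Fin m} {f : ℂ → ℂ} (hf : IsDiscSolution z ρ j w f)
    (h : IsCutWeight z ρ D w) {b : ℂ} (hb : b ∈ singDisc z j) (hbD : b ∈ D) (hb1 : ‖b‖ ≠ 1) :
    ∀ᶠ x in 𝓝 b, caratheodory w x = f x + (caratheodory w b - f b) / w b * w x := by
  have hd : ∀ᶠ x in 𝓝 b, HasDerivAt (fun y => (caratheodory w y - f y) / w y) 0 x := by
    filter_upwards [(isOpen_singDisc z j).mem_nhds hb, h.isOpen.mem_nhds hbD,
      (continuous_norm.isOpen_preimage _ isOpen_ne).mem_nhds hb1] with x h1 h2 h3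
    refine ((hf.hasDerivAt_sub x h1 (h.ne_sing x h2 j) h3).div (h.hasDerivAt x h2)
      (h.ne_zero x h2)).congr_deriv ?_
    rw [div_eq_zero_iff]
    left; ring
  filter_upwards [eventually_eq_of_hasDerivAt_zero hd, h.isOpen.mem_nhds hbD] with x h1 h2
  rw [← h1, div_mul_cancel₀ _ (h.ne_zero x h2)]
  ring

theorem div_eq_connCoeff_div {j : Fin m} (w f : ℂ → ℂ) {b u : ℂ} (hu : Complex.exp u = b - z j) :
    (caratheodory w b - f b) / w b = connCoeff z ρ j w f u / discCoeff z ρ j w u := by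
  have hb : z j + Complex.exp u = b := by rw [hu]; ring
  rw [connCoeff, discCoeff, discCoeff, hb, div_div_div_cancel_right₀ (discBranch_ne_zero _ _ _ _)]

/-- Vanishing would force `ρ ∈ ℤ`; positivity of the real part then makes it a natural number. This
allows division when `z_j` is on the unit circle. -/
theorem one_sub_exp_ne_zero {ρ : ℂ} (h : ∀ n : ℕ, ρ ≠ n) (hre : 0 < ρ.re) :
    1 - Complex.exp (-(2 * Real.pi * Complex.I * ρ)) ≠ 0 := by
  intro h0
  obtain ⟨n, hn⟩ := Complex.exp_eq_one_iff.1 (sub_eq_zero.1 h0).symm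
  have h1 : ρ = ((-n : ℤ) : ℂ) := by
    have := Complex.two_pi_I_ne_zero
    refine mul_left_cancel₀ this ?_
    push_cast
    linear_combination -hn
  have h2 : (0 : ℤ) ≤ -n := by
    rw [h1, Complex.intCast_re] at hre
    exact_mod_cast hre.le
  obtain ⟨k, hk⟩ := Int.eq_ofNat_of_zero_le h2
  exact h k (by rw [h1, hk]; simp)

end

/-! ### Constancy in time at a finite singularity -/

section
variable {m : ℕ} {I : Set ℝ} {D : Set (ℝ × ℂ)} {z : Fin m → ℝ → ℂ} {ρ : Fin m → ℂ}
  {w : ℝ → ℂ → ℂ}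

theorem IsDeformation.exists_ne (hw : IsDeformation I D z ρ w) {t : ℝ} (ht : t ∈ I) (j : Fin m) :
    ∃ k, k ≠ j := by
  have h := (hw.semiclassical t ht).two_le
  rw [singPoly, natDegree_finsetProd_X_sub_C_eq_card, Finset.card_univ, Fintype.card_fin] at h
  have : Nontrivial (Fin m) := Fin.nontrivial_iff_two_le.2 h
  exact _root_.exists_ne j

theorem IsDeformation.continuousAt_sing (hw : IsDeformation I D z ρ w) {t : ℝ} (ht : t ∈ I)
    (j : Fin m) : ContinuousAt (z j) t := (hw.differentiableAt_sing j t ht).continuousAt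

/-- The common factor `N t` cancels. This is the mechanism behind isomonodromy: every formula for
`C` is expressed by such ratios. -/
theorem IsDeformation.discCoeff_div_eventually_eq (hw : IsDeformation I D z ρ w) {t₀ : ℝ}
    (ht₀ : t₀ ∈ I) {j : Fin m} {u v : ℝ → ℂ} (hu : ContinuousAt u t₀)
    (huB : z j t₀ + Complex.exp (u t₀) ∈ singDisc (fun k => z k t₀) j)
    (huD : (t₀, z j t₀ + Complex.exp (u t₀)) ∈ D) (hv : ContinuousAt v t₀)
    (hvB : z j t₀ + Complex.exp (v t₀) ∈ singDisc (fun k => z k t₀) j)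
    (hvD : (t₀, z j t₀ + Complex.exp (v t₀)) ∈ D) :
    ∀ᶠ t in 𝓝 t₀, discCoeff (fun k => z k t) ρ j (w t) (u t)
        / discCoeff (fun k => z k t) ρ j (w t) (v t)
      = discCoeff (fun k => z k t₀) ρ j (w t₀) (u t₀)
        / discCoeff (fun k => z k t₀) ρ j (w t₀) (v t₀) := by
  obtain ⟨N, hN, h⟩ := hw.discCoeff_eventually_eq ht₀ j
  filter_upwards [h u hu huB huD, h v hv hvB hvD] with t h1 h2
  rw [h1, h2, mul_div_mul_left _ _ (hN t)]

/-- Here `C` is `-2` times the ratio of the weight coefficients at `b / |b|` and at `b`; the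
logarithms of both points relative to `z_j` are chosen continuous in `t`. -/
theorem IsDeformation.coeff_eventually_eq_exterior (hw : IsDeformation I D z ρ w) {t₀ : ℝ}
    (ht₀ : t₀ ∈ I) {j : Fin m} {b : ℝ → ℂ} (hb : ContinuousAt b t₀)
    (hbB : b t₀ ∈ singDisc (fun k => z k t₀) j) (hbD : (t₀, b t₀) ∈ D) {f : ℝ → ℂ → ℂ}
    (hf : ∀ t ∈ I, IsDiscSolution (fun k => z k t) ρ j (w t) (f t))
    (hj : ‖z j t₀‖ < 1) (hb1 : 1 < ‖b t₀‖) :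
    ∀ᶠ t in 𝓝 t₀, (caratheodory (w t) (b t) - f t (b t)) / w t (b t)
      = (caratheodory (w t₀) (b t₀) - f t₀ (b t₀)) / w t₀ (b t₀) := by
  have hcw := hw.isCutWeight ht₀
  have hzc := hw.continuousAt_sing ht₀ j
  have hb0 : (‖b t₀‖ : ℂ) ≠ 0 := by
    have : ‖b t₀‖ ≠ 0 := by linarith
    exact_mod_cast this
  have hx1 : ‖b t₀ / (‖b t₀‖ : ℂ)‖ = 1 := by
    rw [norm_div, Complex.norm_real, norm_norm, div_self]; linarith
  have hxne : b t₀ / (‖b t₀‖ : ℂ) ≠ z j t₀ := fun h => by rw [h] at hx1; linarith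
  have hxc : ContinuousAt (fun t => b t / (‖b t‖ : ℂ)) t₀ :=
    hb.div (Complex.continuous_ofReal.continuousAt.comp hb.norm) hb0
  obtain ⟨u, huc, hu0, hu⟩ := exists_continuousAt_log (y := fun t => b t / (‖b t‖ : ℂ) - z j t)
    (hxc.sub hzc) (Complex.exp_log (sub_ne_zero.2 hxne))
  obtain ⟨hxB, hseg, -⟩ := (hf t₀ ht₀).connCoeff_exterior hcw hj hbB hb1 hu.self_of_nhds
  have hxD := hcw.circle_subset _ hx1 fun k => by
    rcases eq_or_ne k j with rfl | hk
    · exact hxne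
    · exact ne_sing_of_mem_singDisc hxB hk
  set v : ℝ → ℂ := fun t => u t + Complex.log ((b t - z j t) / (b t / (‖b t‖ : ℂ) - z j t)) with hv
  have hvc : ContinuousAt v t₀ := huc.add (ContinuousAt.clog
    ((hb.sub hzc).div (hxc.sub hzc) (sub_ne_zero.2 hxne)) (div_mem_slitPlane_of_notMem_segment hseg))
  have hev : ∀ᶠ t in 𝓝 t₀, t ∈ I ∧ ‖z j t‖ < 1 ∧ 1 < ‖b t‖ ∧ b t ∈ singDisc (fun k => z k t) j ∧
      b t ≠ z j t := by
    have e1 : ∀ᶠ t in 𝓝 t₀, t ∈ I := hw.isOpen_time.mem_nhds ht₀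
    filter_upwards [e1, hzc.norm.eventually_lt_const hj, hb.norm.eventually_const_lt hb1,
      hw.eventually_mem_singDisc ht₀ hb hbB, (hb.sub hzc).eventually_ne
        (sub_ne_zero.2 (hcw.ne_sing _ hbD j))] with t h1 h2 h3 h4 h5
    exact ⟨h1, h2, h3, h4, sub_ne_zero.1 h5⟩
  have hform : ∀ᶠ t in 𝓝 t₀, Complex.exp (v t) = b t - z j t ∧
      (caratheodory (w t) (b t) - f t (b t)) / w t (b t) = -2 *
        (discCoeff (fun k => z k t) ρ j (w t) (u t) / discCoeff (fun k => z k t) ρ j (w t) (v t)) := by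
    filter_upwards [hev, hu] with t ⟨h1, h2, h3, h4, h5⟩ h6
    obtain ⟨-, hs, hc⟩ := (hf t h1).connCoeff_exterior (hw.isCutWeight h1) h2 h4 h3 h6
    have hexp : Complex.exp (v t) = b t - z j t := by
      rw [hv]
      simp only
      rw [Complex.exp_add, Complex.exp_log
        (Complex.slitPlane_ne_zero (div_mem_slitPlane_of_notMem_segment hs)), h6]
      exact mul_div_cancel₀ _ (h6 ▸ Complex.exp_ne_zero _)
    refine ⟨hexp, ?_⟩
    rw [div_eq_connCoeff_div (z := fun k => z k t) (ρ := ρ) (j := j) _ _ hexp, hc, mul_div_assoc]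
  have hvb : z j t₀ + Complex.exp (v t₀) = b t₀ := by rw [hform.self_of_nhds.1]; ring
  have hub : z j t₀ + Complex.exp (u t₀) = b t₀ / (‖b t₀‖ : ℂ) := by rw [hu.self_of_nhds]; ring
  filter_upwards [hform, hw.discCoeff_div_eventually_eq ht₀ huc (by rwa [hub]) (by rwa [hub]) hvc
    (by rwa [hvb]) (by rwa [hvb])] with t h1 h2
  rw [h1.2, h2, hform.self_of_nhds.2]

/-- As in the exterior case, with the crossing point `z_j / |z_j|` and the factor `2`. -/
theorem IsDeformation.coeff_eventually_eq_interior (hw : IsDeformation I D z ρ w) {t₀ : ℝ}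
    (ht₀ : t₀ ∈ I) {j : Fin m} {b : ℝ → ℂ} (hb : ContinuousAt b t₀)
    (hbB : b t₀ ∈ singDisc (fun k => z k t₀) j) (hbD : (t₀, b t₀) ∈ D) {f : ℝ → ℂ → ℂ}
    (hf : ∀ t ∈ I, IsDiscSolution (fun k => z k t) ρ j (w t) (f t))
    (hj : 1 < ‖z j t₀‖) (hb1 : ‖b t₀‖ < 1) :
    ∀ᶠ t in 𝓝 t₀, (caratheodory (w t) (b t) - f t (b t)) / w t (b t)
      = (caratheodory (w t₀) (b t₀) - f t₀ (b t₀)) / w t₀ (b t₀) := by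
  have hcw := hw.isCutWeight ht₀
  have hzc := hw.continuousAt_sing ht₀ j
  have hb0 : (‖z j t₀‖ : ℂ) ≠ 0 := by
    have : ‖z j t₀‖ ≠ 0 := by linarith
    exact_mod_cast this
  have hx1 : ‖z j t₀ / (‖z j t₀‖ : ℂ)‖ = 1 := by
    rw [norm_div, Complex.norm_real, norm_norm, div_self]; linarith
  have hxne : z j t₀ / (‖z j t₀‖ : ℂ) ≠ z j t₀ := fun h => by rw [h] at hx1; linarith
  have hxc : ContinuousAt (fun t => z j t / (‖z j t‖ : ℂ)) t₀ :=
    hzc.div (Complex.continuous_ofReal.continuousAt.comp hzc.norm) hb0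
  obtain ⟨u, huc, hu0, hu⟩ := exists_continuousAt_log (y := fun t => z j t / (‖z j t‖ : ℂ) - z j t)
    (hxc.sub hzc) (Complex.exp_log (sub_ne_zero.2 hxne))
  obtain ⟨hxB, hseg, -⟩ := (hf t₀ ht₀).connCoeff_interior hcw hj hbB hb1 hu.self_of_nhds
  have hxD := hcw.circle_subset _ hx1 fun k => by
    rcases eq_or_ne k j with rfl | hk
    · exact hxne
    · exact ne_sing_of_mem_singDisc hxB hk
  set v : ℝ → ℂ := fun t => u t + Complex.log ((b t - z j t) / (z j t / (‖z j t‖ : ℂ) - z j t))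
    with hv
  have hvc : ContinuousAt v t₀ := huc.add (ContinuousAt.clog
    ((hb.sub hzc).div (hxc.sub hzc) (sub_ne_zero.2 hxne)) (div_mem_slitPlane_of_notMem_segment hseg))
  have hev : ∀ᶠ t in 𝓝 t₀, t ∈ I ∧ 1 < ‖z j t‖ ∧ ‖b t‖ < 1 ∧ b t ∈ singDisc (fun k => z k t) j := by
    have e1 : ∀ᶠ t in 𝓝 t₀, t ∈ I := hw.isOpen_time.mem_nhds ht₀
    filter_upwards [e1, hzc.norm.eventually_const_lt hj, hb.norm.eventually_lt_const hb1,
      hw.eventually_mem_singDisc ht₀ hb hbB] with t h1 h2 h3 h4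
    exact ⟨h1, h2, h3, h4⟩
  have hform : ∀ᶠ t in 𝓝 t₀, Complex.exp (v t) = b t - z j t ∧
      (caratheodory (w t) (b t) - f t (b t)) / w t (b t) = 2 *
        (discCoeff (fun k => z k t) ρ j (w t) (u t) / discCoeff (fun k => z k t) ρ j (w t) (v t)) := by
    filter_upwards [hev, hu] with t ⟨h1, h2, h3, h4⟩ h6
    obtain ⟨-, hs, hc⟩ := (hf t h1).connCoeff_interior (hw.isCutWeight h1) h2 h4 h3 h6
    have hexp : Complex.exp (v t) = b t - z j t := by
      rw [hv]
      simp only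
      rw [Complex.exp_add, Complex.exp_log
        (Complex.slitPlane_ne_zero (div_mem_slitPlane_of_notMem_segment hs)), h6]
      exact mul_div_cancel₀ _ (h6 ▸ Complex.exp_ne_zero _)
    refine ⟨hexp, ?_⟩
    rw [div_eq_connCoeff_div (z := fun k => z k t) (ρ := ρ) (j := j) _ _ hexp, hc, mul_div_assoc]
  have hvb : z j t₀ + Complex.exp (v t₀) = b t₀ := by rw [hform.self_of_nhds.1]; ring
  have hub : z j t₀ + Complex.exp (u t₀) = z j t₀ / (‖z j t₀‖ : ℂ) := by
    rw [hu.self_of_nhds]; ring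
  filter_upwards [hform, hw.discCoeff_div_eventually_eq ht₀ huc (by rwa [hub]) (by rwa [hub]) hvc
    (by rwa [hvb]) (by rwa [hvb])] with t h1 h2
  rw [h1.2, h2, hform.self_of_nhds.2]

/-- Only at `t₀` is `z_j` assumed to lie on the unit circle. At nearby times the circle about `z_j`
through `b` still crosses `𝕋` twice, so one formula for `C` holds while the singularity leaves or
passes through `𝕋`. -/
theorem IsDeformation.coeff_eventually_eq_circle (hw : IsDeformation I D z ρ w) {t₀ : ℝ}
    (ht₀ : t₀ ∈ I) {j : Fin m} {b : ℝ → ℂ} (hb : ContinuousAt b t₀)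
    (hbB : b t₀ ∈ singDisc (fun k => z k t₀) j) (hbD : (t₀, b t₀) ∈ D) {f : ℝ → ℂ → ℂ}
    (hf : ∀ t ∈ I, IsDiscSolution (fun k => z k t) ρ j (w t) (f t))
    (hj : ‖z j t₀‖ = 1) (hb1 : ‖b t₀‖ ≠ 1) :
    ∀ᶠ t in 𝓝 t₀, (caratheodory (w t) (b t) - f t (b t)) / w t (b t)
      = (caratheodory (w t₀) (b t₀) - f t₀ (b t₀)) / w t₀ (b t₀) := by
  have hcw := hw.isCutWeight ht₀
  have hzc := hw.continuousAt_sing ht₀ j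
  have hj0 : z j t₀ ≠ 0 := norm_ne_zero_iff.1 (by rw [hj]; exact one_ne_zero)
  have hbz : b t₀ - z j t₀ ≠ 0 := sub_ne_zero.2 (hcw.ne_sing _ hbD j)
  have hq := one_sub_exp_ne_zero (hcw.exponent_ne j) (hcw.re_pos j hj)
  set q := 1 - Complex.exp (-(2 * Real.pi * Complex.I * ρ j)) with hqdef
  obtain ⟨l, hlc, hl0, hl⟩ := exists_continuousAt_log hzc (Complex.exp_log hj0)
  set δ : ℝ → ℝ := fun t => ‖b t - z j t‖ with hδ
  have hδc : ContinuousAt δ t₀ := (hb.sub hzc).norm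
  have hδ0 : 0 < δ t₀ := norm_pos_iff.2 hbz
  -- The singularity at the origin is at distance `1` from `z_j`. Hence `κ = -δ / 2` lies strictly
  -- between `-1` and `1`.
  have hδ1 : δ t₀ < 1 := by
    obtain ⟨k, hk⟩ := hw.sing_zero
    have hkj : k ≠ j := fun h => hj0 (h ▸ hk t₀ ht₀)
    have := hbB k hkj
    simp only [hk t₀ ht₀, dist_zero_left, hj] at this
    rwa [dist_eq_norm] at this
  set κ : ℝ → ℝ := fun t => (1 - ‖z j t‖ ^ 2 - δ t ^ 2) / (2 * ‖z j t‖ * δ t) with hκ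
  have hκc : ContinuousAt κ t₀ := by
    refine ContinuousAt.div ((continuousAt_const.sub (hzc.norm.pow 2)).sub (hδc.pow 2))
      ((continuousAt_const.mul hzc.norm).mul hδc) ?_
    rw [hj]
    positivity
  have hκ0 : κ t₀ = -(δ t₀ / 2) := by
    rw [hκ]
    simp only [hj]
    field_simp
    ring
  have hκ1 : -1 < κ t₀ := by rw [hκ0]; linarith
  have hκ2 : κ t₀ < 1 := by rw [hκ0]; linarith
  set A : ℝ → ℝ := fun t => Real.arccos (κ t) with hA
  have hAc : ContinuousAt A t₀ := Real.continuous_arccos.continuousAt.comp hκc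
  set α : ℝ → ℝ := fun t => (l t).im with hα
  have hαc : ContinuousAt α t₀ := Complex.continuous_im.continuousAt.comp hlc
  have hpol : ∀ t, Complex.exp (l t) = z j t → z j t = ‖z j t‖ * Complex.exp (α t * Complex.I) := by
    intro t ht
    rw [← ht, Complex.norm_exp, Complex.ofReal_exp, ← Complex.exp_add, hα, Complex.re_add_im]
  set u : ℝ → ℝ → ℂ := fun t θ => (Real.log (δ t) : ℂ) + (α t + θ) * Complex.I with hu
  have hucomp : ∀ {θ : ℝ → ℝ}, ContinuousAt θ t₀ → ContinuousAt (fun t => u t (θ t)) t₀ := by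
    intro θ hθ
    have h1 : ContinuousAt (fun t => Real.log (δ t)) t₀ := hδc.log hδ0.ne'
    have h2 : ∀ {g : ℝ → ℝ}, ContinuousAt g t₀ → ContinuousAt (fun t => (g t : ℂ)) t₀ :=
      fun hg => Complex.continuous_ofReal.continuousAt.comp hg
    exact (h2 h1).add (((h2 hαc).add (h2 hθ)).mul continuousAt_const)
  have hnorm : ∀ θ : ℝ, ‖Complex.exp (u t₀ θ)‖ = δ t₀ := fun θ => by
    rw [Complex.norm_exp, hu]
    simp [Real.exp_log hδ0]
  have huB : ∀ θ : ℝ, z j t₀ + Complex.exp (u t₀ θ) ∈ singDisc (fun k => z k t₀) j := by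
    intro θ k hk
    refine lt_of_eq_of_lt ?_ (hbB k hk)
    simp only [dist_eq_norm, add_sub_cancel_left, hnorm]
    rfl
  have hsq := fun θ : ℝ => norm_circle_sq (θ := θ) hδ0 (hpol t₀ hl.self_of_nhds)
  have huD : ∀ θ : ℝ, Real.cos θ = κ t₀ → (t₀, z j t₀ + Complex.exp (u t₀ θ)) ∈ D := by
    intro θ hθ
    refine hcw.circle_subset _ ?_ fun k => ?_
    · refine (pow_eq_one_iff_of_nonneg (norm_nonneg _) two_ne_zero).1 ?_
      rw [hu]
      simp only
      rw [hsq, hθ, hκ0, hj]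
      ring
    · rcases eq_or_ne k j with rfl | hk
      · simp [Complex.exp_ne_zero]
      · exact ne_sing_of_mem_singDisc (huB θ) hk
  have hcosA : Real.cos (A t₀) = κ t₀ := Real.cos_arccos hκ1.le hκ2.le
  -- it suffices to give the base point a suitable angle
  have hmain : ∀ v₀ : ℂ, Complex.exp v₀ = b t₀ - z j t₀ →
      (v₀.im - α t₀ ∈ Ioo (-A t₀) (A t₀) ∨ v₀.im - α t₀ ∈ Ioo (A t₀) (2 * Real.pi - A t₀)) →
      ∀ᶠ t in 𝓝 t₀, (caratheodory (w t) (b t) - f t (b t)) / w t (b t)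
        = (caratheodory (w t₀) (b t₀) - f t₀ (b t₀)) / w t₀ (b t₀) := by
    intro v₀ hv₀ hθ₀
    obtain ⟨v, hvc, hv0, hv⟩ := exists_continuousAt_log (hb.sub hzc) hv₀
    set θ : ℝ → ℝ := fun t => (v t).im - α t with hθ
    have hθc : ContinuousAt θ t₀ := (Complex.continuous_im.continuousAt.comp hvc).sub hαc
    have huv : ∀ t, Complex.exp (v t) = b t - z j t → u t (θ t) = v t := by
      intro t ht
      have : δ t = Real.exp (v t).re := by rw [hδ]; simp only; rw [← ht, Complex.norm_exp]
      rw [hu]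
      simp only
      rw [this, Real.log_exp, hθ]
      push_cast
      rw [add_sub_cancel, Complex.re_add_im]
    have hvb : z j t₀ + Complex.exp (v t₀) = b t₀ := by
      have := hv.self_of_nhds
      simp only [Pi.sub_apply] at this
      rw [this]; ring
    have r1 := hw.discCoeff_div_eventually_eq ht₀ (hucomp hAc) (huB _) (huD _ hcosA) hvc
      (by rwa [hvb]) (by rwa [hvb])
    have r2 := hw.discCoeff_div_eventually_eq ht₀ (hucomp (θ := fun t => 2 * Real.pi - A t)
      (continuousAt_const.sub hAc)) (huB _) (huD _ (by rw [Real.cos_two_pi_sub, hcosA])) hvc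
      (by rwa [hvb]) (by rwa [hvb])
    have hev : ∀ᶠ t in 𝓝 t₀, t ∈ I ∧ z j t ≠ 0 ∧ 0 < δ t ∧ -1 < κ t ∧ κ t < 1 ∧
        b t ∈ singDisc (fun k => z k t) j ∧ Complex.exp (l t) = z j t ∧
        Complex.exp (v t) = b t - z j t := by
      have e1 : ∀ᶠ t in 𝓝 t₀, t ∈ I := hw.isOpen_time.mem_nhds ht₀
      filter_upwards [e1, hzc.eventually_ne hj0, hδc.eventually_const_lt hδ0,
        hκc.eventually_const_lt hκ1, hκc.eventually_lt_const hκ2,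
        hw.eventually_mem_singDisc ht₀ hb hbB, hl, hv] with t h1 h2 h3 h4 h5 h6 h7 h8
      exact ⟨h1, h2, h3, h4, h5, h6, h7, h8⟩
    have hcirc : ∀ᶠ t in 𝓝 t₀, t ∈ I ∧ Complex.exp (v t) = b t - z j t ∧ u t (θ t) = v t ∧
        (∀ s ∈ Ioo (-A t) (A t), connCoeff (fun k => z k t) ρ j (w t) (f t) (u t s) * q
          = 2 * (discCoeff (fun k => z k t) ρ j (w t) (u t (2 * Real.pi - A t))
            - discCoeff (fun k => z k t) ρ j (w t) (u t (A t)))) ∧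
        (∀ s ∈ Ioo (A t) (2 * Real.pi - A t), (connCoeff (fun k => z k t) ρ j (w t) (f t) (u t s)
            - 2 * discCoeff (fun k => z k t) ρ j (w t) (u t (A t))) * q
          = 2 * (discCoeff (fun k => z k t) ρ j (w t) (u t (2 * Real.pi - A t))
            - discCoeff (fun k => z k t) ρ j (w t) (u t (A t)))) := by
      filter_upwards [hev] with t ⟨h1, h2, h3, h4, h5, h6, h7, h8⟩
      refine ⟨h1, h8, huv t h8, ?_⟩
      exact (hf t h1).connCoeff_of_circle (hw.isCutWeight h1) h3 h2 (hpol t h7)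
        (fun x hx k hk => by
          refine lt_of_eq_of_lt ?_ (h6 k hk)
          simp only [hx, hδ, dist_eq_norm]) rfl h4 h5 (u := u t) rfl rfl rfl
    have hane : ∀ᶠ t in 𝓝 t₀, discCoeff (fun k => z k t) ρ j (w t) (v t) ≠ 0 := by
      obtain ⟨N, hN, h⟩ := hw.discCoeff_eventually_eq ht₀ j
      filter_upwards [h v hvc (by rwa [hvb]) (by rwa [hvb])] with t ht
      rw [ht]
      refine mul_ne_zero (hN t) (div_ne_zero ?_ (discBranch_ne_zero _ _ _ _))
      simp only [hvb]
      exact hcw.ne_zero _ hbD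
    rcases hθ₀ with hθ₀ | hθ₀
    · have hform : ∀ᶠ t in 𝓝 t₀, (caratheodory (w t) (b t) - f t (b t)) / w t (b t)
          = 2 * (discCoeff (fun k => z k t) ρ j (w t) (u t (2 * Real.pi - A t))
              / discCoeff (fun k => z k t) ρ j (w t) (v t)
            - discCoeff (fun k => z k t) ρ j (w t) (u t (A t))
              / discCoeff (fun k => z k t) ρ j (w t) (v t)) / q := by
        rw [← hv0] at hθ₀
        filter_upwards [hcirc, hane, hAc.neg.eventually_lt hθc hθ₀.1, hθc.eventually_lt hAc hθ₀.2]
          with t ⟨_, h2, h3, h4, _⟩ h5 h6 h7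
        have h8 := h4 (θ t) ⟨h6, h7⟩
        rw [h3] at h8
        rw [div_eq_connCoeff_div (z := fun k => z k t) (ρ := ρ) (j := j) _ _ h2, ← sub_div,
          ← mul_div_assoc, ← h8]
        field_simp
      filter_upwards [hform, r1, r2] with t h1 h2 h3
      rw [h1, h2, h3, hform.self_of_nhds]
    · have hform : ∀ᶠ t in 𝓝 t₀, (caratheodory (w t) (b t) - f t (b t)) / w t (b t)
          = 2 * (discCoeff (fun k => z k t) ρ j (w t) (u t (2 * Real.pi - A t))
              / discCoeff (fun k => z k t) ρ j (w t) (v t)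
            - discCoeff (fun k => z k t) ρ j (w t) (u t (A t))
              / discCoeff (fun k => z k t) ρ j (w t) (v t)) / q
            + 2 * (discCoeff (fun k => z k t) ρ j (w t) (u t (A t))
              / discCoeff (fun k => z k t) ρ j (w t) (v t)) := by
        rw [← hv0] at hθ₀
        filter_upwards [hcirc, hane, hAc.eventually_lt hθc hθ₀.1,
          hθc.eventually_lt (continuousAt_const.sub hAc) hθ₀.2]
          with t ⟨_, h2, h3, _, h4⟩ h5 h6 h7
        have h8 := h4 (θ t) ⟨h6, h7⟩
        rw [h3] at h8
        rw [div_eq_connCoeff_div (z := fun k => z k t) (ρ := ρ) (j := j) _ _ h2, ← sub_div,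
          ← mul_div_assoc, ← h8]
        field_simp
        ring
      filter_upwards [hform, r1, r2] with t h1 h2 h3
      rw [h1, h2, h3, hform.self_of_nhds]
  have hα0 : α t₀ = (Complex.log (z j t₀)).im := by rw [hα]; simp only [hl0]
  have hbsq : ∀ θ : ℝ, z j t₀ + Complex.exp (u t₀ θ) = b t₀ →
      ‖b t₀‖ ^ 2 - 1 = 2 * δ t₀ * (Real.cos θ - κ t₀) := by
    intro θ hθ
    rw [← hθ, hu]
    simp only
    rw [hsq, hj, hκ0]
    ring
  have hangle : ∀ v₀ : ℂ, Complex.exp v₀ = b t₀ - z j t₀ →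
      z j t₀ + Complex.exp (u t₀ (v₀.im - α t₀)) = b t₀ := by
    intro v₀ hv₀
    have : δ t₀ = Real.exp v₀.re := by rw [hδ]; simp only; rw [← hv₀, Complex.norm_exp]
    rw [hu]
    simp only
    rw [this, Real.log_exp]
    push_cast
    rw [add_sub_cancel, Complex.re_add_im, hv₀]
    ring
  -- The angle is measured from the outward direction. For `b` inside, the principal argument of the
  -- negated quotient plus `π` falls in the inner arc; for `b` outside, the principal argument
  -- itself falls in the outer arc.
  rcases lt_or_gt_of_ne hb1 with hlt | hgt
  · set y := -((b t₀ - z j t₀) / z j t₀) with hy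
    have hy0 : y ≠ 0 := neg_ne_zero.2 (div_ne_zero hbz hj0)
    have hexp : Complex.exp (Complex.log (z j t₀) + (Complex.log y + Real.pi * Complex.I))
        = b t₀ - z j t₀ := by
      rw [Complex.exp_add, Complex.exp_add, Complex.exp_log hj0, Complex.exp_log hy0,
        Complex.exp_pi_mul_I, hy]
      field_simp
    refine hmain _ hexp (Or.inr ?_)
    have h1 := hbsq _ (hangle _ hexp)
    have him : (Complex.log (z j t₀) + (Complex.log y + Real.pi * Complex.I)).im - α t₀
        = y.arg + Real.pi := by
      rw [hα0]; simp [Complex.log_im]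
    rw [him, Real.cos_add_pi] at h1
    rw [him]
    have h2 : -κ t₀ < Real.cos |y.arg| := by
      rw [Real.cos_abs]
      by_contra! h3
      have : 1 ≤ ‖b t₀‖ ^ 2 := by nlinarith
      nlinarith [norm_nonneg (b t₀)]
    have h3 : |y.arg| < Real.pi - A t₀ := by
      by_contra! h4
      have := Real.cos_le_cos_of_nonneg_of_le_pi
        (by rw [sub_nonneg]; exact Real.arccos_le_pi _) (Complex.abs_arg_le_pi y) h4
      rw [Real.cos_pi_sub, hcosA] at this
      linarith
    rw [abs_lt] at h3
    exact ⟨by linarith [h3.1], by linarith [h3.2]⟩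
  · set y := (b t₀ - z j t₀) / z j t₀ with hy
    have hy0 : y ≠ 0 := div_ne_zero hbz hj0
    have hexp : Complex.exp (Complex.log (z j t₀) + Complex.log y) = b t₀ - z j t₀ := by
      rw [Complex.exp_add, Complex.exp_log hj0, Complex.exp_log hy0, hy]
      field_simp
    refine hmain _ hexp (Or.inl ?_)
    have h1 := hbsq _ (hangle _ hexp)
    have him : (Complex.log (z j t₀) + Complex.log y).im - α t₀ = y.arg := by
      rw [hα0]; simp [Complex.log_im]
    rw [him] at h1
    rw [him]
    have h2 : κ t₀ < Real.cos |y.arg| := by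
      rw [Real.cos_abs]
      by_contra! h3
      have : ‖b t₀‖ ^ 2 ≤ 1 := by nlinarith
      nlinarith [norm_nonneg (b t₀)]
    have h3 : |y.arg| < A t₀ := by
      by_contra! h4
      have := Real.cos_le_cos_of_nonneg_of_le_pi (Real.arccos_nonneg _)
        (Complex.abs_arg_le_pi y) h4
      rw [hcosA] at this
      linarith
    exact abs_lt.1 h3

/-- Near a finite singularity the coefficient of the weight in the Carathéodory function is
constant in time. -/
theorem IsDeformation.exists_connection_coeff (hw : IsDeformation I D z ρ w) (j : Fin m)
    {b : ℝ → ℂ} (hb : ContinuousOn b I)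
    (hb' : ∀ t ∈ I, (t, b t) ∈ D ∧ ‖b t‖ ≠ 1 ∧ b t ∈ singDisc (fun k => z k t) j) :
    ∃ C : ℂ, ∀ t ∈ I, ∃ f : ℂ → ℂ, DifferentiableOn ℂ f (singDisc (fun k => z k t) j) ∧
      ∀ᶠ x in 𝓝 (b t), caratheodory (w t) x = f x + C * w t x := by
  rcases I.eq_empty_or_nonempty with rfl | ⟨t₁, ht₁⟩
  · exact ⟨0, fun t ht => absurd ht (notMem_empty t)⟩
  -- The solutions are chosen independently for each `t`; no regularity in `t` is needed, since only
  -- their defining properties enter the formulas for `C`.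
  have hex : ∀ t, ∃ f, t ∈ I → IsDiscSolution (fun k => z k t) ρ j (w t) f := by
    intro t
    by_cases ht : t ∈ I
    · obtain ⟨k, hk⟩ := hw.sing_zero
      obtain ⟨f, hf⟩ := (hw.isCutWeight ht).exists_isDiscSolution (hw.exists_ne ht j) ⟨k, hk t ht⟩
      exact ⟨f, fun _ => hf⟩
    · exact ⟨0, fun h => absurd h ht⟩
  choose f hf using hex
  have hloc : ∀ t₀ ∈ I, ∀ᶠ t in 𝓝 t₀, (caratheodory (w t) (b t) - f t (b t)) / w t (b t)
      = (caratheodory (w t₀) (b t₀) - f t₀ (b t₀)) / w t₀ (b t₀) := by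
    intro t₀ ht₀
    obtain ⟨hbD, hb1, hbB⟩ := hb' t₀ ht₀
    have hbc := hb.continuousAt (hw.isOpen_time.mem_nhds ht₀)
    have hzc := hw.continuousAt_sing ht₀ j
    have hI : ∀ᶠ t in 𝓝 t₀, t ∈ I := hw.isOpen_time.mem_nhds ht₀
    have hzero : (∀ᶠ t in 𝓝 t₀, caratheodory (w t) (b t) = f t (b t)) →
        ∀ᶠ t in 𝓝 t₀, (caratheodory (w t) (b t) - f t (b t)) / w t (b t)
          = (caratheodory (w t₀) (b t₀) - f t₀ (b t₀)) / w t₀ (b t₀) := by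
      intro h
      filter_upwards [h] with t ht
      rw [ht, h.self_of_nhds, sub_self, sub_self, zero_div, zero_div]
    rcases lt_trichotomy ‖z j t₀‖ 1 with hj | hj | hj
    · rcases lt_or_gt_of_ne hb1 with h1 | h1
      · refine hzero ?_
        filter_upwards [hI, hzc.norm.eventually_lt_const hj, hbc.norm.eventually_lt_const h1]
          with t e1 e2 e3
        exact (hf t e1).eq_interior e2 _ (hb' t e1).2.2 e3
      · exact hw.coeff_eventually_eq_exterior ht₀ hbc hbB hbD hf hj h1
    · exact hw.coeff_eventually_eq_circle ht₀ hbc hbB hbD hf hj hb1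
    · rcases lt_or_gt_of_ne hb1 with h1 | h1
      · exact hw.coeff_eventually_eq_interior ht₀ hbc hbB hbD hf hj h1
      · refine hzero ?_
        filter_upwards [hI, hzc.norm.eventually_const_lt hj, hbc.norm.eventually_const_lt h1]
          with t e1 e2 e3
        exact (hf t e1).eq_exterior e2 _ (hb' t e1).2.2 e3
  refine ⟨(caratheodory (w t₁) (b t₁) - f t₁ (b t₁)) / w t₁ (b t₁), fun t ht =>
    ⟨f t, (hf t ht).differentiableOn, ?_⟩⟩
  rw [eq_of_eventually_eq_of_isPreconnected hw.isPreconnected_time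
    (f := fun t => (caratheodory (w t) (b t) - f t (b t)) / w t (b t))
    (fun s hs => eventually_nhdsWithin_of_eventually_nhds (hloc s hs)) ht₁ ht]
  exact (hf t ht).eventually_eq_add (hw.isCutWeight ht) (hb' t ht).2.2 (hb' t ht).1 (hb' t ht).2.1

end

section
variable {m : ℕ} {z ρ : Fin m → ℂ} {D : Set ℂ} {w : ℂ → ℂ} {φ φb : ℕ → ℂ[X]}

/-! ### The associated functions -/

/-- The difference quotient of `φ n` cancels the kernel, so off the circle `ψ_n` agrees with a
single entire function. Continuation of `Y_n` therefore only concerns `F` and `w`. -/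
theorem exists_differentiable_psi (hw : CircleIntegrable w 0 1) (φ : ℕ → ℂ[X]) (n : ℕ) :
    ∃ Ψ : ℂ → ℂ, Differentiable ℂ Ψ ∧ ∀ x, ‖x‖ ≠ 1 → psi w φ n x = Ψ x := by
  rcases eq_or_ne n 0 with rfl | hn
  · exact ⟨fun _ => ((φ 0).leadingCoeff)⁻¹, differentiable_const _, fun x _ => by rw [psi, if_pos rfl]⟩
  obtain ⟨S, hS⟩ := exists_evalEval_eq (φ n)
  refine ⟨_, differentiable_circleAverage_evalEval hw ((C X + X) * S), fun x hx => ?_⟩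
  rw [psi, if_neg hn, circleMean_eq_circleAverage]
  refine Real.circleAverage_congr_sphere fun ζ hζ => ?_
  have h0 : ζ - x ≠ 0 := fun h0 => by
    rw [sub_eq_zero.1 h0] at hζ
    simp at hζ
    exact hx hζ
  simp only [evalEval_mul, evalEval_add, evalEval_C, evalEval_X, eval_X]
  rw [hS ζ x]
  field_simp
  ring

theorem eval_recip {n : ℕ} (hn : (φb n).natDegree = n) {ζ : ℂ} (hζ : ‖ζ‖ = 1) :
    (recip φb n).eval ζ = ζ ^ n * (φb n).eval (starRingEnd ℂ ζ) := by
  have h1 : ζ * starRingEnd ℂ ζ = 1 := by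
    rw [Complex.mul_conj, Complex.normSq_eq_norm_sq, hζ]; simp
  let _ : Invertible (starRingEnd ℂ ζ) := ⟨ζ, h1, by rw [mul_comm, h1]⟩
  have h2 : (recip φb n).eval ζ * (starRingEnd ℂ ζ) ^ n = (φb n).eval (starRingEnd ℂ ζ) :=
    eval₂_reflect_mul_pow (RingHom.id ℂ) (starRingEnd ℂ ζ) n (φb n) hn.le
  rw [← h2, mul_left_comm, ← mul_pow, h1, one_pow, mul_one]

theorem exists_differentiable_psiStar (hw : CircleIntegrable w 0 1) (hφb : ∀ n, (φb n).natDegree = n)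
    (n : ℕ) : ∃ Ψ : ℂ → ℂ, Differentiable ℂ Ψ ∧ ∀ x, ‖x‖ ≠ 1 → psiStar w φb n x = Ψ x := by
  rcases eq_or_ne n 0 with rfl | hn
  · exact ⟨fun _ => ((φb 0).leadingCoeff)⁻¹, differentiable_const _,
      fun x _ => by rw [psiStar, if_pos rfl]⟩
  obtain ⟨S, hS⟩ := exists_evalEval_eq (recip φb n)
  obtain ⟨P, hP⟩ := exists_evalEval_eq (X ^ n : ℂ[X])
  -- On the circle `x^n φ̄_n(ζ̄) - φ*_n(x) = ζ̄^n (x^n φ*_n(ζ) - ζ^n φ*_n(x))`. The bracket is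
  -- divisible by `ζ - x`, while `ζ̄^n` joins the weight.
  have hg : CircleIntegrable (fun ζ => (starRingEnd ℂ ζ) ^ n * w ζ) 0 1 :=
    hw.continuousOn_mul (by fun_prop)
  refine ⟨_, (differentiable_circleAverage_evalEval hg ((C X + X) * (X.map C ^ n * S
    - P * (recip φb n).map C))).neg, fun x hx => ?_⟩
  rw [psiStar, if_neg hn, circleMean_eq_circleAverage, Pi.neg_apply, neg_inj]
  refine Real.circleAverage_congr_sphere fun ζ hζ => ?_
  have h0 : ζ - x ≠ 0 := fun h0 => by
    rw [sub_eq_zero.1 h0] at hζ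
    simp at hζ
    exact hx hζ
  have hζ1 : ‖ζ‖ = 1 := by simpa using hζ
  have h2 : ζ ^ n * (starRingEnd ℂ ζ) ^ n = 1 := by
    rw [← mul_pow, Complex.mul_conj, Complex.normSq_eq_norm_sq, hζ1]; simp
  have h3 := eval_recip (hφb n) hζ1
  have h4 := hS ζ x
  have h5 := hP ζ x
  simp only [eval_pow, eval_X] at h5
  simp only [evalEval_mul, evalEval_add, evalEval_sub, evalEval_C, evalEval_pow, evalEval_X, eval_X,
    evalEval_map_C]
  rw [div_mul_eq_mul_div, div_mul_eq_mul_div, div_eq_iff h0]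
  linear_combination (-(ζ + x) * w ζ * x ^ n * (φb n).eval (starRingEnd ℂ ζ)
      + (ζ + x) * w ζ * (recip φb n).eval x) * h2
    - (ζ + x) * w ζ * x ^ n * (starRingEnd ℂ ζ) ^ n * h3
    + (ζ + x) * w ζ * x ^ n * (starRingEnd ℂ ζ) ^ n * h4
    - (ζ + x) * w ζ * (starRingEnd ℂ ζ) ^ n * (recip φb n).eval x * h5

/-! ### The determinant of the fundamental matrix -/

theorem IsBiorthonormal.leadingCoeff_ne_zero (h : IsBiorthonormal w φ φb) (n : ℕ) :
    (φb n).leadingCoeff ≠ 0 := by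
  intro h0
  have := h.orthonormal n n
  rw [leadingCoeff_eq_zero.1 h0] at this
  simp [circleMean, circleIntegral] at this

theorem circleMean_mul_eval_conj (hw : CircleIntegrable w 0 1) (p q : ℂ[X]) :
    circleMean (fun ζ => w ζ * p.eval ζ * q.eval (starRingEnd ℂ ζ))
      = ∑ i ∈ Finset.range (q.natDegree + 1), q.coeff i *
        Real.circleAverage (fun ζ => w ζ * p.eval ζ * (starRingEnd ℂ ζ) ^ i) 0 1 := by
  rw [circleMean_eq_circleAverage]
  have h1 : (fun ζ => w ζ * p.eval ζ * q.eval (starRingEnd ℂ ζ)) = fun ζ =>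
      ∑ i ∈ Finset.range (q.natDegree + 1),
        q.coeff i • (w ζ * p.eval ζ * (starRingEnd ℂ ζ) ^ i) := by
    ext ζ
    rw [eval_eq_sum_range (p := q), Finset.mul_sum]
    refine Finset.sum_congr rfl fun i _ => ?_
    simp only [smul_eq_mul]
    ring
  rw [h1, Real.circleAverage_fun_sum]
  · simp only [Real.circleAverage_fun_smul]
    simp only [smul_eq_mul]
  · intro i _
    refine CircleIntegrable.fun_const_smul ?_ _
    have h2 : (fun ζ => w ζ * p.eval ζ * (starRingEnd ℂ ζ) ^ i)
        = fun ζ => (p.eval ζ * (starRingEnd ℂ ζ) ^ i) * w ζ := by ext ζ; ring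
    rw [h2]
    exact hw.continuousOn_mul (by fun_prop)

/-- Orthogonality to `φ̄_k(ζ̄)` for `k < n` is triangular in the powers of `ζ̄`, with nonzero
leading coefficients. -/
theorem IsBiorthonormal.moment_eq_zero (h : IsBiorthonormal w φ φb) (hw : CircleIntegrable w 0 1)
    {n k : ℕ} (hk : k < n) :
    Real.circleAverage (fun ζ => w ζ * (φ n).eval ζ * (starRingEnd ℂ ζ) ^ k) 0 1 = 0 := by
  induction k using Nat.strong_induction_on with
  | _ k ih =>
    have h1 := h.orthonormal n k
    rw [circleMean_mul_eval_conj hw, if_neg hk.ne', h.natDegree_right, Finset.sum_range_succ,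
      Finset.sum_eq_zero fun i hi => by
        rw [ih i (Finset.mem_range.1 hi) ((Finset.mem_range.1 hi).trans hk), mul_zero],
      zero_add] at h1
    refine (mul_eq_zero.1 h1).resolve_left ?_
    have := h.leadingCoeff_ne_zero k
    rwa [leadingCoeff, h.natDegree_right] at this

theorem IsBiorthonormal.moment_ne_zero (h : IsBiorthonormal w φ φb) (hw : CircleIntegrable w 0 1)
    (n : ℕ) : Real.circleAverage (fun ζ => w ζ * (φ n).eval ζ * (starRingEnd ℂ ζ) ^ n) 0 1 ≠ 0 := by
  intro h0
  have h1 := h.orthonormal n n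
  rw [circleMean_mul_eval_conj hw, if_pos rfl, h.natDegree_right, Finset.sum_range_succ, h0,
    mul_zero, add_zero, Finset.sum_eq_zero fun i hi => by
      rw [h.moment_eq_zero hw (Finset.mem_range.1 hi), mul_zero]] at h1
  exact zero_ne_one h1

/-- On the circle the kernel `K` satisfies `K = 1 + x ζ̄ (K + 1)`. Each application extracts one
factor `x` at the cost of one moment. -/
theorem circleAverage_kernel_eq {g : ℂ → ℂ} (hg : CircleIntegrable g 0 1) {x : ℂ} (hx : ‖x‖ ≠ 1) :
    Real.circleAverage (fun ζ => (ζ + x) / (ζ - x) * g ζ) 0 1 = Real.circleAverage g 0 1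
      + x * (Real.circleAverage (fun ζ => (ζ + x) / (ζ - x) * (g ζ * starRingEnd ℂ ζ)) 0 1
        + Real.circleAverage (fun ζ => g ζ * starRingEnd ℂ ζ) 0 1) := by
  have hg' : CircleIntegrable (fun ζ => g ζ * starRingEnd ℂ ζ) 0 1 :=
    hg.mul_continuousOn (by fun_prop)
  have i1 : CircleIntegrable (fun ζ => (ζ + x) / (ζ - x) * (g ζ * starRingEnd ℂ ζ)) 0 1 :=
    hg'.continuousOn_mul (continuousOn_kernel zero_le_one hx)
  have i2 : CircleIntegrable (fun ζ => x • ((ζ + x) / (ζ - x) * (g ζ * starRingEnd ℂ ζ)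
      + g ζ * starRingEnd ℂ ζ)) 0 1 := (i1.add hg').fun_const_smul x
  rw [← Real.circleAverage_fun_add i1 hg', ← smul_eq_mul x, ← Real.circleAverage_fun_smul,
    ← Real.circleAverage_fun_add hg i2]
  refine Real.circleAverage_congr_sphere fun ζ hζ => ?_
  have h0 : ζ - x ≠ 0 := fun h0 => by
    rw [sub_eq_zero.1 h0] at hζ
    simp at hζ
    exact hx hζ
  have hζ1 : ‖ζ‖ = 1 := by simpa using hζ
  have h2 : ζ * starRingEnd ℂ ζ = 1 := by
    rw [Complex.mul_conj, Complex.normSq_eq_norm_sq, hζ1]; simp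
  simp only [smul_eq_mul]
  field_simp
  linear_combination -2 * x * g ζ * h2

theorem eps_eq (hw : CircleIntegrable w 0 1) {n : ℕ} (hn : n ≠ 0) {x : ℂ} (hx : ‖x‖ ≠ 1) :
    eps w φ n x = Real.circleAverage (fun ζ => (ζ + x) / (ζ - x) * (w ζ * (φ n).eval ζ)) 0 1 := by
  have hK := continuousOn_kernel zero_le_one hx
  have i1 : CircleIntegrable (fun ζ => (ζ + x) / (ζ - x) * (w ζ * (φ n).eval ζ)) 0 1 :=
    (hw.mul_continuousOn (φ n).continuous.continuousOn).continuousOn_mul hK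
  have i2 : CircleIntegrable (fun ζ => (ζ + x) / (ζ - x) * w ζ) 0 1 := hw.continuousOn_mul hK
  have h1 : Real.circleAverage (fun ζ => (ζ + x) / (ζ - x) * w ζ * ((φ n).eval ζ - (φ n).eval x)) 0 1
      = Real.circleAverage (fun ζ => (ζ + x) / (ζ - x) * (w ζ * (φ n).eval ζ)
        - (φ n).eval x • ((ζ + x) / (ζ - x) * w ζ)) 0 1 := by
    congr 1
    ext ζ
    simp only [smul_eq_mul]
    ring
  rw [eps, psi, if_neg hn, caratheodory, circleMean_eq_circleAverage, circleMean_eq_circleAverage,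
    h1, Real.circleAverage_fun_sub i1 (i2.fun_const_smul _), Real.circleAverage_fun_smul,
    smul_eq_mul]
  ring

theorem epsStar_eq (hw : CircleIntegrable w 0 1) {n : ℕ} (hn : n ≠ 0) {x : ℂ} (hx : ‖x‖ ≠ 1) :
    epsStar w φb n x = -(x ^ n * Real.circleAverage (fun ζ => (ζ + x) / (ζ - x) *
      (w ζ * (φb n).eval (starRingEnd ℂ ζ))) 0 1) := by
  have hK := continuousOn_kernel zero_le_one hx
  have i1 : CircleIntegrable (fun ζ => (ζ + x) / (ζ - x) * (w ζ * (φb n).eval (starRingEnd ℂ ζ))) 0 1 :=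
    (hw.mul_continuousOn ((φb n).continuous.comp Complex.continuous_conj).continuousOn).continuousOn_mul
      hK
  have i2 : CircleIntegrable (fun ζ => (ζ + x) / (ζ - x) * w ζ) 0 1 := hw.continuousOn_mul hK
  have h1 : Real.circleAverage (fun ζ => (ζ + x) / (ζ - x) * w ζ *
        (x ^ n * (φb n).eval (starRingEnd ℂ ζ) - (recip φb n).eval x)) 0 1
      = Real.circleAverage (fun ζ => x ^ n • ((ζ + x) / (ζ - x) *
          (w ζ * (φb n).eval (starRingEnd ℂ ζ)))
        - (recip φb n).eval x • ((ζ + x) / (ζ - x) * w ζ)) 0 1 := by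
    congr 1
    ext ζ
    simp only [smul_eq_mul]
    ring
  rw [epsStar, psiStar, if_neg hn, caratheodory, circleMean_eq_circleAverage,
    circleMean_eq_circleAverage, h1, Real.circleAverage_fun_sub (i1.fun_const_smul _)
      (i2.fun_const_smul _), Real.circleAverage_fun_smul, Real.circleAverage_fun_smul,
    smul_eq_mul, smul_eq_mul]
  ring

/-- The recursion can be iterated up to `k = n` because the moments of order below `n` vanish. This
exhibits the factor `x^n` of `ε_n`. -/
theorem IsBiorthonormal.kernel_eq_pow_mul (h : IsBiorthonormal w φ φb)
    (hw : CircleIntegrable w 0 1) {n : ℕ} (hn : n ≠ 0) {x : ℂ} (hx : ‖x‖ ≠ 1) {k : ℕ} (hk : k ≤ n) :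
    Real.circleAverage (fun ζ => (ζ + x) / (ζ - x) * (w ζ * (φ n).eval ζ)) 0 1 = x ^ k *
      (Real.circleAverage (fun ζ => (ζ + x) / (ζ - x) *
          (w ζ * (φ n).eval ζ * (starRingEnd ℂ ζ) ^ k)) 0 1
        + Real.circleAverage (fun ζ => w ζ * (φ n).eval ζ * (starRingEnd ℂ ζ) ^ k) 0 1) := by
  induction k with
  | zero =>
    have := h.moment_eq_zero hw (Nat.pos_of_ne_zero hn)
    rw [this]
    simp
  | succ k ih =>
    have hg : CircleIntegrable (fun ζ => w ζ * (φ n).eval ζ * (starRingEnd ℂ ζ) ^ k) 0 1 :=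
      (hw.mul_continuousOn (φ n).continuous.continuousOn).mul_continuousOn (by fun_prop)
    rw [ih (Nat.le_of_succ_le hk), circleAverage_kernel_eq hg hx, h.moment_eq_zero hw hk]
    simp only [mul_assoc, ← pow_succ]
    ring

theorem circleAverage_kernel_zero (g : ℂ → ℂ) :
    Real.circleAverage (fun ζ => (ζ + 0) / (ζ - 0) * g ζ) 0 1 = Real.circleAverage g 0 1 := by
  refine Real.circleAverage_congr_sphere fun ζ hζ => ?_
  have hζ0 : ζ ≠ 0 := fun h => by simp [h] at hζ
  simp [div_self hζ0]

/-- The determinant of the fundamental matrix does not vanish identically. -/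
theorem IsBiorthonormal.exists_det_ne_zero (h : IsBiorthonormal w φ φb)
    (hw : CircleIntegrable w 0 1) (n : ℕ) : ∃ x : ℂ, ‖x‖ ≠ 1 ∧
      (φ n).eval x * epsStar w φb n x + (recip φb n).eval x * eps w φ n x ≠ 0 := by
  have hκ := h.leadingCoeff_ne_zero n
  have h0 : (0 : ℂ) ∈ {x : ℂ | ‖x‖ ≠ 1} := by simp
  rcases eq_or_ne n 0 with rfl | hn
  · refine ⟨0, h0, ?_⟩
    have hφ : φ 0 = C ((φb 0).leadingCoeff) := by
      have := eq_C_of_natDegree_eq_zero (h.natDegree_left 0)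
      rw [← h.leadingCoeff_eq 0, this]
      simp
    have hφb : recip φb 0 = C ((φb 0).leadingCoeff) := by
      have := eq_C_of_natDegree_eq_zero (h.natDegree_right 0)
      rw [recip, this]
      simp
    rw [eps, epsStar, psi, psiStar, if_pos rfl, if_pos rfl, hφb, h.leadingCoeff_eq 0, hφ]
    simp only [eval_C]
    have : (φb 0).leadingCoeff * ((φb 0).leadingCoeff⁻¹
        - caratheodory w 0 * (φb 0).leadingCoeff) + (φb 0).leadingCoeff * ((φb 0).leadingCoeff⁻¹
        + caratheodory w 0 * (φb 0).leadingCoeff) = 2 := by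
      field_simp
      ring
    rw [this]
    exact two_ne_zero
  · set μ := Real.circleAverage (fun ζ => w ζ * (φ n).eval ζ * (starRingEnd ℂ ζ) ^ n) 0 1 with hμ
    -- Off the circle, both `ε_n` and `ε*_n` carry the factor `x^n`, and `B` is what remains of the
    -- determinant expression. At `0` the second term vanishes by orthogonality to `φ_0`, leaving `2
    -- κ_n μ ≠ 0`.
    set B : ℂ → ℂ := fun x => (recip φb n).eval x * (Real.circleAverage (fun ζ => (ζ + x) / (ζ - x) *
          (w ζ * (φ n).eval ζ * (starRingEnd ℂ ζ) ^ n)) 0 1 + μ)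
        - (φ n).eval x * Real.circleAverage (fun ζ => (ζ + x) / (ζ - x) *
          (w ζ * (φb n).eval (starRingEnd ℂ ζ))) 0 1 with hB
    have hg1 : CircleIntegrable (fun ζ => w ζ * (φ n).eval ζ * (starRingEnd ℂ ζ) ^ n) 0 1 :=
      (hw.mul_continuousOn (φ n).continuous.continuousOn).mul_continuousOn (by fun_prop)
    have hg2 : CircleIntegrable (fun ζ => w ζ * (φb n).eval (starRingEnd ℂ ζ)) 0 1 :=
      hw.mul_continuousOn ((φb n).continuous.comp Complex.continuous_conj).continuousOn
    have hBc : ContinuousAt B 0 :=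
      ((recip φb n).continuous.continuousAt.mul
        ((hasDerivAt_circleAverage_kernel zero_le_one hg1 h0).continuousAt.add
          continuousAt_const)).sub ((φ n).continuous.continuousAt.mul
        (hasDerivAt_circleAverage_kernel zero_le_one hg2 h0).continuousAt)
    have hB0 : B 0 ≠ 0 := by
      have h1 : Real.circleAverage (fun ζ => w ζ * (φb n).eval (starRingEnd ℂ ζ)) 0 1 = 0 := by
        have h2 := h.orthonormal 0 n
        have h3 := h.orthonormal 0 0
        have hφ := eq_C_of_natDegree_eq_zero (h.natDegree_left 0)
        rw [if_pos rfl, hφ] at h3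
        rw [if_neg hn.symm, hφ, circleMean_eq_circleAverage] at h2
        simp only [eval_C] at h2 h3
        have h4 : (φ 0).coeff 0 ≠ 0 := by
          intro h5
          rw [h5] at h3
          simp [circleMean, circleIntegral] at h3
        have h6 : (fun ζ => w ζ * (φ 0).coeff 0 * (φb n).eval (starRingEnd ℂ ζ))
            = fun ζ => (φ 0).coeff 0 • (w ζ * (φb n).eval (starRingEnd ℂ ζ)) := by
          ext ζ; simp only [smul_eq_mul]; ring
        rw [h6, Real.circleAverage_fun_smul, smul_eq_mul] at h2
        exact (mul_eq_zero.1 h2).resolve_left h4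
      have h2 : (recip φb n).eval 0 = (φb n).leadingCoeff := by
        rw [← coeff_zero_eq_eval_zero, recip, coeff_reflect, leadingCoeff, h.natDegree_right]
        simp
      simp only [hB]
      rw [circleAverage_kernel_zero, circleAverage_kernel_zero, h1, h2, mul_zero, sub_zero, ← hμ]
      refine mul_ne_zero hκ ?_
      rw [← two_mul]
      exact mul_ne_zero two_ne_zero (h.moment_ne_zero hw n)
    have hev : ∀ᶠ x in 𝓝[≠] (0 : ℂ), x ≠ 0 ∧ ‖x‖ ≠ 1 ∧ B x ≠ 0 := by
      have e1 : ∀ᶠ x in 𝓝 (0 : ℂ), ‖x‖ ≠ 1 :=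
        (continuous_norm.isOpen_preimage _ isOpen_ne).mem_nhds h0
      filter_upwards [self_mem_nhdsWithin, nhdsWithin_le_nhds e1,
        nhdsWithin_le_nhds (hBc.eventually_ne hB0)] with x h1 h2 h3
      exact ⟨h1, h2, h3⟩
    obtain ⟨x, hx0, hx1, hBx⟩ := hev.exists
    refine ⟨x, hx1, ?_⟩
    have : (φ n).eval x * epsStar w φb n x + (recip φb n).eval x * eps w φ n x = x ^ n * B x := by
      rw [eps_eq hw hn hx1, epsStar_eq hw hn hx1, h.kernel_eq_pow_mul hw hn hx1 le_rfl]
      simp only [hB]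
      ring
    rw [this]
    exact mul_ne_zero (pow_ne_zero n hx0) hBx

/-! ### Monodromy -/

/-- Near `γ 1` the determinant is `-A / w` with `A` entire and not identically zero. Thus some point
close to `γ 1` has `Y` invertible and `Y M = Y M'`. -/
theorem IsBiorthonormal.hasMonodromy_unique (h : IsBiorthonormal w φ φb)
    (hw : IsCutWeight z ρ D w) {n : ℕ} {γ : ℝ → ℂ} (hγ : Continuous γ) (hD : γ 1 ∈ D)
    (h1 : ‖γ 1‖ ≠ 1) {M M' : Matrix (Fin 2) (Fin 2) ℂ} (hM : HasMonodromy (Y w φ φb n) γ M)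
    (hM' : HasMonodromy (Y w φ φb n) γ M') : M = M' := by
  have hwi := hw.circleIntegrable
  obtain ⟨Ψ, hΨ, hΨe⟩ := exists_differentiable_psi hwi φ n
  obtain ⟨Ψs, hΨs, hΨse⟩ := exists_differentiable_psiStar hwi h.natDegree_right n
  set A : ℂ → ℂ := fun x => (φ n).eval x * Ψs x + (recip φb n).eval x * Ψ x with hA
  have hAd : Differentiable ℂ A :=
    ((φ n).differentiable.mul hΨs).add ((recip φb n).differentiable.mul hΨ)
  have hAe : ∀ x : ℂ, ‖x‖ ≠ 1 →
      (φ n).eval x * epsStar w φb n x + (recip φb n).eval x * eps w φ n x = A x := by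
    intro x hx
    rw [eps, epsStar, hΨe x hx, hΨse x hx]
    simp only [hA]
    ring
  have hfreq : ∃ᶠ x in 𝓝 (γ 1), A x ≠ 0 := by
    intro hev
    simp only [not_not] at hev
    obtain ⟨x, hx1, hx⟩ := h.exists_det_ne_zero hwi n
    rw [hAe x hx1] at hx
    refine hx (congrFun (AnalyticOnNhd.eq_of_eventuallyEq (f := A) (g := 0)
      (fun y _ => hAd.analyticAt y) (fun y _ => analyticAt_const) hev) x)
  have hne : ∀ᶠ x in 𝓝 (γ 1), x ∈ D ∧ ‖x‖ ≠ 1 := by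
    have e1 : ∀ᶠ x in 𝓝 (γ 1), x ∈ D := hw.isOpen.mem_nhds hD
    have e2 : ∀ᶠ x in 𝓝 (γ 1), ‖x‖ ≠ 1 := (continuous_norm.isOpen_preimage _ isOpen_ne).mem_nhds h1
    exact e1.and e2
  obtain ⟨x, hAx, ⟨hxD, hx1⟩, hY⟩ := (hfreq.and_eventually (hne.and (hM.eventuallyEq hγ hM'))).exists
  have hdet : IsUnit (Y w φ φb n x).det := by
    rw [isUnit_iff_ne_zero, Y, Matrix.det_fin_two_of]
    have hwx := hw.ne_zero x hxD
    have : (φ n).eval x * (-(epsStar w φb n x) / w x) - eps w φ n x / w x * (recip φb n).eval x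
        = -(A x) / w x := by
      rw [← hAe x hx1]
      field_simp
      ring
    rw [this]
    exact div_ne_zero (neg_ne_zero.2 hAx) hwx
  have hY' : Y w φ φb n x * M = Y w φ φb n x * M' := hY
  rw [← Matrix.nonsing_inv_mul_cancel_left _ M hdet, hY', Matrix.nonsing_inv_mul_cancel_left _ _ hdet]

end

section
variable {m : ℕ} {z ρ : Fin m → ℂ} {D : Set ℂ} {w : ℂ → ℂ} {φ φb : ℕ → ℂ[X]}

/-- The continuation, along the circle through `b` about `a`, of a weight `E(x) (x - a)^r`. -/
noncomputable def loopWeight (a b r : ℂ) (ε : ℤ) (γ : ℝ → ℂ) (w E : ℂ → ℂ) (s : ℝ) (x : ℂ) : ℂ :=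
  w b * E x / E b * Complex.exp (r * (Complex.log ((x - a) / (γ s - a))
    + 2 * Real.pi * Complex.I * ε * s))

section
variable {a b r : ℂ} {ε : ℤ} {γ : ℝ → ℂ} {E : ℂ → ℂ}

/-- Replacing the reference point `γ s` by `γ s'` shifts the principal logarithm by exactly the
change of the explicit term `2πiεs`, provided `s'` is close to `s`. -/
theorem loopWeight_eventually_eq (hγ : ∀ s, γ s = a + (b - a) * Complex.exp (2 * Real.pi * Complex.I * ε * s))
    (hab : b ≠ a) (s : ℝ) :
    ∀ᶠ s' in 𝓝 s, loopWeight a b r ε γ w E s' =ᶠ[𝓝 (γ s')] loopWeight a b r ε γ w E s := by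
  have hba : b - a ≠ 0 := sub_ne_zero.2 hab
  have hγa : ∀ s, γ s - a ≠ 0 := fun s => by
    rw [hγ s, add_sub_cancel_left]; exact mul_ne_zero hba (Complex.exp_ne_zero _)
  have hquot : ∀ s', (γ s' - a) / (γ s - a)
      = Complex.exp ((2 * Real.pi * ε * (s' - s) : ℝ) * Complex.I) := by
    intro s'
    rw [div_eq_iff (hγa s), hγ s', hγ s, add_sub_cancel_left, add_sub_cancel_left, mul_left_comm,
      ← Complex.exp_add]
    congr 2
    push_cast
    ring
  have h1 : ∀ᶠ s' in 𝓝 s, |2 * Real.pi * ε * (s' - s)| < Real.pi := by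
    have hc : Continuous fun s' : ℝ => |2 * Real.pi * ε * (s' - s)| := by fun_prop
    refine hc.continuousAt.eventually_lt_const ?_
    simpa using Real.pi_pos
  filter_upwards [h1] with s' hs'
  set θ : ℝ := 2 * Real.pi * ε * (s' - s) with hθ
  have hlogθ : Complex.log (Complex.exp (θ * Complex.I)) = θ * Complex.I := by
    rw [abs_lt] at hs'
    rw [Complex.log_exp] <;> simp [hs'.1, hs'.2.le]
  have hslit : Complex.exp (θ * Complex.I) ∈ Complex.slitPlane := by
    rw [Complex.mem_slitPlane_iff_arg]
    refine ⟨?_, Complex.exp_ne_zero _⟩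
    rw [← Complex.log_im, hlogθ]
    simpa using (abs_lt.1 hs').2.ne
  have hc : ContinuousAt (fun x => Complex.log ((x - a) / (γ s - a))
      - Complex.log ((x - a) / (γ s' - a)) - θ * Complex.I) (γ s') := by
    refine ContinuousAt.sub (ContinuousAt.sub (ContinuousAt.clog (by fun_prop) ?_)
      (ContinuousAt.clog (by fun_prop) ?_)) continuousAt_const
    · rw [hquot]; exact hslit
    · rw [div_self (hγa s')]; exact Complex.one_mem_slitPlane
  have h0 : Complex.log ((γ s' - a) / (γ s - a)) - Complex.log ((γ s' - a) / (γ s' - a))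
      - θ * Complex.I = 0 := by
    rw [hquot, ← hθ, hlogθ, div_self (hγa s'), Complex.log_one]; ring
  have hz := eventually_eq_zero_of_exp_eq_one (h0 ▸ hc.tendsto) (by
    have hne : ∀ᶠ x in 𝓝 (γ s'), x ≠ a := isOpen_ne.mem_nhds (sub_ne_zero.1 (hγa s'))
    filter_upwards [hne] with x hx
    have hxa := sub_ne_zero.2 hx
    have e1 := hγa s
    have e2 := hγa s'
    rw [Complex.exp_sub, Complex.exp_sub, Complex.exp_log (div_ne_zero hxa e1),
      Complex.exp_log (div_ne_zero hxa e2), hθ, ← hquot]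
    field_simp)
  filter_upwards [hz] with x hx
  simp only [loopWeight]
  congr 3
  rw [hθ] at hx
  push_cast at hx
  linear_combination -hx

theorem loopWeight_one (hγ : ∀ s, γ s = a + (b - a) * Complex.exp (2 * Real.pi * Complex.I * ε * s))
    (x : ℂ) : loopWeight a b r ε γ w E 1 x
      = loopWeight a b r ε γ w E 0 x * Complex.exp (2 * Real.pi * Complex.I * (ε * r)) := by
  have h1 : γ 1 = γ 0 := by
    have : Complex.exp (2 * Real.pi * Complex.I * ε * (1 : ℝ)) = 1 := by
      rw [Complex.exp_eq_one_iff]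
      exact ⟨ε, by push_cast; ring⟩
    rw [hγ, hγ, this]
    simp
  rw [loopWeight, loopWeight, h1, mul_assoc (w b * E x / E b), ← Complex.exp_add]
  congr 2
  push_cast
  ring

/-- Both functions have the logarithmic derivative of the weight near `b` and the same value at `b`.
-/
theorem loopWeight_zero_eventually_eq (h : IsCutWeight z ρ D w)
    (hγ : ∀ s, γ s = a + (b - a) * Complex.exp (2 * Real.pi * Complex.I * ε * s))
    (hab : b ≠ a) (hb : b ∈ D) (hE0 : ∀ x, E x ≠ 0) {e : ℂ → ℂ}
    (hE : ∀ᶠ x in 𝓝 b, HasDerivAt E (e x * E x) x)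
    (he : ∀ᶠ x in 𝓝 b, logDer z ρ x = e x + r / (x - a)) :
    loopWeight a b r ε γ w E 0 =ᶠ[𝓝 b] w := by
  have h0 : γ 0 = b := by rw [hγ]; simp
  have hba : b - a ≠ 0 := sub_ne_zero.2 hab
  have hwD : ∀ᶠ x in 𝓝 b, x ∈ D := h.isOpen.mem_nhds hb
  have hslit : ∀ᶠ x in 𝓝 b, (x - a) / (b - a) ∈ Complex.slitPlane := by
    have hc : ContinuousAt (fun x => (x - a) / (b - a)) b := by fun_prop
    refine hc.eventually (Complex.isOpen_slitPlane.mem_nhds ?_)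
    show (b - a) / (b - a) ∈ Complex.slitPlane
    rw [div_self hba]; exact Complex.one_mem_slitPlane
  have hL : ∀ x, loopWeight a b r ε γ w E 0 x
      = w b / E b * (E x * Complex.exp (r * Complex.log ((x - a) / (b - a)))) := by
    intro x
    rw [loopWeight, h0]
    simp only [Complex.ofReal_zero, mul_zero, add_zero]
    ring
  have hd : ∀ᶠ x in 𝓝 b, HasDerivAt (fun y => loopWeight a b r ε γ w E 0 y / w y) 0 x := by
    filter_upwards [hE, he, hwD, hslit] with x h1 h2 h3 h4
    have h5 := ((((hasDerivAt_id x).sub_const a).div_const (b - a)).clog h4).const_mul r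
    have h6 := ((h1.mul h5.cexp).const_mul (w b / E b)).div (h.hasDerivAt x h3) (h.ne_zero x h3)
    have h7 : (fun y => loopWeight a b r ε γ w E 0 y / w y) = fun y =>
        w b / E b * (E y * Complex.exp (r * Complex.log ((y - a) / (b - a)))) / w y := by
      ext y; rw [hL]
    rw [h7]
    refine h6.congr_deriv ?_
    rw [div_eq_zero_iff]
    left
    have hxa : x - a ≠ 0 := fun h' => by
      rw [h', zero_div] at h4
      exact Complex.slitPlane_ne_zero h4 rfl
    simp only [id, Pi.mul_apply]
    rw [h2]
    field_simp
    ring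
  filter_upwards [eventually_eq_of_hasDerivAt_zero hd, hwD] with x h1 h2
  have h3 : loopWeight a b r ε γ w E 0 b = w b := by
    rw [hL, div_self hba, Complex.log_one]
    have := hE0 b
    simp [this]
  rw [h3, div_self (h.ne_zero b hb), div_eq_one_iff_eq (h.ne_zero x h2)] at h1
  exact h1

/-- The monodromy of the fundamental matrix along a circle about a singularity. -/
theorem IsBiorthonormal.hasMonodromy_iff (hφ : IsBiorthonormal w φ φb) (h : IsCutWeight z ρ D w)
    (hγ : ∀ s, γ s = a + (b - a) * Complex.exp (2 * Real.pi * Complex.I * ε * s))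
    (hab : b ≠ a) (hb : b ∈ D) (hb1 : ‖b‖ ≠ 1) {U : Set ℂ} (hU : IsOpen U) (hγU : ∀ s, γ s ∈ U)
    (hE0 : ∀ x, E x ≠ 0) {e : ℂ → ℂ} (hE : ∀ x ∈ U, HasDerivAt E (e x * E x) x)
    (he : ∀ x, x ∈ U → x ≠ a → logDer z ρ x = e x + r / (x - a)) {f : ℂ → ℂ}
    (hf : DifferentiableOn ℂ f U) {C : ℂ} (hF : ∀ᶠ x in 𝓝 b, caratheodory w x = f x + C * w x)
    (n : ℕ) (M : Matrix (Fin 2) (Fin 2) ℂ) :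
    HasMonodromy (Y w φ φb n) γ M ↔ M = monodromyMatrix C (ε * r) := by
  have hγc : Continuous γ := by
    have : γ = fun s : ℝ => a + (b - a) * Complex.exp (2 * Real.pi * Complex.I * ε * s) := funext hγ
    rw [this]; fun_prop
  have hγ0 : γ 0 = b := by rw [hγ]; simp
  have hγ1 : γ 1 = b := by
    have : Complex.exp (2 * Real.pi * Complex.I * ε * (1 : ℝ)) = 1 := by
      rw [Complex.exp_eq_one_iff]
      exact ⟨ε, by push_cast; ring⟩
    rw [hγ, this]; ring
  have hbU : b ∈ U := hγ0 ▸ hγU 0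
  suffices hex : HasMonodromy (Y w φ φb n) γ (monodromyMatrix C (ε * r)) by
    refine ⟨fun hM => ?_, fun hM => hM ▸ hex⟩
    exact hφ.hasMonodromy_unique h hγc (hγ1 ▸ hb) (hγ1 ▸ hb1) hM hex
  have hba : b - a ≠ 0 := sub_ne_zero.2 hab
  have hγa : ∀ s, γ s ≠ a := fun s => by
    rw [← sub_ne_zero, hγ s, add_sub_cancel_left]
    exact mul_ne_zero hba (Complex.exp_ne_zero _)
  have hwi := h.circleIntegrable
  obtain ⟨Ψ, hΨ, hΨe⟩ := exists_differentiable_psi hwi φ n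
  obtain ⟨Ψs, hΨs, hΨse⟩ := exists_differentiable_psiStar hwi hφ.natDegree_right n
  set W := loopWeight a b r ε γ w E with hW
  have hW0 : W 0 =ᶠ[𝓝 b] w := by
    refine loopWeight_zero_eventually_eq h hγ hab hb hE0 (eventually_of_mem (hU.mem_nhds hbU) hE) ?_
    have hne : ∀ᶠ x in 𝓝 b, x ≠ a := isOpen_ne.mem_nhds hab
    filter_upwards [hne, hU.mem_nhds hbU] with x h1 h2 using he x h2 h1
  have hWne : ∀ s x, W s x ≠ 0 := fun s x =>
    mul_ne_zero (div_ne_zero (mul_ne_zero (h.ne_zero b hb) (hE0 x)) (hE0 b)) (Complex.exp_ne_zero _)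
  have hWan : ∀ s, AnalyticAt ℂ (W s) (γ s) := by
    intro s
    have hEan : AnalyticAt ℂ E (γ s) := by
      rw [Complex.analyticAt_iff_eventually_differentiableAt]
      filter_upwards [hU.mem_nhds (hγU s)] with x hx using (hE x hx).differentiableAt
    refine AnalyticAt.mul ((analyticAt_const.mul hEan).div analyticAt_const (hE0 b)) ?_
    refine AnalyticAt.cexp (analyticAt_const.mul (AnalyticAt.add (AnalyticAt.clog ?_ ?_)
      analyticAt_const))
    · exact (analyticAt_id.sub analyticAt_const).div analyticAt_const (sub_ne_zero.2 (hγa s))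
    · show (γ s - a) / (γ s - a) ∈ Complex.slitPlane
      rw [div_self (sub_ne_zero.2 (hγa s))]
      exact Complex.one_mem_slitPlane
  have hfan : ∀ s, AnalyticAt ℂ f (γ s) := fun s => hf.analyticAt (hU.mem_nhds (hγU s))
  have hpan : ∀ (p : ℂ[X]) s, AnalyticAt ℂ (fun x => p.eval x) (γ s) := fun p s =>
    p.differentiable.analyticAt _
  have hb1' : ∀ᶠ x in 𝓝 b, ‖x‖ ≠ 1 := (continuous_norm.isOpen_preimage _ isOpen_ne).mem_nhds hb1
  -- `F` is replaced by `f + C W_s` and `w` by its continuation `W_s`. The summands `C φ_n` and `C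
  -- φ*_n` are single-valued; a turn only multiplies the quotients by `W_s` by `e^{-2πiεr}`.
  set G : ℝ → ℂ → Matrix (Fin 2) (Fin 2) ℂ := fun s x =>
    !![(φ n).eval x, (Ψ x + f x * (φ n).eval x) / W s x + C * (φ n).eval x;
      (recip φb n).eval x,
        -(Ψs x - f x * (recip φb n).eval x) / W s x + C * (recip φb n).eval x] with hG
  have hG0 : G 0 =ᶠ[𝓝 b] Y w φ φb n := by
    filter_upwards [hW0, hF, hb1', h.isOpen.mem_nhds hb] with x h1 h2 h3 h4
    have h5 := h.ne_zero x h4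
    rw [hG, Y, eps, epsStar, h2, hΨe x h3, hΨse x h3]
    simp only [h1]
    congr 1
    ext i j
    fin_cases i <;> fin_cases j <;> simp <;> field_simp <;> ring
  refine ⟨G, fun s _ => ⟨?_, ?_⟩, by rwa [hγ0], ?_⟩
  · intro i j
    fin_cases i <;> fin_cases j
    · exact hpan _ s
    · exact (((hΨ.analyticAt _).add ((hfan s).mul (hpan _ s))).div (hWan s) (hWne s _)).add
        (analyticAt_const.mul (hpan _ s))
    · exact hpan _ s
    · exact ((((hΨs.analyticAt _).sub ((hfan s).mul (hpan _ s))).neg).div (hWan s) (hWne s _)).add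
        (analyticAt_const.mul (hpan _ s))
  · filter_upwards [nhdsWithin_le_nhds (loopWeight_eventually_eq (r := r) (w := w) (E := E) hγ hab s)]
      with s' hs'
    filter_upwards [hs'] with x hx
    simp only [hG, hW, hx]
  · rw [hγ1]
    filter_upwards [hG0, hW0] with x h1 h2
    rw [← h1]
    have h3 : W 1 x = W 0 x * Complex.exp (2 * Real.pi * Complex.I * (ε * r)) :=
      loopWeight_one hγ x
    have h4 := hWne 0 x
    have h5 := Complex.exp_ne_zero (2 * Real.pi * Complex.I * (ε * r))
    simp only [hG, monodromyMatrix, h3, Complex.exp_neg]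
    ext i j
    fin_cases i <;> fin_cases j <;> simp [Matrix.mul_apply, Fin.sum_univ_two] <;> field_simp <;> ring

end

theorem IsBiorthonormal.hasMonodromy_circleLoop_iff (hφ : IsBiorthonormal w φ φb)
    (h : IsCutWeight z ρ D w) {j : Fin m} {b : ℂ} (hb : b ∈ D) (hb1 : ‖b‖ ≠ 1)
    (hbB : b ∈ singDisc z j) {f : ℂ → ℂ} (hf : DifferentiableOn ℂ f (singDisc z j)) {C : ℂ}
    (hF : ∀ᶠ x in 𝓝 b, caratheodory w x = f x + C * w x) (n : ℕ)
    (M : Matrix (Fin 2) (Fin 2) ℂ) :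
    HasMonodromy (Y w φ φb n) (circleLoop (z j) b) M ↔ M = monodromyMatrix C (ρ j) := by
  have key := hφ.hasMonodromy_iff (a := z j) (b := b) (r := ρ j) (ε := 1) (γ := circleLoop (z j) b)
    (E := discFactor z ρ j) (U := singDisc z j) h (fun s => by simp [circleLoop])
    (h.ne_sing b hb j) hb hb1 (isOpen_singDisc z j) (fun s k hk => ?_)
    (discFactor_ne_zero z ρ j) (fun x hx => hasDerivAt_discFactor hx)
    (fun x _ _ => by rw [logDer_eq_add z ρ j]; ring) hf hF n M
  · simpa using key
  · refine lt_of_eq_of_lt ?_ (hbB k hk)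
    have : (2 * Real.pi * Complex.I * s : ℂ) = ((2 * Real.pi * s : ℝ) : ℂ) * Complex.I := by
      push_cast; ring
    rw [circleLoop, dist_eq_norm, dist_eq_norm, add_sub_cancel_left, norm_mul, this,
      Complex.norm_exp_ofReal_mul_I, mul_one]

/-! ### The point at infinity -/

/-- The branch of `∏ (1 - z_k / x)^{ρ_k}` near infinity. -/
noncomputable def inftyFactor (z ρ : Fin m → ℂ) (x : ℂ) : ℂ :=
  Complex.exp (∑ k, ρ k * Complex.log (1 - z k / x))

theorem inftyFactor_ne_zero (z ρ : Fin m → ℂ) (x : ℂ) : inftyFactor z ρ x ≠ 0 :=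
  Complex.exp_ne_zero _

theorem isOpen_inftyDisc (z : Fin m → ℂ) : IsOpen (inftyDisc z) := by
  simp only [inftyDisc, ofPred_forall]
  exact isOpen_iInter_of_finite fun k => isOpen_lt continuous_const continuous_norm

theorem one_sub_div_mem_slitPlane_of_mem_inftyDisc {x : ℂ} (hx : x ∈ inftyDisc z) (k : Fin m) :
    1 - z k / x ∈ Complex.slitPlane := by
  rw [sub_eq_add_neg]
  refine Complex.mem_slitPlane_of_norm_lt_one ?_
  rw [norm_neg, norm_div]
  exact (div_lt_one ((norm_nonneg _).trans_lt (hx k))).2 (hx k)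

theorem ne_zero_of_mem_inftyDisc {x : ℂ} (hx : x ∈ inftyDisc z) (k : Fin m) : x ≠ 0 :=
  norm_pos_iff.1 ((norm_nonneg _).trans_lt (hx k))

theorem ne_sing_of_mem_inftyDisc {x : ℂ} (hx : x ∈ inftyDisc z) (k : Fin m) : x ≠ z k := by
  rintro rfl
  exact lt_irrefl _ (hx k)

theorem hasDerivAt_inftyFactor {x : ℂ} (hx : x ∈ inftyDisc z) :
    HasDerivAt (inftyFactor z ρ) ((∑ k, (ρ k / (x - z k) - ρ k / x)) * inftyFactor z ρ x) x := by
  have h1 : HasDerivAt (fun x => ∑ k, ρ k * Complex.log (1 - z k / x))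
      (∑ k, (ρ k / (x - z k) - ρ k / x)) x := by
    refine HasDerivAt.fun_sum fun k _ => ?_
    have hx0 := ne_zero_of_mem_inftyDisc hx k
    have hs := one_sub_div_mem_slitPlane_of_mem_inftyDisc hx k
    have h2 : HasDerivAt (fun x => 1 - z k / x) (z k / x ^ 2) x := by
      refine (((hasDerivAt_const x (z k)).div (hasDerivAt_id x) hx0).const_sub 1).congr_deriv ?_
      simp only [id]
      field_simp
      ring
    refine ((h2.clog hs).const_mul (ρ k)).congr_deriv ?_
    have h3 := sub_ne_zero.2 (ne_sing_of_mem_inftyDisc hx k)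
    have h4 : 1 - z k / x = (x - z k) / x := by field_simp
    rw [h4]
    field_simp
    ring
  refine h1.cexp.congr_deriv ?_
  rw [inftyFactor]
  ring

theorem logDer_eq_add_infty (z ρ : Fin m → ℂ) (x : ℂ) :
    logDer z ρ x = (∑ k, (ρ k / (x - z k) - ρ k / x)) + (∑ k, ρ k) / (x - 0) := by
  rw [Finset.sum_sub_distrib, sub_zero, Finset.sum_div, logDer]
  ring

/-- The loop is negatively oriented about `0`, where `∑ ρ_k` acts as the exponent; `ε = -1` turns
this into `ρ_∞`. -/
theorem IsBiorthonormal.hasMonodromy_inftyLoop_iff (hφ : IsBiorthonormal w φ φb)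
    (h : IsCutWeight z ρ D w) {b : ℂ} (hb0 : b ≠ 0) (hb : b ∈ D) (hb1 : ‖b‖ ≠ 1)
    (hbB : b ∈ inftyDisc z) {f : ℂ → ℂ} (hf : DifferentiableOn ℂ f (inftyDisc z)) {C : ℂ}
    (hF : ∀ᶠ x in 𝓝 b, caratheodory w x = f x + C * w x) (n : ℕ)
    (M : Matrix (Fin 2) (Fin 2) ℂ) :
    HasMonodromy (Y w φ φb n) (inftyLoop b) M ↔ M = monodromyMatrix C (-∑ k, ρ k) := by
  have key := hφ.hasMonodromy_iff (a := 0) (b := b) (r := ∑ k, ρ k) (ε := -1) (γ := inftyLoop b)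
    (E := inftyFactor z ρ) (U := inftyDisc z) h (fun s => by simp [inftyLoop])
    hb0 hb hb1 (isOpen_inftyDisc z) (fun s k => ?_)
    (inftyFactor_ne_zero z ρ) (fun x hx => hasDerivAt_inftyFactor hx)
    (fun x _ _ => logDer_eq_add_infty z ρ x) hf hF n M
  · simpa using key
  · refine (hbB k).trans_eq ?_
    have : -(2 * Real.pi * Complex.I * s : ℂ) = ((-(2 * Real.pi * s) : ℝ) : ℂ) * Complex.I := by
      push_cast; ring
    rw [inftyLoop, norm_mul, this, Complex.norm_exp_ofReal_mul_I, mul_one]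

end

/-! ### The Carathéodory function near infinity -/

section
variable {m : ℕ} {z ρ : Fin m → ℂ} {D : Set ℂ} {w : ℂ → ℂ}

/-- The kernel tends to `-1` uniformly on the circle: adding `1` leaves `2ζ / (ζ - x)`. -/
theorem IsCutWeight.tendsto_caratheodory_cobounded (h : IsCutWeight z ρ D w) :
    Tendsto (caratheodory w) (Bornology.cobounded ℂ) (𝓝 (-Real.circleAverage w 0 1)) := by
  obtain ⟨K, hK⟩ := h.exists_norm_le
  have hw := h.circleIntegrable
  rw [tendsto_iff_norm_sub_tendsto_zero]
  have hb : Tendsto (fun x : ℂ => 2 / (‖x‖ - 1) * K) (Bornology.cobounded ℂ) (𝓝 0) := by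
    have : Tendsto (fun x : ℂ => ‖x‖ - 1) (Bornology.cobounded ℂ) atTop :=
      tendsto_atTop_add_const_right _ (-1) tendsto_norm_cobounded_atTop
    simpa using (this.const_div_atTop 2).mul_const K
  refine squeeze_zero' (Eventually.of_forall fun _ => norm_nonneg _) ?_ hb
  filter_upwards [tendsto_norm_cobounded_atTop.eventually_gt_atTop 1] with x hx
  have i1 : CircleIntegrable (fun ζ => (ζ + x) / (ζ - x) * w ζ) 0 1 :=
    hw.continuousOn_mul (continuousOn_kernel zero_le_one hx.ne')
  rw [caratheodory_eq, sub_neg_eq_add]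
  simp only
  rw [← Real.circleAverage_fun_add i1 hw, Real.circleAverage_def, norm_smul]
  have hle : ∀ θ ∈ uIoc (0 : ℝ) (2 * Real.pi), ‖(circleMap 0 1 θ + x) / (circleMap 0 1 θ - x)
      * w (circleMap 0 1 θ) + w (circleMap 0 1 θ)‖ ≤ 2 / (‖x‖ - 1) * K := by
    intro θ _
    set ζ := circleMap 0 1 θ with hζ
    have hζ1 : ‖ζ‖ = 1 := by simp [hζ]
    have h0 : ζ - x ≠ 0 := circleMap_sub_ne_zero zero_le_one hx.ne' θ
    have h1 : (ζ + x) / (ζ - x) * w ζ + w ζ = 2 * ζ / (ζ - x) * w ζ := by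
      field_simp
      ring
    have h2 : ‖x‖ - 1 ≤ ‖ζ - x‖ := by
      have := norm_sub_norm_le x ζ
      rwa [hζ1, norm_sub_rev] at this
    rw [h1, norm_mul, norm_div, norm_mul, hζ1, mul_one, Complex.norm_two]
    have : 0 < ‖x‖ - 1 := by linarith
    gcongr
    exact hK ζ hζ1
  have := intervalIntegral.norm_integral_le_of_norm_le_const hle
  rw [sub_zero, abs_of_pos Real.two_pi_pos] at this
  rw [Real.norm_of_nonneg (by positivity)]
  calc (2 * Real.pi)⁻¹ * _ ≤ (2 * Real.pi)⁻¹ * (2 / (‖x‖ - 1) * K * (2 * Real.pi)) := by gcongr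
    _ = _ := by field_simp

/-- When all singularities lie inside the circle, the sum of the exponents is an integer. -/
theorem IsCutWeight.exists_int (h : IsCutWeight z ρ D w) (hz : ∀ k, ‖z k‖ < 1) :
    ∃ n : ℤ, (n : ℂ) = ∑ k, ρ k ∧ ∀ x : ℂ, ‖x‖ = 1 →
      w x = w 1 / inftyFactor z ρ 1 * (x ^ n * inftyFactor z ρ x) := by
  set σ := ∑ k, ρ k with hσ
  have hmem : ∀ x : ℂ, ‖x‖ = 1 → x ∈ inftyDisc z := fun x hx k => by rw [hx]; exact hz k
  have hD : ∀ x : ℂ, ‖x‖ = 1 → x ∈ D := fun x hx =>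
    h.circle_subset x hx (ne_sing_of_mem_inftyDisc (hmem x hx))
  -- The quotient of `w` by its branch `e^{iσθ} ∏ (1 - z_k / x)^{ρ_k}` is constant in `θ`. Comparing
  -- `θ = 0` and `θ = 2π` gives `e^{-2πiσ} = 1`.
  set q : ℝ → ℂ := fun θ => w (Complex.exp (θ * Complex.I)) * Complex.exp (-(σ * (θ * Complex.I)))
    / inftyFactor z ρ (Complex.exp (θ * Complex.I)) with hq
  have hqd : ∀ θ, HasDerivAt q 0 θ := by
    intro θ
    have hx := Complex.norm_exp_ofReal_mul_I θ
    have h1 : HasDerivAt (fun θ : ℝ => (θ : ℂ) * Complex.I) Complex.I θ := by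
      simpa using (Complex.ofRealCLM.hasDerivAt (x := θ)).mul_const Complex.I
    have h2 := h1.cexp
    have h3 := HasDerivAt.comp_of_eq (h₂ := w) θ (h.hasDerivAt _ (hD _ hx)) h2 rfl
    have h4 := HasDerivAt.comp_of_eq (h₂ := inftyFactor z ρ) θ
      (hasDerivAt_inftyFactor (ρ := ρ) (hmem _ hx)) h2 rfl
    have h5 := ((h1.const_mul σ).neg).cexp
    refine ((h3.mul h5).div h4 (inftyFactor_ne_zero _ _ _)).congr_deriv ?_
    rw [div_eq_zero_iff]
    left
    simp only [Function.comp, Pi.mul_apply]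
    rw [logDer_eq_add_infty, sub_zero, ← hσ]
    have := Complex.exp_ne_zero (θ * Complex.I)
    field_simp
    ring
  have hconst : ∀ θ, q θ = w 1 / inftyFactor z ρ 1 := by
    intro θ
    rw [is_const_of_deriv_eq_zero (fun θ => (hqd θ).differentiableAt) (fun θ => (hqd θ).deriv) θ 0]
    simp [hq]
  have h0 : w 1 / inftyFactor z ρ 1 ≠ 0 :=
    div_ne_zero (h.ne_zero 1 (hD 1 norm_one)) (inftyFactor_ne_zero _ _ _)
  have hper : Complex.exp (-(σ * ((2 * Real.pi : ℝ) * Complex.I))) = 1 := by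
    have h1 := hconst (2 * Real.pi)
    simp only [hq] at h1
    have h2 : Complex.exp ((2 * Real.pi : ℝ) * Complex.I) = 1 := by
      push_cast; exact Complex.exp_two_pi_mul_I
    rw [h2, mul_div_right_comm] at h1
    exact mul_left_cancel₀ h0 (h1.trans (mul_one _).symm)
  obtain ⟨n, hn⟩ := Complex.exp_eq_one_iff.1 hper
  have hnσ : ((-n : ℤ) : ℂ) = σ := by
    refine mul_right_cancel₀ Complex.two_pi_I_ne_zero ?_
    push_cast at hn ⊢
    linear_combination hn
  refine ⟨-n, hnσ, fun x hx => ?_⟩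
  have hx' : Complex.exp (x.arg * Complex.I) = x := by
    have := Complex.norm_mul_exp_arg_mul_I x
    rwa [hx, Complex.ofReal_one, one_mul] at this
  have h1 := hconst x.arg
  simp only [hq] at h1
  rw [← h1, hx', Complex.exp_neg, ← hnσ]
  have h2 : Complex.exp (((-n : ℤ) : ℂ) * (x.arg * Complex.I)) = x ^ (-n) := by
    rw [Complex.exp_int_mul, hx']
  rw [h2]
  have hx0 : x ≠ 0 := norm_ne_zero_iff.1 (by rw [hx]; exact one_ne_zero)
  have := inftyFactor_ne_zero z ρ x
  have := zpow_ne_zero (-n) hx0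
  field_simp

theorem circleAverage_eq_of_differentiable_annulus {g : ℂ → ℂ} {r R : ℝ} (h0 : 0 < r) (hle : r ≤ R)
    (hd : ∀ ζ, r ≤ ‖ζ‖ → ‖ζ‖ ≤ R → DifferentiableAt ℂ g ζ) :
    Real.circleAverage g 0 r = Real.circleAverage g 0 R := by
  rw [Real.circleAverage_eq_circleIntegral h0.ne', Real.circleAverage_eq_circleIntegral
    (h0.trans_le hle).ne',
    Complex.circleIntegral_sub_center_inv_smul_eq_of_differentiable_on_annulus_off_countable h0 hle
      countable_empty]
  · intro ζ hζ
    refine (hd ζ ?_ ?_).continuousAt.continuousWithinAt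
    · simpa using hζ.2
    · simpa using hζ.1
  · intro ζ hζ
    refine hd ζ ?_ ?_
    · have := hζ.1.2
      simp only [mem_closedBall_zero_iff, not_le] at this
      exact this.le
    · have := hζ.1.1
      simp only [mem_ball_zero_iff] at this
      exact this.le

theorem circleAverage_kernel_of_lt {r : ℝ} (hr : 0 < r) {x : ℂ} (hx : r < ‖x‖) :
    Real.circleAverage (fun ζ => (ζ + x) / (ζ - x)) 0 r = -1 := by
  have hr0 : (r : ℂ) ≠ 0 := by exact_mod_cast hr.ne'
  have h1 : 1 < ‖x / r‖ := by
    rw [norm_div, Complex.norm_real, Real.norm_of_nonneg hr.le, one_lt_div hr]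
    exact hx
  have h2 := circleAverage_kernel_one h1.ne'
  rw [if_neg h1.not_gt] at h2
  rw [← h2, Real.circleAverage_def, Real.circleAverage_def]
  congr 2
  ext θ
  have h3 : circleMap 0 r θ = r * circleMap 0 1 θ := by simp [circleMap]
  have h4 := circleMap_sub_ne_zero zero_le_one h1.ne' θ
  have h5 := circleMap_sub_ne_zero hr.le hx.ne' θ
  rw [h3] at h5 ⊢
  rw [div_eq_div_iff h5 h4]
  field_simp

/-- The decomposition of the Carathéodory function near infinity. -/
theorem IsCutWeight.exists_infty_solution (h : IsCutWeight z ρ D w) (hm : Nonempty (Fin m)) :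
    ∃ f : ℂ → ℂ, DifferentiableOn ℂ f (inftyDisc z) ∧
      (∃ l : ℂ, Tendsto f (Bornology.cobounded ℂ) (𝓝 l)) ∧
      (∀ x ∈ inftyDisc z, 1 < ‖x‖ → caratheodory w x = f x) ∧
      ∀ x ∈ inftyDisc z, ‖x‖ < 1 → ∃ n : ℤ, (n : ℂ) = ∑ k, ρ k ∧
        caratheodory w x - f x = 2 * (w 1 / inftyFactor z ρ 1 * (x ^ n * inftyFactor z ρ x)) := by
  by_cases hz : ∀ k, ‖z k‖ < 1
  swap
  · push Not at hz
    obtain ⟨k, hk⟩ := hz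
    refine ⟨caratheodory w, fun x hx => ?_, ⟨_, h.tendsto_caratheodory_cobounded⟩, fun _ _ _ => rfl,
      fun x hx hx1 => absurd (hx k) (by linarith)⟩
    exact (h.differentiableAt_caratheodory (hk.trans_lt (hx k)).ne').differentiableWithinAt
  obtain ⟨n, hn, hwn⟩ := h.exists_int hz
  obtain ⟨k₀, -, hk₀⟩ := Finset.univ.exists_max_image (fun k => ‖z k‖)
    (Finset.univ_nonempty_iff.2 hm)
  set r₀ := ‖z k₀‖ with hr₀
  have hr00 : 0 ≤ r₀ := norm_nonneg _
  have hr01 : r₀ < 1 := hz k₀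
  have hdisc : ∀ x, x ∈ inftyDisc z ↔ r₀ < ‖x‖ := fun x =>
    ⟨fun hx => hx k₀, fun hx k => (hk₀ k (Finset.mem_univ k)).trans_lt hx⟩
  -- `v` extends the restriction of `w` to the circle holomorphically to `|x| > r₀`, so the contour
  -- may be moved in that region.
  set v : ℂ → ℂ := fun x => w 1 / inftyFactor z ρ 1 * (x ^ n * inftyFactor z ρ x) with hv
  have hvd : ∀ x, r₀ < ‖x‖ → DifferentiableAt ℂ v x := fun x hx =>
    (((differentiableAt_zpow.2 (Or.inl (ne_zero_of_mem_inftyDisc ((hdisc x).2 hx) k₀)))).mul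
      (hasDerivAt_inftyFactor ((hdisc x).2 hx)).differentiableAt).const_mul _
  have hvi : ∀ r, r₀ < r → CircleIntegrable v 0 r := fun r hr => by
    refine ContinuousOn.circleIntegrable (hr00.trans hr.le) fun ζ hζ => ?_
    refine (hvd ζ ?_).continuousAt.continuousWithinAt
    rw [mem_sphere_zero_iff_norm.1 hζ]
    exact hr
  set S : ℝ → ℂ → ℂ := fun r x => Real.circleAverage (fun ζ => (ζ + x) / (ζ - x) * v ζ) 0 r with hS
  have hSle : ∀ {x : ℂ} {r r' : ℝ}, r₀ < r → r ≤ r' → r' < ‖x‖ → S r x = S r' x := by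
    intro x r r' h1 h2 h3
    refine circleAverage_eq_of_differentiable_annulus (hr00.trans_lt h1) h2 fun ζ h4 h5 => ?_
    refine DifferentiableAt.mul (DifferentiableAt.div (by fun_prop) (by fun_prop) ?_)
      (hvd ζ (h1.trans_le h4))
    rw [sub_ne_zero]
    rintro rfl
    linarith
  have hSeq : ∀ {x : ℂ} {r r' : ℝ}, r₀ < r → r₀ < r' → r < ‖x‖ → r' < ‖x‖ → S r x = S r' x := by
    intro x r r' h1 h2 h3 h4
    rcases le_total r r' with hle | hle
    · exact hSle h1 hle h4
    · exact (hSle h2 hle h3).symm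
  have hF : caratheodory w = S 1 := by
    rw [caratheodory_eq]
    ext x
    refine Real.circleAverage_congr_sphere fun ζ hζ => ?_
    rw [hwn ζ (by simpa using hζ)]
  -- A radius strictly between `r₀` and `min 1 |x|`. The average does not depend on the admissible
  -- radius, so the choice depending on `x` still gives a holomorphic function.
  set R : ℂ → ℝ := fun x => (r₀ + min 1 ‖x‖) / 2 with hR
  have hR0 : ∀ x, r₀ < ‖x‖ → r₀ < R x ∧ R x < ‖x‖ ∧ R x < 1 := by
    intro x hx
    have h1 : r₀ < min 1 ‖x‖ := lt_min hr01 hx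
    have h2 := min_le_left 1 ‖x‖
    have h3 := min_le_right 1 ‖x‖
    exact ⟨by simp only [hR]; linarith, by simp only [hR]; linarith, by simp only [hR]; linarith⟩
  have hout : ∀ x : ℂ, 1 < ‖x‖ → caratheodory w x = S (R x) x := by
    intro x hx
    obtain ⟨h1, h2, -⟩ := hR0 x (hr01.trans hx)
    rw [hF]
    exact hSeq hr01 h1 hx h2
  refine ⟨fun x => S (R x) x, fun x hx => ?_, ⟨_, h.tendsto_caratheodory_cobounded.congr' ?_⟩,
    fun x _ hx1 => hout x hx1, fun x hx hx1 => ⟨n, hn, ?_⟩⟩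
  · rw [hdisc] at hx
    obtain ⟨h1, h2, -⟩ := hR0 x hx
    have h3 : (fun y => S (R y) y) =ᶠ[𝓝 x] S (R x) := by
      filter_upwards [continuous_norm.continuousAt.eventually_const_lt h2] with y hy
      obtain ⟨h4, h5, -⟩ := hR0 y (h1.trans hy)
      exact hSeq h4 h1 h5 hy
    exact (h3.differentiableAt_iff.2 (hasDerivAt_circleAverage_kernel (hr00.trans h1.le)
      (hvi _ h1) h2.ne').differentiableAt).differentiableWithinAt
  · filter_upwards [tendsto_norm_cobounded_atTop.eventually_gt_atTop 1] with x hx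
    exact hout x hx
  · rw [hdisc] at hx
    obtain ⟨h1, h2, h3⟩ := hR0 x hx
    have hpos := hr00.trans_lt h1
    rw [hF]
    simp only
    have hopen : IsOpen {y : ℂ | r₀ < ‖y‖} := isOpen_lt continuous_const continuous_norm
    -- Subtracting `v x` removes the pole at `ζ = x`, so the radii `R x` and `1` can be compared
    -- across `x`. The averages `-1` and `1` of the kernel there produce the difference `2 v x`.
    have hdd : DifferentiableOn ℂ (dslope v x) {y : ℂ | r₀ < ‖y‖} :=
      (Complex.differentiableOn_dslope (hopen.mem_nhds hx)).2
        fun y hy => (hvd y hy).differentiableWithinAt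
    have key := circleAverage_eq_of_differentiable_annulus
      (g := fun ζ => (ζ + x) * dslope v x ζ) hpos h3.le fun ζ h4 _ =>
        DifferentiableAt.mul (by fun_prop)
          (hdd.differentiableAt (hopen.mem_nhds (h1.trans_le h4)))
    have hexp : ∀ r, r₀ < r → ‖x‖ ≠ r → Real.circleAverage (fun ζ => (ζ + x) * dslope v x ζ) 0 r
        = S r x - v x * Real.circleAverage (fun ζ => (ζ + x) / (ζ - x)) 0 r := by
      intro r hr hxr
      have hr' : 0 ≤ r := hr00.trans hr.le
      have hK := continuousOn_kernel hr' hxr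
      have i1 : CircleIntegrable (fun ζ => (ζ + x) / (ζ - x) * v ζ) 0 r :=
        (hvi r hr).continuousOn_mul hK
      have i2 : CircleIntegrable (fun ζ => (ζ + x) / (ζ - x)) 0 r := hK.circleIntegrable'
      rw [← smul_eq_mul (v x), ← Real.circleAverage_fun_smul,
        ← Real.circleAverage_fun_sub i1 (i2.fun_const_smul _)]
      refine Real.circleAverage_congr_sphere fun ζ hζ => ?_
      have hne : ζ ≠ x := by
        rintro rfl
        rw [mem_sphere_zero_iff_norm, abs_of_nonneg hr'] at hζ
        exact hxr hζ
      rw [dslope_of_ne _ hne, slope_def_field, smul_eq_mul]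
      ring
    rw [hexp _ h1 h2.ne', hexp 1 hr01 hx1.ne, circleAverage_kernel_one hx1.ne, if_pos hx1,
      circleAverage_kernel_of_lt hpos h2] at key
    linear_combination -key

end

/-! ### Constancy in time at infinity -/

section
variable {m : ℕ} {I : Set ℝ} {D : Set (ℝ × ℂ)} {z : Fin m → ℝ → ℂ} {ρ : Fin m → ℂ}
  {w : ℝ → ℂ → ℂ}

/-- Near infinity the coefficient of the weight in the Carathéodory function is constant in
time. -/
theorem IsDeformation.exists_connection_coeff_infty (hw : IsDeformation I D z ρ w)
    {b : ℝ → ℂ} (hb : ContinuousOn b I)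
    (hb' : ∀ t ∈ I, (t, b t) ∈ D ∧ ‖b t‖ ≠ 1 ∧ b t ∈ inftyDisc (fun k => z k t)) :
    ∃ C : ℂ, ∀ t ∈ I, ∃ f : ℂ → ℂ, DifferentiableOn ℂ f (inftyDisc (fun k => z k t)) ∧
      (∃ l : ℂ, Tendsto f (Bornology.cobounded ℂ) (𝓝 l)) ∧
      ∀ᶠ x in 𝓝 (b t), caratheodory (w t) x = f x + C * w t x := by
  rcases I.eq_empty_or_nonempty with rfl | ⟨t₁, ht₁⟩
  · exact ⟨0, fun t ht => absurd ht (notMem_empty t)⟩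
  obtain ⟨k₀, -⟩ := hw.sing_zero
  have hex : ∀ t, ∃ f, t ∈ I → DifferentiableOn ℂ f (inftyDisc (fun k => z k t)) ∧
      (∃ l : ℂ, Tendsto f (Bornology.cobounded ℂ) (𝓝 l)) ∧
      (∀ x ∈ inftyDisc (fun k => z k t), 1 < ‖x‖ → caratheodory (w t) x = f x) ∧
      ∀ x ∈ inftyDisc (fun k => z k t), ‖x‖ < 1 → ∃ n : ℤ, (n : ℂ) = ∑ k, ρ k ∧
        caratheodory (w t) x - f x = 2 * (w t 1 / inftyFactor (fun k => z k t) ρ 1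
          * (x ^ n * inftyFactor (fun k => z k t) ρ x)) := by
    intro t
    by_cases ht : t ∈ I
    · obtain ⟨f, hf⟩ := (hw.isCutWeight ht).exists_infty_solution ⟨k₀⟩
      exact ⟨f, fun _ => hf⟩
    · exact ⟨0, fun h => absurd h ht⟩
  choose f hf using hex
  have hloc : ∀ t₀ ∈ I, ∀ᶠ t in 𝓝 t₀, (caratheodory (w t) (b t) - f t (b t)) / w t (b t)
      = (caratheodory (w t₀) (b t₀) - f t₀ (b t₀)) / w t₀ (b t₀) := by
    intro t₀ ht₀
    obtain ⟨hbD, hb1, hbB⟩ := hb' t₀ ht₀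
    have hbc := hb.continuousAt (hw.isOpen_time.mem_nhds ht₀)
    have hzc := hw.continuousAt_sing ht₀
    have hI : ∀ᶠ t in 𝓝 t₀, t ∈ I := hw.isOpen_time.mem_nhds ht₀
    have hcw := hw.isCutWeight ht₀
    rcases lt_or_gt_of_ne hb1 with hlt | hgt
    · have hzlt : ∀ k, ‖z k t₀‖ < 1 := fun k => (hbB k).trans hlt
      have hb0 : b t₀ ≠ 0 := ne_zero_of_mem_inftyDisc hbB k₀
      have h1mem : ∀ t, (∀ k, ‖z k t‖ < 1) → (1 : ℂ) ∈ inftyDisc (fun k => z k t) := fun t ht k => by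
        rw [norm_one]; exact ht k
      obtain ⟨n, hn, -⟩ := (hf t₀ ht₀).2.2.2 _ hbB hlt
      obtain ⟨l, hlc, -, hl⟩ := exists_continuousAt_log hbc (Complex.exp_log hb0)
      have hzev : ∀ᶠ t in 𝓝 t₀, ∀ k, ‖z k t‖ < 1 := by
        rw [eventually_all]
        exact fun k => (hzc k).norm.eventually_lt_const (hzlt k)
      have e1 := hw.weight_eventually_eq ht₀ (x := fun _ => 1) continuousAt_const
        (hcw.circle_subset 1 norm_one (ne_sing_of_mem_inftyDisc (h1mem t₀ hzlt)))
        (l := fun k t => Complex.log (1 - z k t / 1))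
        (fun k => ContinuousAt.clog (continuousAt_const.sub ((hzc k).div_const 1))
          (one_sub_div_mem_slitPlane_of_mem_inftyDisc (h1mem t₀ hzlt) k))
        (by
          filter_upwards [hzev] with t ht k
          rw [Complex.exp_log (Complex.slitPlane_ne_zero
            (one_sub_div_mem_slitPlane_of_mem_inftyDisc (h1mem t ht) k)), div_one])
      have e2 := hw.weight_eventually_eq ht₀ hbc hbD
        (l := fun k t => l t + Complex.log (1 - z k t / b t))
        (fun k => hlc.add (ContinuousAt.clog (continuousAt_const.sub ((hzc k).div hbc hb0))
          (one_sub_div_mem_slitPlane_of_mem_inftyDisc hbB k)))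
        (by
          filter_upwards [hI, hl] with t ht h1 k
          have hbt := (hb' t ht).2.2
          have := ne_zero_of_mem_inftyDisc hbt k
          rw [Complex.exp_add, h1, Complex.exp_log (Complex.slitPlane_ne_zero
            (one_sub_div_mem_slitPlane_of_mem_inftyDisc hbt k))]
          field_simp)
      -- `C` is twice the ratio of two values of `w` over a continuous branch of `∏ (x -
      -- z_k)^{ρ_k}`, at `x = 1` and at the base point. Integrality of `∑ ρ_k` turns `e^{n l}` into
      -- the power `b^n`.
      have hform : ∀ᶠ t in 𝓝 t₀, (caratheodory (w t) (b t) - f t (b t)) / w t (b t)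
          = 2 * ((w t 1 * Complex.exp (-∑ k, ρ k * Complex.log (1 - z k t / 1)))
            / (w t (b t) * Complex.exp (-∑ k, ρ k * (l t + Complex.log (1 - z k t / b t))))) := by
        filter_upwards [hI, hl, hbc.norm.eventually_lt_const hlt] with t ht h1 h2
        obtain ⟨n', hn', hfn⟩ := (hf t ht).2.2.2 _ (hb' t ht).2.2 h2
        obtain rfl : n' = n := by
          have := hn'.trans hn.symm
          exact_mod_cast this
        have hwb := (hw.isCutWeight ht).ne_zero _ (hb' t ht).1
        have hsum : ∑ k, ρ k * (l t + Complex.log (1 - z k t / b t))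
            = n' * l t + ∑ k, ρ k * Complex.log (1 - z k t / b t) := by
          rw [hn', Finset.sum_mul, ← Finset.sum_add_distrib]
          exact Finset.sum_congr rfl fun k _ => by ring
        rw [hfn, hsum, neg_add, Complex.exp_add, Complex.exp_neg, Complex.exp_neg, Complex.exp_neg,
          Complex.exp_int_mul, h1]
        have hbt0 := ne_zero_of_mem_inftyDisc (hb' t ht).2.2 k₀
        have := zpow_ne_zero n' hbt0
        have h4 := inftyFactor_ne_zero (fun k => z k t) ρ (b t)
        have h5 := inftyFactor_ne_zero (fun k => z k t) ρ 1
        change _ = 2 * (w t 1 * (inftyFactor (fun k => z k t) ρ 1)⁻¹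
          / (w t (b t) * ((b t ^ n')⁻¹ * (inftyFactor (fun k => z k t) ρ (b t))⁻¹)))
        field_simp
      filter_upwards [hform, e1, e2] with t h1 h2 h3
      rw [h1, h2, h3, hform.self_of_nhds]
    · have h0 : ∀ᶠ t in 𝓝 t₀, caratheodory (w t) (b t) = f t (b t) := by
        filter_upwards [hI, hbc.norm.eventually_const_lt hgt] with t ht h1
        exact (hf t ht).2.2.1 _ (hb' t ht).2.2 h1
      filter_upwards [h0] with t ht
      rw [ht, h0.self_of_nhds, sub_self, sub_self, zero_div, zero_div]
  refine ⟨(caratheodory (w t₁) (b t₁) - f t₁ (b t₁)) / w t₁ (b t₁), fun t ht =>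
    ⟨f t, (hf t ht).1, (hf t ht).2.1, ?_⟩⟩
  rw [eq_of_eventually_eq_of_isPreconnected hw.isPreconnected_time
    (f := fun t => (caratheodory (w t) (b t) - f t (b t)) / w t (b t))
    (fun s hs => eventually_nhdsWithin_of_eventually_nhds (hloc s hs)) ht₁ ht]
  obtain ⟨hbD, hb1, hbB⟩ := hb' t ht
  have hcw := hw.isCutWeight ht
  have hB : ∀ᶠ x in 𝓝 (b t), x ∈ inftyDisc (fun k => z k t) := (isOpen_inftyDisc _).mem_nhds hbB
  have hD : ∀ᶠ x in 𝓝 (b t), x ∈ {x | (t, x) ∈ D} := hcw.isOpen.mem_nhds hbD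
  rcases lt_or_gt_of_ne hb1 with hlt | hgt
  · obtain ⟨n, hn, hfn⟩ := (hf t ht).2.2.2 _ hbB hlt
    set v : ℂ → ℂ := fun x => 2 * (w t 1 / inftyFactor (fun k => z k t) ρ 1
      * (x ^ n * inftyFactor (fun k => z k t) ρ x)) with hv
    have hd : ∀ᶠ x in 𝓝 (b t), HasDerivAt (fun y => v y / w t y) 0 x := by
      filter_upwards [hB, hD] with x h1 h2
      have hx0 := ne_zero_of_mem_inftyDisc h1 k₀
      refine ((((((hasDerivAt_zpow n x (Or.inl hx0)).mul (hasDerivAt_inftyFactor h1)).const_mul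
        _).const_mul 2)).div (hcw.hasDerivAt x h2) (hcw.ne_zero x h2)).congr_deriv ?_
      rw [div_eq_zero_iff]
      left
      rw [logDer_eq_add_infty, ← hn, zpow_sub_one₀ hx0]
      simp only [Pi.mul_apply]
      field_simp
      ring
    filter_upwards [eventually_eq_of_hasDerivAt_zero hd, hB, hD,
      continuous_norm.continuousAt.eventually_lt_const hlt] with x h1 h2 h3 h4
    obtain ⟨n', hn', hfx⟩ := (hf t ht).2.2.2 _ h2 h4
    obtain rfl : n' = n := by
      have := hn'.trans hn.symm
      exact_mod_cast this
    rw [hfn]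
    have h5 : v (b t) / w t (b t) * w t x = v x := by
      rw [← h1, div_mul_cancel₀ _ (hcw.ne_zero x h3)]
    simp only [hv] at h5
    rw [h5, ← hfx]
    ring
  · filter_upwards [hB, continuous_norm.continuousAt.eventually_const_lt hgt] with x h1 h2
    rw [(hf t ht).2.2.1 _ h1 h2, (hf t ht).2.2.1 _ hbB hgt, sub_self, zero_div, zero_mul, add_zero]

end

end Semiclassical

theorem mainTheorem11 {m : ℕ} (I : Set ℝ) (D : Set (ℝ × ℂ)) (z : Fin m → ℝ → ℂ)
    (ρ : Fin m → ℂ) (w : ℝ → ℂ → ℂ) (hw : IsDeformation I D z ρ w) :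
    (∀ (j : Fin m) (b : ℝ → ℂ), ContinuousOn b I →
      (∀ t ∈ I, (t, b t) ∈ D ∧ ‖b t‖ ≠ 1 ∧ b t ∈ singDisc (fun k => z k t) j) →
      ∃ C : ℂ, ∀ t ∈ I,
        (∃ f : ℂ → ℂ, DifferentiableOn ℂ f (singDisc (fun k => z k t) j) ∧
          ∀ᶠ x in 𝓝 (b t), caratheodory (w t) x = f x + C * w t x) ∧
        ∀ φ φb : ℕ → ℂ[X], IsBiorthonormal (w t) φ φb → ∀ n : ℕ,
          ∀ M : Matrix (Fin 2) (Fin 2) ℂ,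
            HasMonodromy (Y (w t) φ φb n) (circleLoop (z j t) (b t)) M ↔
              M = monodromyMatrix C (ρ j)) ∧
    (∀ b : ℝ → ℂ, ContinuousOn b I →
      (∀ t ∈ I, (t, b t) ∈ D ∧ ‖b t‖ ≠ 1 ∧ b t ∈ inftyDisc (fun k => z k t)) →
      ∃ C : ℂ, ∀ t ∈ I,
        (∃ f : ℂ → ℂ, DifferentiableOn ℂ f (inftyDisc (fun k => z k t)) ∧
          (∃ l : ℂ, Tendsto f (Bornology.cobounded ℂ) (𝓝 l)) ∧
          ∀ᶠ x in 𝓝 (b t), caratheodory (w t) x = f x + C * w t x) ∧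
        ∀ φ φb : ℕ → ℂ[X], IsBiorthonormal (w t) φ φb → ∀ n : ℕ,
          ∀ M : Matrix (Fin 2) (Fin 2) ℂ,
            HasMonodromy (Y (w t) φ φb n) (inftyLoop (b t)) M ↔
              M = monodromyMatrix C (-∑ j, ρ j)) := by
  refine ⟨fun j b hb hb' => ?_, fun b hb hb' => ?_⟩
  · obtain ⟨C, hC⟩ := hw.exists_connection_coeff j hb hb'
    refine ⟨C, fun t ht => ⟨hC t ht, fun φ φb hφ n M => ?_⟩⟩
    obtain ⟨f, hf, hF⟩ := hC t ht
    exact hφ.hasMonodromy_circleLoop_iff (hw.isCutWeight ht) (hb' t ht).1 (hb' t ht).2.1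
      (hb' t ht).2.2 hf hF n M
  · obtain ⟨C, hC⟩ := hw.exists_connection_coeff_infty hb hb'
    refine ⟨C, fun t ht => ⟨hC t ht, fun φ φb hφ n M => ?_⟩⟩
    obtain ⟨f, hf, -, hF⟩ := hC t ht
    obtain ⟨k, -⟩ := hw.sing_zero
    exact hφ.hasMonodromy_inftyLoop_iff (hw.isCutWeight ht)
      (ne_zero_of_mem_inftyDisc (hb' t ht).2.2 k) (hb' t ht).1 (hb' t ht).2.1
      (hb' t ht).2.2 hf hF n M
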